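/- Let $\gamma=\{\gamma(u),u\ge 0\}$ be a piecewise constant nondecreasing process with $\gamma(0)=0$ and unit jumps at random points $0=\tau_0<\tau_1<\tau_2<\cdots$ with $\tau_k\to\infty$ (where $\tau_k=\infty$ is allowed and means that the $k$-th jump does not occur), that is, $$\gamma(u)=\sum_{k=0}^{\infty}k\,\mathbf 1(\tau_k\le u<\tau_{k+1}),\qquad u\ge 0 .$$ Let $1<\alpha<2$, let $c_0>0$, and let $a_j\ge 0$ $(j=0,1,2,\dots)$ satisfy $a_j=c_0j^{-\alpha}(1+o(1))$ as $j\to\infty$. Assume: (i) $\mathbb P(0<\tau_1\le u)=\int_0^u\theta(y)\,dy$ for all $u\ge 0$, where $\theta\ge 0$ is a bounded measurable function with $\lim_{u\to 0+}\theta(u)=1$; (ii) there is $\delta>2(\alpha-1)$ with $\mathbb E\,\gamma(u)^{2+\delta}<\infty$ for all $u>0$; (iii) $\mathbb E\,\gamma(u)^2\mathbf 1(\tau_2\le u)=O(u^2)$ as $u\to 0+$. Let $\gamma_k$, $k\in\mathbb Z$, be independent copies of $\gamma$, and let $$X_k=\sum_{j=0}^{\infty}\gamma_{k-j}(a_j)\quad(k\in\mathbb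 Z),\qquad S_n=\sum_{k=1}^nX_k .$$ Then each of the series $X_k$ converges almost surely and $X_k$ is integrable, and, as $n\to\infty$, $$n^{-1/\alpha}\big(S_{[nt]}-\mathbb E S_{[nt]}\big)\ \longrightarrow\ L_\alpha(t),\qquad t\ge 0,$$ in the sense of convergence of all finite-dimensional distributions, where $L_\alpha$ is the (existing, and unique in law) homogeneous $\alpha$-stable Lévy process with characteristic function $$\mathbb E\,e^{izL_\alpha(t)}=\exp\Big\{-t|z|^{\alpha}\,\frac{c_0\,\Gamma(2-\alpha)}{1-\alpha}\Big(\cos\big(\tfrac{\pi\alpha}{2}\big)-i\,\mathrm{sgn}(z)\sin\big(\tfrac{\pi\alpha}{2}\big)\Big)\Big\},\qquad z\in\mathbb R .$$ -/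

import Mathlib

open MeasureTheory ProbabilityTheory Filter Topology Asymptotics
open scoped NNReal ENNReal

noncomputable section

/-- A sequence of jump times `0 = τ₀ < τ₁ < τ₂ < ⋯ ≤ ∞` tending to `∞`, so that only finitely many
jumps occur on bounded intervals. The value `∞` means that the jump never occurs; from the first
infinite time on, all later times are infinite. -/
structure IsJumpSequence (τ : ℕ → ℝ≥0∞) : Prop where
  zero : τ 0 = 0
  lt_succ : ∀ k, τ k ≠ ∞ → τ k < τ (k + 1)
  top_succ : ∀ k, τ k = ∞ → τ (k + 1) = ∞
  tendsto_top : Tendsto τ atTop (𝓝 ∞)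

/-- The path `u ↦ ∑ k, k · 1(τ_k ≤ u < τ_{k+1})` with unit jumps at `τ₁, τ₂, …`. -/
def jumpPath (τ : ℕ → ℝ≥0∞) (u : ℝ≥0) : ℝ :=
  ∑' k : ℕ, (Set.Ico (τ k) (τ (k + 1))).indicator (fun _ ↦ (k : ℝ)) (u : ℝ≥0∞)

/-- The unit-jump seed process with random jump times `τ`. -/
def seedProcess {Ω : Type*} (τ : ℕ → Ω → ℝ≥0∞) (u : ℝ≥0) (ω : Ω) : ℝ :=
  jumpPath (fun k ↦ τ k ω) u

/-- `γ k`, `k ∈ ℤ`, are independent copies of the process `g`: they are independent as processes,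
and each has the law of `g` on the product space `ℝ≥0 → ℝ`. -/
structure IsIIDCopies {Ω Ω₀ : Type*} [MeasurableSpace Ω] [MeasurableSpace Ω₀]
    (γ : ℤ → ℝ≥0 → Ω → ℝ) (P : Measure Ω) (g : ℝ≥0 → Ω₀ → ℝ) (P₀ : Measure Ω₀) : Prop where
  measurable : ∀ k u, Measurable (γ k u)
  indep : iIndepFun (fun (k : ℤ) (ω : Ω) (u : ℝ≥0) ↦ γ k u ω) P
  ident : ∀ k, IdentDistrib (fun (ω : Ω) (u : ℝ≥0) ↦ γ k u ω) (fun (ω : Ω₀) (u : ℝ≥0) ↦ g u ω) P P₀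

/-- The trawl process `X_k = ∑_{j ≥ 0} γ_{k-j}(a_j)`. -/
def trawl {Ω : Type*} (γ : ℤ → ℝ≥0 → Ω → ℝ) (a : ℕ → ℝ≥0) (k : ℤ) (ω : Ω) : ℝ :=
  ∑' j : ℕ, γ (k - j) (a j) ω

/-- The partial sums `S_n = X_1 + ⋯ + X_n`. -/
def trawlSum {Ω : Type*} (γ : ℤ → ℝ≥0 → Ω → ℝ) (a : ℕ → ℝ≥0) (n : ℕ) (ω : Ω) : ℝ :=
  ∑ k ∈ Finset.Icc 1 n, trawl γ a (k : ℤ) ω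

/-- A (homogeneous, real-valued) Lévy process: it starts at zero, has independent and stationary
increments and is continuous in probability. -/
structure IsLevyProcess {Ω : Type*} [MeasurableSpace Ω] (L : ℝ≥0 → Ω → ℝ) (Q : Measure Ω) :
    Prop where
  measurable : ∀ t, Measurable (L t)
  zero : ∀ᵐ ω ∂Q, L 0 ω = 0
  indep : HasIndepIncrements L Q
  stationary : ∀ s h, IdentDistrib (fun ω ↦ L (s + h) ω - L s ω) (L h) Q Q
  continuous : ∀ t, TendstoInMeasure Q L (𝓝 t) (L t)

/-- The totally skewed `α`-stable Lévy process with scale `c₀`, given by its characteristic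
function. -/
structure IsSkewedStableLevy {Ω : Type*} [MeasurableSpace Ω] (α c₀ : ℝ) (L : ℝ≥0 → Ω → ℝ)
    (Q : Measure Ω) : Prop where
  levy : IsLevyProcess L Q
  charFun_eq : ∀ (t : ℝ≥0) (z : ℝ), charFun (Q.map (L t)) z =
    Complex.exp (-((t : ℝ) * |z| ^ α * (c₀ * Real.Gamma (2 - α) / (1 - α)) : ℝ) *
      ((Real.cos (Real.pi * (α / 2)) : ℝ) -
        Complex.I * (Real.sign z : ℝ) * (Real.sin (Real.pi * (α / 2)) : ℝ)))

end

open MeasureTheory ProbabilityTheory Filter Topology Asymptotics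
open scoped NNReal ENNReal

noncomputable section

/-! Regroup the double sum by seeds. The seed with index `s` contributes `γ_s(a_j)` at time `s + j`,
so up to boundary effects `S_N` is the sum over `s ≤ N` of the i.i.d. variables `Z_s = ∑_j
γ_s(a_j)`. For fixed `j`, replacing `γ_{k-j}(a_j)` by `γ_k(a_j)` in the sum over `k` costs at most
`2 e_j min(j, N)` in `L¹`, where `e_j = O(j^{-α})` bounds the first moments; interpolating the
minimum makes the total error `O(N^{1-κ})` with `1 - κ < 1/α`.

Next split `γ_s(a_j)` into its truncation at one and its excess. The excess vanishes unless the
second jump occurs before `a_j`, so its `L²` norm is `O(a_j)`, which is summable; the centred sums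
of excesses are therefore `O(√N)`, negligible against `N^{1/α}`. Both reductions are
`exists_integral_abs_trawlSum_sub_le`.

What remains is `W_s = ∑_j min(γ_s(a_j), 1)`, the number `A(τ₁)` of indices with `a_j ≥ τ₁`
(`truncatedSum_seedProcess`). Since `A(y) ~ (c₀/y)^{1/α}` at zero (`tendsto_countGe_mul_rpow`) and
`τ₁` has density tending to one there, the substitution `y = w/n` gives `n E[e^{ixW} - 1 - ixW] →
∫₀^∞ (e^{iv} - 1 - iv) dw`, with `x = z n^{-1/α}` and `v = z (c₀/w)^{1/α}`
(`tendsto_integral_compExp_countGe`). This integral is the stable exponent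
(`integral_compExp_eq_stableExponent`), and the i.i.d. limit theorem
`tendstoInDistribution_sum_stable` follows from characteristic functions of increments.

The limit process is constructed as a compensated Poisson integral of `1(u ≤ t)(c₀/w)^{1/α}` over
the quarter plane (`exists_isSkewedStableLevy`). -/

/-! ### Evaluation of the stable exponent as a compensated integral. -/

/-- The compensated exponential `e^{ix} - 1 - ix`. -/
def compExp (x : ℝ) : ℂ := Complex.exp (x * Complex.I) - 1 - x * Complex.I

/-- For real positive `s` this is the Gamma integral. Both sides are analytic on the right
half-plane, the left one as the complex moment generating function of `x^{p-1} dx` at `-s`, so the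
identity theorem applies at the accumulation point `1`. -/
lemma integral_rpow_mul_cexp_neg_mul_Ioi {p : ℝ} (hp : 0 < p) {s : ℂ} (hs : 0 < s.re) :
    ∫ x in Set.Ioi (0 : ℝ), ((x ^ (p - 1) : ℝ) : ℂ) * Complex.exp (-(s * x)) =
      s ^ (-(p : ℂ)) * Real.Gamma p := by
  set μ : Measure ℝ :=
    (volume.restrict (Set.Ioi 0)).withDensity (fun x ↦ ENNReal.ofReal (x ^ (p - 1))) with hμ
  have hmeas : Measurable (fun x : ℝ ↦ ENNReal.ofReal (x ^ (p - 1))) := by fun_prop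
  have key (s : ℂ) : complexMGF id μ (-s) =
      ∫ x in Set.Ioi (0 : ℝ), ((x ^ (p - 1) : ℝ) : ℂ) * Complex.exp (-(s * x)) := by
    rw [complexMGF, hμ, integral_withDensity_eq_integral_toReal_smul hmeas (by simp)]
    refine setIntegral_congr_fun measurableSet_Ioi fun x hx ↦ ?_
    have : 0 ≤ x ^ (p - 1) := Real.rpow_nonneg (le_of_lt hx) _
    simp [ENNReal.toReal_ofReal this]
  have hint : Set.Iio 0 ⊆ integrableExpSet id μ := by
    intro t ht
    simp only [Set.mem_Iio] at ht
    simp only [integrableExpSet, Set.mem_ofPred_eq, id]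
    rw [hμ, integrable_withDensity_iff_integrable_smul' hmeas (by simp)]
    have h := integrableOn_rpow_mul_exp_neg_mul_rpow (p := 1) (s := p - 1) (b := -t) (by linarith)
      zero_lt_one (by linarith)
    refine h.congr_fun (fun x hx ↦ ?_) measurableSet_Ioi
    have : 0 ≤ x ^ (p - 1) := Real.rpow_nonneg (le_of_lt hx) _
    simp [ENNReal.toReal_ofReal this]
  have hopen : IsOpen {s : ℂ | 0 < s.re} := isOpen_lt continuous_const Complex.continuous_re
  have hconn : IsPreconnected {s : ℂ | 0 < s.re} :=
    (convex_halfSpace_re_gt 0).isPreconnected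
  have hf : AnalyticOnNhd ℂ (fun s ↦ complexMGF id μ (-s)) {s : ℂ | 0 < s.re} := by
    refine DifferentiableOn.analyticOnNhd ?_ hopen
    intro s hs
    refine DifferentiableAt.differentiableWithinAt ?_
    refine DifferentiableAt.comp s (g := complexMGF id μ) ?_ (by fun_prop)
    refine (hasDerivAt_complexMGF ?_).differentiableAt
    refine interior_mono hint ?_
    rw [interior_Iio]
    simpa using hs
  have hg : AnalyticOnNhd ℂ (fun s : ℂ ↦ s ^ (-(p : ℂ)) * Real.Gamma p) {s : ℂ | 0 < s.re} := by
    refine DifferentiableOn.analyticOnNhd ?_ hopen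
    intro s hs
    refine DifferentiableAt.differentiableWithinAt ?_
    refine DifferentiableAt.mul_const ?_ _
    exact (differentiableAt_id).cpow_const (Or.inl hs)
  have heq := hf.eqOn_of_preconnected_of_frequently_eq hg hconn (z₀ := 1) (by simp) ?_
  · rw [← key]
    exact heq hs
  · have hreal : ∀ r : ℝ, 0 < r →
        complexMGF id μ (-(r : ℂ)) = (r : ℂ) ^ (-(p : ℂ)) * Real.Gamma p := by
      intro r hr
      rw [key]
      have h := Complex.integral_cpow_mul_exp_neg_mul_Ioi (a := p) (r := r) (by simpa using hp) hr
      rw [Complex.Gamma_ofReal, one_div, Complex.inv_cpow _ _ (by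
        rw [Complex.arg_ofReal_of_nonneg hr.le]; exact Real.pi_pos.ne), ← Complex.cpow_neg] at h
      rw [← h]
      refine setIntegral_congr_fun measurableSet_Ioi fun x hx ↦ ?_
      simp only [Complex.ofReal_cpow (le_of_lt hx)]
      push_cast
      rfl
    have htend : Tendsto (fun r : ℝ ↦ (r : ℂ)) (𝓝[≠] 1) (𝓝[≠] 1) := by
      refine tendsto_nhdsWithin_iff.2 ⟨?_, ?_⟩
      · exact (Complex.continuous_ofReal.tendsto' 1 1 (by simp)).mono_left nhdsWithin_le_nhds
      · filter_upwards [self_mem_nhdsWithin] with r hr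
        simpa using hr
    refine htend.frequently (Eventually.frequently ?_)
    filter_upwards [mem_nhdsWithin_of_mem_nhds (lt_mem_nhds (zero_lt_one' ℝ))] with r hr
    exact hreal r hr

/-- Mean value inequality on the closed right half-plane, where `e^{-z}` has norm at most one. -/
lemma norm_one_sub_cexp_neg_le {s : ℂ} (hs : 0 ≤ s.re) : ‖1 - Complex.exp (-s)‖ ≤ ‖s‖ := by
  have h := (convex_halfSpace_re_ge 0).norm_image_sub_le_of_norm_hasDerivWithin_le
    (f := fun z : ℂ ↦ -Complex.exp (-z)) (f' := fun z ↦ Complex.exp (-z)) (C := 1) (x := 0) (y := s)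
    (fun z _ ↦ ?_) (fun z hz ↦ ?_) (by simp) (by simpa using hs)
  · simpa [neg_add_eq_sub] using h
  · have : HasDerivAt (fun z : ℂ ↦ -Complex.exp (-z)) (-(Complex.exp (-z) * (-1))) z :=
      ((hasDerivAt_neg z).cexp).neg
    simpa using this.hasDerivWithinAt
  · rw [Complex.norm_exp]
    simpa using hz

/-- The second order remainder `e^{-s} - 1 + s`. -/
def expRem (s : ℂ) : ℂ := Complex.exp (-s) - 1 + s

lemma norm_expRem_le {s : ℂ} (hs : 0 ≤ s.re) : ‖expRem s‖ ≤ 2 * ‖s‖ := by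
  have h := norm_one_sub_cexp_neg_le hs
  calc ‖expRem s‖ = ‖s - (1 - Complex.exp (-s))‖ := by rw [expRem]; ring_nf
    _ ≤ ‖s‖ + ‖1 - Complex.exp (-s)‖ := norm_sub_le _ _
    _ ≤ 2 * ‖s‖ := by linarith

lemma norm_expRem_le_sq {s : ℂ} (hs : 0 ≤ s.re) : ‖expRem s‖ ≤ ‖s‖ ^ 2 := by
  have h := (convex_segment (𝕜 := ℝ) (0 : ℂ) s).norm_image_sub_le_of_norm_hasDerivWithin_le
    (f := expRem) (f' := fun z ↦ 1 - Complex.exp (-z)) (C := ‖s‖) (x := 0) (y := s)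
    (fun z _ ↦ ?_) (fun z hz ↦ ?_) (left_mem_segment _ _ _) (right_mem_segment _ _ _)
  · have h0 : expRem 0 = 0 := by simp [expRem]
    rw [h0, sub_zero, sub_zero] at h
    rwa [sq]
  · have : HasDerivAt expRem (Complex.exp (-z) * (-1) + 1) z :=
      (((hasDerivAt_neg z).cexp).sub_const 1).add (hasDerivAt_id z)
    convert this.hasDerivWithinAt using 1
    ring
  · obtain ⟨t, ht, rfl⟩ : ∃ t ∈ Set.Icc (0 : ℝ) 1, t • s = z := by
      rw [segment_eq_image] at hz
      obtain ⟨t, ht, rfl⟩ := hz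
      exact ⟨t, ht, by simp⟩
    refine (norm_one_sub_cexp_neg_le ?_).trans ?_
    · simpa using mul_nonneg ht.1 hs
    · rw [norm_smul, Real.norm_of_nonneg ht.1]
      exact mul_le_of_le_one_left (norm_nonneg _) ht.2

/-- The linear bound serves at infinity and the quadratic one at zero; their minimum is what
`x^{-α-1}` can integrate at both ends when `1 < α < 2`. -/
lemma norm_expRem_mul_le {s : ℂ} (hs : 0 ≤ s.re) {x : ℝ} (hx : 0 ≤ x) :
    ‖expRem (s * x)‖ ≤ (2 * ‖s‖ + ‖s‖ ^ 2) * min x (x ^ 2) := by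
  have hre : 0 ≤ (s * x).re := by simpa using mul_nonneg hs hx
  have h1 := norm_expRem_le hre
  have h2 := norm_expRem_le_sq hre
  rw [norm_mul, Complex.norm_real, Real.norm_of_nonneg hx] at h1 h2
  have hn := norm_nonneg s
  rcases min_choice x (x ^ 2) with h | h <;> rw [h]
  · nlinarith [mul_nonneg hn hx, mul_nonneg (sq_nonneg ‖s‖) hx]
  · nlinarith [mul_nonneg hn (sq_nonneg x), mul_nonneg (sq_nonneg ‖s‖) (sq_nonneg x)]

lemma compExp_eq_expRem (x : ℝ) : compExp x = expRem (-(Complex.I * x)) := by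
  simp only [compExp, expRem, neg_neg]; ring_nf

lemma norm_compExp_le (x : ℝ) : ‖compExp x‖ ≤ 2 * |x| := by
  rw [compExp_eq_expRem]
  simpa using norm_expRem_le (s := -(Complex.I * x)) (by simp)

lemma norm_compExp_le_sq (x : ℝ) : ‖compExp x‖ ≤ x ^ 2 := by
  rw [compExp_eq_expRem]
  simpa using norm_expRem_le_sq (s := -(Complex.I * x)) (by simp)

@[simp] lemma compExp_zero : compExp 0 = 0 := by simp [compExp]

lemma continuous_compExp : Continuous compExp := by
  unfold compExp; fun_prop

lemma continuous_expRem : Continuous expRem := by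
  unfold expRem; fun_prop

lemma integrableOn_min_mul_rpow {α : ℝ} (hα₁ : 1 < α) (hα₂ : α < 2) :
    IntegrableOn (fun x : ℝ ↦ min x (x ^ 2) * x ^ (-α - 1)) (Set.Ioi 0) := by
  rw [← Set.Ioc_union_Ioi_eq_Ioi (zero_le_one' ℝ)]
  refine IntegrableOn.union ?_ ?_
  · have h : IntegrableOn (fun x : ℝ ↦ x ^ (1 - α)) (Set.Ioc 0 1) := by
      rw [← intervalIntegrable_iff_integrableOn_Ioc_of_le zero_le_one]
      exact intervalIntegral.intervalIntegrable_rpow' (by linarith)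
    refine h.congr_fun (fun x hx ↦ ?_) measurableSet_Ioc
    have hx0 := hx.1
    have : x ^ 2 ≤ x := by nlinarith [hx.1, hx.2]
    simp only [min_eq_right this]
    rw [← Real.rpow_natCast, ← Real.rpow_add hx0]
    congr 1; push_cast; ring
  · have h : IntegrableOn (fun x : ℝ ↦ x ^ (-α)) (Set.Ioi 1) :=
      integrableOn_Ioi_rpow_of_lt (by linarith) one_pos
    refine h.congr_fun (fun x hx ↦ ?_) measurableSet_Ioi
    have hx1 : (1 : ℝ) < x := hx
    have hx0 : 0 < x := by linarith
    have : x ≤ x ^ 2 := by nlinarith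
    simp only [min_eq_left this]
    nth_rw 2 [← Real.rpow_one x]
    rw [← Real.rpow_add hx0]
    congr 1; ring

lemma measurable_expRem_mul_rpow (s : ℂ) (β : ℝ) :
    Measurable fun x : ℝ ↦ expRem (s * x) * ((x ^ β : ℝ) : ℂ) := by
  have := continuous_expRem
  have h1 : Measurable fun x : ℝ ↦ expRem (s * x) := by
    exact (continuous_expRem.comp (by fun_prop)).measurable
  exact h1.mul (by fun_prop)

lemma norm_expRem_mul_rpow_le {s : ℂ} (hs : 0 ≤ s.re) {x : ℝ} (hx : 0 < x) (β : ℝ) :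
    ‖expRem (s * x) * ((x ^ β : ℝ) : ℂ)‖ ≤
      (2 * ‖s‖ + ‖s‖ ^ 2) * (min x (x ^ 2) * x ^ β) := by
  rw [norm_mul, Complex.norm_real, Real.norm_of_nonneg (Real.rpow_nonneg hx.le _), ← mul_assoc]
  exact mul_le_mul_of_nonneg_right (norm_expRem_mul_le hs hx.le) (Real.rpow_nonneg hx.le _)

lemma integrableOn_expRem_mul_rpow {α : ℝ} (hα₁ : 1 < α) (hα₂ : α < 2) {s : ℂ} (hs : 0 ≤ s.re) :
    IntegrableOn (fun x : ℝ ↦ expRem (s * x) * ((x ^ (-α - 1) : ℝ) : ℂ)) (Set.Ioi 0) := by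
  refine Integrable.mono' ((integrableOn_min_mul_rpow hα₁ hα₂).const_mul (2 * ‖s‖ + ‖s‖ ^ 2))
    (measurable_expRem_mul_rpow s _).aestronglyMeasurable ?_
  filter_upwards [ae_restrict_mem measurableSet_Ioi] with x hx
  exact norm_expRem_mul_rpow_le hs hx _

/-- Two integrations by parts reduce the integral to a Gamma integral with exponent `2 - α`. They
are packaged into one function `H`, vanishing at both ends, whose derivative is the integrand minus
`s² / (α(α-1)) · x^{1-α} e^{-sx}`. -/
lemma integral_expRem_mul_rpow_of_re_pos {α : ℝ} (hα₁ : 1 < α) (hα₂ : α < 2) {s : ℂ}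
    (hs : 0 < s.re) :
    ∫ x in Set.Ioi (0 : ℝ), expRem (s * x) * ((x ^ (-α - 1) : ℝ) : ℂ) =
      s ^ (α : ℂ) * Real.Gamma (2 - α) / (α * (α - 1)) := by
  have hs0 : s ≠ 0 := by rintro rfl; simp at hs
  have hα0 : (α : ℂ) ≠ 0 := by exact_mod_cast (by linarith : α ≠ 0)
  have hα1 : (α : ℂ) - 1 ≠ 0 := by exact_mod_cast (by linarith : α - 1 ≠ 0)
  set H : ℝ → ℂ := fun x ↦ -(expRem (s * x) * ((x ^ (-α) : ℝ) : ℂ)) / α -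
    s / (α * (α - 1)) * ((1 - Complex.exp (-(s * x))) * ((x ^ (1 - α) : ℝ) : ℂ)) with hH
  have hH0 : H 0 = 0 := by simp [hH, expRem]
  set K : ℝ := ‖(α : ℂ)‖⁻¹ with hK
  set K' : ℝ := ‖s / (α * (α - 1))‖ with hK'
  have hb (x : ℝ) (hx : 0 < x) : ‖H x‖ ≤
      K * (‖expRem (s * x)‖ * x ^ (-α)) + K' * (‖1 - Complex.exp (-(s * x))‖ * x ^ (1 - α)) := by
    refine (norm_sub_le _ _).trans (le_of_eq ?_)
    have hn (β : ℝ) : ‖((x ^ β : ℝ) : ℂ)‖ = x ^ β := by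
      rw [Complex.norm_real, Real.norm_of_nonneg (Real.rpow_nonneg hx.le _)]
    rw [norm_div, norm_neg, norm_mul, norm_mul, norm_mul, hn, hn]
    ring
  have hre (x : ℝ) (hx : 0 < x) : 0 ≤ (s * x).re := by simpa using mul_nonneg hs.le hx.le
  have hnorm (x : ℝ) (hx : 0 < x) : ‖s * x‖ = ‖s‖ * x := by
    rw [norm_mul, Complex.norm_real, Real.norm_of_nonneg hx.le]
  have hpow (x : ℝ) (hx : 0 < x) : x * x ^ (-α) = x ^ (1 - α) := by
    rw [sub_eq_add_neg, Real.rpow_add hx, Real.rpow_one]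
  have hpow2 (x : ℝ) (hx : 0 < x) : x * x ^ (1 - α) = x ^ (2 - α) := by
    rw [show 2 - α = 1 + (1 - α) by ring, Real.rpow_add hx 1, Real.rpow_one]
  have hinfty : Tendsto H atTop (𝓝 0) := by
    have hlim : Tendsto (fun x : ℝ ↦ (K * (2 * ‖s‖) + K' * 2) * x ^ (1 - α)) atTop (𝓝 0) := by
      have := (tendsto_rpow_neg_atTop (y := α - 1) (by linarith)).const_mul
        (K * (2 * ‖s‖) + K' * 2)
      simpa using this
    refine squeeze_zero_norm' ?_ hlim
    filter_upwards [eventually_gt_atTop 0] with x hx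
    refine (hb x hx).trans ?_
    have h1 : ‖expRem (s * x)‖ * x ^ (-α) ≤ 2 * ‖s‖ * x ^ (1 - α) := by
      rw [← hpow x hx, ← mul_assoc]
      refine mul_le_mul_of_nonneg_right ?_ (Real.rpow_nonneg hx.le _)
      have := norm_expRem_le (hre x hx)
      rw [hnorm x hx] at this
      linarith
    have h2 : ‖1 - Complex.exp (-(s * x))‖ ≤ 2 := by
      refine (norm_sub_le _ _).trans ?_
      rw [Complex.norm_exp, norm_one]
      have : Real.exp (-(s * x)).re ≤ 1 := Real.exp_le_one_iff.2 (by simpa using hre x hx)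
      linarith
    have h3 := mul_le_mul_of_nonneg_right h2 (Real.rpow_nonneg hx.le (1 - α))
    have h4 := mul_le_mul_of_nonneg_left h1 (by positivity : 0 ≤ K)
    have h5 := mul_le_mul_of_nonneg_left h3 (by positivity : 0 ≤ K')
    nlinarith
  have hzero : ContinuousWithinAt H (Set.Ici 0) 0 := by
    rw [← continuousWithinAt_Ioi_iff_Ici]
    unfold ContinuousWithinAt
    rw [hH0]
    have hlim : Tendsto (fun x : ℝ ↦ (K * ‖s‖ ^ 2 + K' * ‖s‖) * x ^ (2 - α)) (𝓝[>] 0) (𝓝 0) := by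
      have h : ContinuousAt (fun x : ℝ ↦ x ^ (2 - α)) 0 :=
        Real.continuousAt_rpow_const _ _ (Or.inr (by linarith))
      have h' := h.tendsto
      rw [Real.zero_rpow (by linarith)] at h'
      simpa using (h'.mono_left nhdsWithin_le_nhds).const_mul (K * ‖s‖ ^ 2 + K' * ‖s‖)
    refine squeeze_zero_norm' ?_ hlim
    filter_upwards [self_mem_nhdsWithin] with x hx
    have hx : 0 < x := hx
    refine (hb x hx).trans ?_
    have h1 : ‖expRem (s * x)‖ * x ^ (-α) ≤ ‖s‖ ^ 2 * x ^ (2 - α) := by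
      rw [← hpow2 x hx, ← hpow x hx]
      have := norm_expRem_le_sq (hre x hx)
      rw [hnorm x hx] at this
      have := mul_le_mul_of_nonneg_right this (Real.rpow_nonneg hx.le (-α))
      linarith
    have h2 : ‖1 - Complex.exp (-(s * x))‖ * x ^ (1 - α) ≤ ‖s‖ * x ^ (2 - α) := by
      rw [← hpow2 x hx]
      have := norm_one_sub_cexp_neg_le (hre x hx)
      rw [hnorm x hx] at this
      have := mul_le_mul_of_nonneg_right this (Real.rpow_nonneg hx.le (1 - α))
      linarith
    have h4 := mul_le_mul_of_nonneg_left h1 (by positivity : 0 ≤ K)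
    have h5 := mul_le_mul_of_nonneg_left h2 (by positivity : 0 ≤ K')
    nlinarith
  set H' : ℝ → ℂ := fun x ↦ expRem (s * x) * ((x ^ (-α - 1) : ℝ) : ℂ) -
    s ^ 2 / (α * (α - 1)) * (((x ^ ((2 - α) - 1) : ℝ) : ℂ) * Complex.exp (-(s * x))) with hH'
  have hderiv (x : ℝ) (hx : x ∈ Set.Ioi (0 : ℝ)) : HasDerivAt H (H' x) x := by
    have hx0 : (0 : ℝ) < x := hx
    have hsx : HasDerivAt (fun x : ℝ ↦ s * (x : ℂ)) s x := by
      simpa using (Complex.ofRealCLM.hasDerivAt (x := x)).const_mul s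
    have hexp : HasDerivAt (fun x : ℝ ↦ Complex.exp (-(s * x))) (Complex.exp (-(s * x)) * (-s)) x :=
      hsx.neg.cexp
    have hrem : HasDerivAt (fun x : ℝ ↦ expRem (s * x)) (Complex.exp (-(s * x)) * (-s) + s) x :=
      (hexp.sub_const 1).add hsx
    have hp1 : HasDerivAt (fun x : ℝ ↦ ((x ^ (-α) : ℝ) : ℂ)) (((-α * x ^ (-α - 1) : ℝ)) : ℂ) x :=
      (Real.hasDerivAt_rpow_const (Or.inl hx0.ne')).ofReal_comp
    have hp2 : HasDerivAt (fun x : ℝ ↦ ((x ^ (1 - α) : ℝ) : ℂ))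
        ((((1 - α) * x ^ (1 - α - 1) : ℝ)) : ℂ) x :=
      (Real.hasDerivAt_rpow_const (Or.inl hx0.ne')).ofReal_comp
    have := ((hrem.mul hp1).neg.div_const (α : ℂ)).sub
      (((hexp.const_sub 1).mul hp2).const_mul (s / (α * (α - 1))))
    refine this.congr_deriv ?_
    simp only [hH', show 1 - α - 1 = -α by ring, show 2 - α - 1 = 1 - α by ring]
    push_cast
    field_simp
    ring
  have hint1 := integrableOn_expRem_mul_rpow hα₁ hα₂ hs.le
  have hΓ := integral_rpow_mul_cexp_neg_mul_Ioi (p := 2 - α) (by linarith) hs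
  have hint2 : IntegrableOn (fun x : ℝ ↦ ((x ^ ((2 - α) - 1) : ℝ) : ℂ) * Complex.exp (-(s * x)))
      (Set.Ioi 0) := by
    -- A non-integrable function has integral zero by convention, whereas the Gamma formula gives a
    -- nonzero value.
    by_contra hcon
    rw [integral_undef hcon] at hΓ
    have h1 : s ^ (-((2 - α : ℝ) : ℂ)) ≠ 0 := by
      rw [Ne, Complex.cpow_eq_zero_iff]; tauto
    have h2 : (Real.Gamma (2 - α) : ℂ) ≠ 0 := by
      exact_mod_cast (Real.Gamma_pos_of_pos (by linarith)).ne'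
    exact (mul_ne_zero h1 h2) hΓ.symm
  have hFTC := integral_Ioi_of_hasDerivAt_of_tendsto hzero hderiv
    (hint1.sub (hint2.const_mul (s ^ 2 / (α * (α - 1))))) hinfty
  rw [hH0, sub_zero, hH', integral_sub hint1 (hint2.const_mul _), sub_eq_zero, integral_const_mul,
    hΓ] at hFTC
  rw [hFTC]
  have : s ^ (α : ℂ) = s ^ 2 * s ^ (-((2 - α : ℝ) : ℂ)) := by
    rw [← Complex.cpow_natCast, ← Complex.cpow_add _ _ hs0]
    congr 1; push_cast; ring
  rw [this]; ring

/-- Polar form: `-iz = |z| e^{-i sgn(z) π/2}`, whose argument lies in the principal range, so the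
principal power multiplies the angle by `α`. -/
lemma cpow_neg_I_mul (α : ℝ) {z : ℝ} (hz : z ≠ 0) :
    (-(Complex.I * z)) ^ (α : ℂ) = ((|z| ^ α : ℝ) : ℂ) * ((Real.cos (Real.pi * (α / 2)) : ℝ) -
        Complex.I * (Real.sign z : ℝ) * (Real.sin (Real.pi * (α / 2)) : ℝ)) := by
  have habs : 0 < |z| := abs_pos.2 hz
  have hfac : -(Complex.I * z) =
      (|z| : ℝ) * Complex.exp ((-(Real.sign z * (Real.pi / 2)) : ℝ) * Complex.I) := by
    rcases lt_or_gt_of_ne hz with h | h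
    · rw [abs_of_neg h, Real.sign_of_neg h, Complex.exp_mul_I, ← Complex.ofReal_cos,
        ← Complex.ofReal_sin]
      simp; ring
    · rw [abs_of_pos h, Real.sign_of_pos h, Complex.exp_mul_I, ← Complex.ofReal_cos,
        ← Complex.ofReal_sin]
      simp; ring
  have hlog : Complex.log (-(Complex.I * z)) =
      (Real.log |z| : ℝ) + (-(Real.sign z * (Real.pi / 2)) : ℝ) * Complex.I := by
    have hpi := Real.pi_pos
    rw [hfac, Complex.log_ofReal_mul habs (Complex.exp_ne_zero _), Complex.log_exp]
    all_goals
      rcases lt_or_gt_of_ne hz with h | h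
      · simp [Real.sign_of_neg h]; linarith
      · simp [Real.sign_of_pos h]; linarith
  have hne : -(Complex.I * z) ≠ 0 := by simpa using hz
  rw [Complex.cpow_def_of_ne_zero hne, hlog, add_mul, Complex.exp_add, Real.rpow_def_of_pos habs]
  have h2 : (((-(Real.sign z * (Real.pi / 2)) : ℝ) : ℂ) * Complex.I * α) =
      ((-(Real.sign z * (Real.pi * (α / 2))) : ℝ) : ℂ) * Complex.I := by
    push_cast; ring
  rw [h2, Complex.exp_mul_I, ← Complex.ofReal_cos, ← Complex.ofReal_sin, Real.cos_neg,
    Real.sin_neg]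
  push_cast
  congr 1
  rcases lt_or_gt_of_ne hz with h | h
  · simp [Real.sign_of_neg h]; ring
  · simp [Real.sign_of_pos h]; ring

/-- Boundary case `s = -iz` of the half-plane formula, reached by letting the real part decrease to
zero. Since `z ≠ 0`, the limit point avoids the branch cut and the power is continuous there. -/
lemma integral_compExp_mul_rpow {α : ℝ} (hα₁ : 1 < α) (hα₂ : α < 2) {z : ℝ} (hz : z ≠ 0) :
    ∫ x in Set.Ioi (0 : ℝ), compExp (z * x) * ((x ^ (-α - 1) : ℝ) : ℂ) =
      (-(Complex.I * z)) ^ (α : ℂ) * Real.Gamma (2 - α) / (α * (α - 1)) := by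
  have hcongr : (fun x : ℝ ↦ compExp (z * x) * ((x ^ (-α - 1) : ℝ) : ℂ)) =
      fun x : ℝ ↦ expRem ((-(Complex.I * z)) * x) * ((x ^ (-α - 1) : ℝ) : ℂ) := by
    ext x
    rw [compExp_eq_expRem]
    push_cast
    ring_nf
  rw [hcongr]
  set s₀ : ℂ := -(Complex.I * z) with hs₀
  have hs₀re : s₀.re = 0 := by simp [hs₀]
  have hs₀im : s₀.im = -z := by simp [hs₀]
  have hlim : Tendsto (fun ε : ℝ ↦ (ε : ℂ) + s₀) (𝓝[>] 0) (𝓝 s₀) := by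
    have : Continuous (fun ε : ℝ ↦ (ε : ℂ) + s₀) := by fun_prop
    exact (this.tendsto' 0 s₀ (by simp)).mono_left nhdsWithin_le_nhds
  have h1 : Tendsto (fun ε : ℝ ↦ ∫ x in Set.Ioi (0 : ℝ),
      expRem (((ε : ℂ) + s₀) * x) * ((x ^ (-α - 1) : ℝ) : ℂ)) (𝓝[>] 0)
      (𝓝 (∫ x in Set.Ioi (0 : ℝ), expRem (s₀ * x) * ((x ^ (-α - 1) : ℝ) : ℂ))) := by
    refine tendsto_integral_filter_of_dominated_convergence
      (fun x ↦ (2 * (1 + ‖s₀‖) + (1 + ‖s₀‖) ^ 2) * (min x (x ^ 2) * x ^ (-α - 1))) ?_ ?_ ?_ ?_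
    · exact Eventually.of_forall fun ε ↦ (measurable_expRem_mul_rpow _ _).aestronglyMeasurable
    · filter_upwards [self_mem_nhdsWithin,
        mem_nhdsWithin_of_mem_nhds (gt_mem_nhds (zero_lt_one' ℝ))] with ε hε hε1
      have hε0 : 0 < ε := hε
      filter_upwards [ae_restrict_mem measurableSet_Ioi] with x hx
      have hx0 : 0 < x := hx
      refine (norm_expRem_mul_rpow_le (by simp [hs₀re, hε0.le]) hx _).trans ?_
      have hn : ‖(ε : ℂ) + s₀‖ ≤ 1 + ‖s₀‖ := by
        refine (norm_add_le _ _).trans ?_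
        rw [Complex.norm_real, Real.norm_of_nonneg hε0.le]
        linarith
      have : 0 ≤ min x (x ^ 2) * x ^ (-α - 1) :=
        mul_nonneg (le_min hx0.le (sq_nonneg _)) (Real.rpow_nonneg hx0.le _)
      refine mul_le_mul_of_nonneg_right ?_ this
      gcongr
    · exact (integrableOn_min_mul_rpow hα₁ hα₂).const_mul _
    · refine Eventually.of_forall fun x ↦ ?_
      have h : Tendsto (fun ε : ℝ ↦ ((ε : ℂ) + s₀) * x) (𝓝[>] 0) (𝓝 (s₀ * x)) :=
        hlim.mul_const (x : ℂ)
      exact ((continuous_expRem.tendsto (s₀ * x)).comp h).mul_const ((x ^ (-α - 1) : ℝ) : ℂ)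
  have h2 : Tendsto (fun ε : ℝ ↦ ((ε : ℂ) + s₀) ^ (α : ℂ) * Real.Gamma (2 - α) / (α * (α - 1)))
      (𝓝[>] 0) (𝓝 (s₀ ^ (α : ℂ) * Real.Gamma (2 - α) / (α * (α - 1)))) := by
    refine Tendsto.div_const (Tendsto.mul_const _ ?_) _
    have hcont : ContinuousAt (fun s : ℂ ↦ s ^ (α : ℂ)) s₀ := ?_
    · exact hcont.tendsto.comp hlim
    refine continuousAt_id.cpow continuousAt_const (Or.inr ?_)
    simpa [hs₀im] using hz
  refine tendsto_nhds_unique (h1.congr' ?_) h2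
  filter_upwards [self_mem_nhdsWithin] with ε hε
  exact integral_expRem_mul_rpow_of_re_pos hα₁ hα₂ (by simpa [hs₀re] using hε)

/-- The characteristic exponent of the totally skewed `α`-stable law at time one. -/
def stableExponent (α c₀ z : ℝ) : ℂ :=
  -(|z| ^ α * (c₀ * Real.Gamma (2 - α) / (1 - α)) : ℝ) *
    ((Real.cos (Real.pi * (α / 2)) : ℝ) -
      Complex.I * (Real.sign z : ℝ) * (Real.sin (Real.pi * (α / 2)) : ℝ))

lemma stableExponent_zero {α c₀ : ℝ} (hα : α ≠ 0) : stableExponent α c₀ 0 = 0 := by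
  simp [stableExponent, Real.zero_rpow hα]

/-- The substitution `w = x^{-α}` turns Lebesgue measure into `α x^{-α-1} dx`: the image of Lebesgue
measure under `w ↦ (c₀/w)^{1/α}` is the Lévy measure `α c₀ x^{-α-1} dx`. In this form the exponent
appears both in the limit theorem and in the Poisson construction. -/
lemma integral_compExp_eq_stableExponent {α c₀ : ℝ} (hα₁ : 1 < α) (hα₂ : α < 2) (hc₀ : 0 < c₀)
    (z : ℝ) :
    ∫ w in Set.Ioi (0 : ℝ), compExp (z * (c₀ / w) ^ (1 / α)) = stableExponent α c₀ z := by
  have hα0 : 0 < α := by linarith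
  rcases eq_or_ne z 0 with rfl | hz
  · simp [stableExponent_zero hα0.ne']
  rw [← integral_comp_rpow_Ioi (fun w ↦ compExp (z * (c₀ / w) ^ (1 / α))) (p := -α) (by linarith)]
  have hc1 : 0 < c₀ ^ (1 / α) := Real.rpow_pos_of_pos hc₀ _
  have hz' : z * c₀ ^ (1 / α) ≠ 0 := mul_ne_zero hz hc1.ne'
  have : ∀ x ∈ Set.Ioi (0 : ℝ), (|(-α)| * x ^ (-α - 1)) • compExp (z * (c₀ / x ^ (-α)) ^ (1 / α)) =
      (α : ℂ) * (compExp ((z * c₀ ^ (1 / α)) * x) * ((x ^ (-α - 1) : ℝ) : ℂ)) := by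
    intro x hx
    have hx0 : (0 : ℝ) < x := hx
    have h1 : (c₀ / x ^ (-α)) ^ (1 / α) = c₀ ^ (1 / α) * x := by
      rw [Real.rpow_neg hx0.le, div_inv_eq_mul, Real.mul_rpow hc₀.le (Real.rpow_nonneg hx0.le _),
        ← Real.rpow_mul hx0.le, mul_one_div_cancel hα0.ne', Real.rpow_one]
    rw [h1, abs_neg, abs_of_pos hα0, Complex.real_smul, mul_assoc]
    push_cast
    ring
  rw [setIntegral_congr_fun measurableSet_Ioi this, integral_const_mul,
    integral_compExp_mul_rpow hα₁ hα₂ hz', cpow_neg_I_mul _ hz']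
  have hsign : Real.sign (z * c₀ ^ (1 / α)) = Real.sign z := by
    rcases lt_or_gt_of_ne hz with h | h
    · rw [Real.sign_of_neg h, Real.sign_of_neg (mul_neg_of_neg_of_pos h hc1)]
    · rw [Real.sign_of_pos h, Real.sign_of_pos (mul_pos h hc1)]
  have habs : |z * c₀ ^ (1 / α)| ^ α = |z| ^ α * c₀ := by
    rw [abs_mul, abs_of_pos hc1, Real.mul_rpow (abs_nonneg _) hc1.le, ← Real.rpow_mul hc₀.le,
      one_div_mul_cancel hα0.ne', Real.rpow_one]
  have h0 : (α : ℂ) ≠ 0 := by exact_mod_cast hα0.ne'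
  have h1 : (α : ℂ) - 1 ≠ 0 := by exact_mod_cast (by linarith : α - 1 ≠ 0)
  have h2 : 1 - (α : ℂ) ≠ 0 := by exact_mod_cast (by linarith : 1 - α ≠ 0)
  rw [hsign, habs, stableExponent]
  push_cast
  field_simp
  rw [eq_neg_iff_add_eq_zero]
  ring

lemma integrableOn_min_rpow {α : ℝ} (hα₁ : 1 < α) (hα₂ : α < 2) :
    IntegrableOn (fun w : ℝ ↦ min (w ^ (-(1 / α))) (w ^ (-(2 / α)))) (Set.Ioi 0) := by
  have hα0 : 0 < α := by linarith
  have hle : -(2 / α) ≤ -(1 / α) := by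
    rw [neg_le_neg_iff]; gcongr; norm_num
  rw [← Set.Ioc_union_Ioi_eq_Ioi (zero_le_one' ℝ)]
  refine IntegrableOn.union ?_ ?_
  · have h : IntegrableOn (fun w : ℝ ↦ w ^ (-(1 / α))) (Set.Ioc 0 1) := by
      rw [← intervalIntegrable_iff_integrableOn_Ioc_of_le zero_le_one]
      refine intervalIntegral.intervalIntegrable_rpow' ?_
      rw [neg_lt_neg_iff, div_lt_one hα0]; exact hα₁
    refine h.congr_fun (fun w hw ↦ ?_) measurableSet_Ioc
    exact (min_eq_left (Real.rpow_le_rpow_of_exponent_ge hw.1 hw.2 hle)).symm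
  · have h : IntegrableOn (fun w : ℝ ↦ w ^ (-(2 / α))) (Set.Ioi 1) := by
      refine integrableOn_Ioi_rpow_of_lt ?_ one_pos
      rw [neg_lt_neg_iff, lt_div_iff₀ hα0]; linarith
    refine h.congr_fun (fun w hw ↦ ?_) measurableSet_Ioi
    exact (min_eq_right (Real.rpow_le_rpow_of_exponent_le (le_of_lt hw) hle)).symm

/-- The common majorant for every dominated convergence in the variable `w`: it depends only on the
order `w^{-1/α}` of the argument. -/
lemma norm_compExp_le_min_rpow {α w K x : ℝ} (hw : 0 < w)
    (hx : |x| ≤ K * w ^ (-(1 / α))) :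
    ‖compExp x‖ ≤ (2 * K + K ^ 2) * min (w ^ (-(1 / α))) (w ^ (-(2 / α))) := by
  have hp : 0 < w ^ (-(1 / α)) := Real.rpow_pos_of_pos hw _
  have hK : 0 ≤ K := nonneg_of_mul_nonneg_left ((abs_nonneg x).trans hx) hp
  have hsq : (w ^ (-(1 / α))) ^ 2 = w ^ (-(2 / α)) := by
    rw [← Real.rpow_natCast, ← Real.rpow_mul hw.le]
    congr 1; push_cast; ring
  have h1 := norm_compExp_le x
  have h2 := norm_compExp_le_sq x
  have h3 : x ^ 2 ≤ K ^ 2 * w ^ (-(2 / α)) := by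
    rw [← sq_abs, ← hsq, ← mul_pow]
    gcongr
  have hp2 : 0 < w ^ (-(2 / α)) := Real.rpow_pos_of_pos hw _
  rcases min_choice (w ^ (-(1 / α))) (w ^ (-(2 / α))) with h | h <;> rw [h]
  · nlinarith [mul_nonneg (sq_nonneg K) hp.le]
  · nlinarith [mul_nonneg hK hp2.le]

lemma div_rpow_one_div {c₀ w : ℝ} (hc₀ : 0 ≤ c₀) (hw : 0 < w) (α : ℝ) :
    (c₀ / w) ^ (1 / α) = c₀ ^ (1 / α) * w ^ (-(1 / α)) := by
  rw [Real.div_rpow hc₀ hw.le, Real.rpow_neg hw.le, div_eq_mul_inv]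

lemma stableExponent_re_nonpos {α c₀ : ℝ} (hα₁ : 1 < α) (hα₂ : α < 2) (hc₀ : 0 < c₀) (z : ℝ) :
    (stableExponent α c₀ z).re ≤ 0 := by
  have hpi := Real.pi_pos
  have hcos : Real.cos (Real.pi * (α / 2)) ≤ 0 :=
    Real.cos_nonpos_of_pi_div_two_le_of_le (by nlinarith) (by nlinarith)
  have hG : 0 < Real.Gamma (2 - α) := Real.Gamma_pos_of_pos (by linarith)
  have h1 : |z| ^ α * (c₀ * Real.Gamma (2 - α) / (1 - α)) ≤ 0 :=
    mul_nonpos_of_nonneg_of_nonpos (Real.rpow_nonneg (abs_nonneg _) _)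
      (div_nonpos_of_nonneg_of_nonpos (by positivity) (by linarith))
  have h2 := mul_nonneg_of_nonpos_of_nonpos h1 hcos
  rw [stableExponent, ← Complex.ofReal_neg, Complex.re_ofReal_mul]
  simp only [Complex.sub_re, Complex.ofReal_re, Complex.mul_re, Complex.I_re, Complex.I_im,
    Complex.ofReal_im, Complex.mul_im]
  linarith

lemma continuous_stableExponent {α c₀ : ℝ} (hα₁ : 1 < α) (hα₂ : α < 2) (hc₀ : 0 < c₀) :
    Continuous (stableExponent α c₀) := by
  rw [← funext (integral_compExp_eq_stableExponent hα₁ hα₂ hc₀)]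
  rw [continuous_iff_continuousAt]
  intro z₀
  have hmeas (z : ℝ) : Measurable fun w : ℝ ↦ compExp (z * (c₀ / w) ^ (1 / α)) :=
    continuous_compExp.measurable.comp (by fun_prop)
  set K : ℝ := (|z₀| + 1) * c₀ ^ (1 / α) with hK
  refine tendsto_integral_filter_of_dominated_convergence
    (fun w ↦ (2 * K + K ^ 2) * min (w ^ (-(1 / α))) (w ^ (-(2 / α)))) ?_ ?_ ?_ ?_
  · exact Eventually.of_forall fun z ↦ (hmeas z).aestronglyMeasurable
  · have : ∀ᶠ z in 𝓝 z₀, |z| < |z₀| + 1 :=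
      continuous_abs.continuousAt.eventually (gt_mem_nhds (lt_add_one _))
    filter_upwards [this] with z hz
    filter_upwards [ae_restrict_mem measurableSet_Ioi] with w hw
    have hw0 : 0 < w := hw
    refine norm_compExp_le_min_rpow hw ?_
    have hnn : 0 ≤ c₀ ^ (1 / α) * w ^ (-(1 / α)) := by positivity
    rw [div_rpow_one_div hc₀.le hw, abs_mul, abs_of_nonneg hnn, hK, mul_assoc]
    gcongr
  · exact (integrableOn_min_rpow hα₁ hα₂).const_mul _
  · refine Eventually.of_forall fun w ↦ ?_
    exact (continuous_compExp.tendsto _).comp (tendsto_id.mul_const _)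

/-! ### Finite-dimensional convergence from single increments. -/

lemma Fin.sum_ite_le_succ_sub_castSucc {m : ℕ} (f : Fin (m + 1) → ℝ) (j : Fin m) :
    ∑ k : Fin m, (if k ≤ j then f k.succ - f k.castSucc else 0) = f j.succ - f 0 := by
  set F : ℕ → ℝ := fun k ↦ if h : k < m + 1 then f ⟨k, h⟩ else 0 with hF
  have h1 : ∑ k : Fin m, (if k ≤ j then f k.succ - f k.castSucc else 0) =
      ∑ k : Fin m, (fun k : ℕ ↦ if k ≤ (j : ℕ) then F (k + 1) - F k else 0) k := by
    refine Finset.sum_congr rfl fun k _ ↦ ?_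
    have hk := k.2
    simp only [hF, dif_pos (show (k : ℕ) + 1 < m + 1 by omega),
      dif_pos (show (k : ℕ) < m + 1 by omega), Fin.le_def]
    rfl
  rw [h1, Fin.sum_univ_eq_sum_range (fun k : ℕ ↦ if k ≤ (j : ℕ) then F (k + 1) - F k else 0) m,
    ← Finset.sum_filter]
  have h2 : (Finset.range m).filter (fun k ↦ k ≤ (j : ℕ)) = Finset.range ((j : ℕ) + 1) := by
    ext k
    have := j.2
    simp only [Finset.mem_filter, Finset.mem_range]
    omega
  rw [h2, Finset.sum_range_sub]
  have hj := j.2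
  simp only [hF, dif_pos (show (j : ℕ) + 1 < m + 1 by omega), dif_pos (Nat.succ_pos m)]
  rfl

/-- Finite-dimensional convergence of processes with independent increments follows from the
convergence of the characteristic functions of single increments. -/
theorem tendstoInDistribution_of_hasIndepIncrements {Ω Ω' : Type*} [MeasurableSpace Ω]
    [MeasurableSpace Ω'] {P : Measure Ω} [IsProbabilityMeasure P] {Q : Measure Ω'}
    [IsProbabilityMeasure Q] {Y : ℕ → ℝ≥0 → Ω → ℝ} {L : ℝ≥0 → Ω' → ℝ}
    (hY : ∀ n t, AEMeasurable (Y n t) P) (hL : ∀ t, AEMeasurable (L t) Q)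
    (hYi : ∀ n, HasIndepIncrements (Y n) P) (hLi : HasIndepIncrements L Q)
    (hY0 : ∀ n, ∀ᵐ ω ∂P, Y n 0 ω = 0) (hL0 : ∀ᵐ ω ∂Q, L 0 ω = 0)
    (hlim : ∀ s t, s ≤ t → ∀ z, Tendsto (fun n ↦ charFun (P.map fun ω ↦ Y n t ω - Y n s ω) z)
      atTop (𝓝 (charFun (Q.map fun ω ↦ L t ω - L s ω) z)))
    {m : ℕ} (t : Fin m → ℝ≥0) :
    TendstoInDistribution (fun n ω i ↦ Y n (t i) ω) atTop (fun ω i ↦ L (t i) ω) (fun _ ↦ P) Q := by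
  -- The given times need not be ordered. They are sorted and preceded by time zero, so that values
  -- become partial sums of increments.
  set σ := Tuple.sort t with hσ
  set T : Fin (m + 1) → ℝ≥0 := Fin.cons 0 (t ∘ σ) with hT
  have hTmono : Monotone T := by
    intro i j hij
    induction i using Fin.cases with
    | zero => simp [hT]
    | succ i =>
      induction j using Fin.cases with
      | zero => exact absurd hij (by simp)
      | succ j => exact Tuple.monotone_sort t (Fin.succ_le_succ_iff.1 hij)
  -- The position of `t i` in the sorted list is `σ.symm i`; summing the increments up to that
  -- position recovers the value at `t i`, because the processes start at zero.
  set g : (Fin m → ℝ) → (Fin m → ℝ) :=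
    fun x i ↦ ∑ k : Fin m, if k ≤ σ.symm i then x k else 0 with hg
  have hgc : Continuous g := by
    refine _root_.continuous_pi fun i ↦ continuous_finsetSum _ fun k _ ↦ ?_
    split_ifs <;> fun_prop
  have hDm (n : ℕ) (i : Fin m) :
      AEMeasurable (fun ω ↦ Y n (T i.succ) ω - Y n (T i.castSucc) ω) P :=
    (hY n _).sub (hY n _)
  have hDLm (i : Fin m) : AEMeasurable (fun ω ↦ L (T i.succ) ω - L (T i.castSucc) ω) Q :=
    (hL _).sub (hL _)
  have hD : TendstoInDistribution
      (fun n ω (i : Fin m) ↦ Y n (T i.succ) ω - Y n (T i.castSucc) ω) atTop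
      (fun ω (i : Fin m) ↦ L (T i.succ) ω - L (T i.castSucc) ω) (fun _ ↦ P) Q := by
    refine ⟨fun n ↦ aemeasurable_pi_lambda _ (hDm n), aemeasurable_pi_lambda _ hDLm, ?_⟩
    have hpt (i : Fin m) : Tendsto (β := ProbabilityMeasure ℝ)
        (fun n ↦ ⟨P.map fun ω ↦ Y n (T i.succ) ω - Y n (T i.castSucc) ω,
          Measure.isProbabilityMeasure_map (hDm n i)⟩) atTop
        (𝓝 ⟨Q.map fun ω ↦ L (T i.succ) ω - L (T i.castSucc) ω,
          Measure.isProbabilityMeasure_map (hDLm i)⟩) :=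
      ProbabilityMeasure.tendsto_of_tendsto_charFun fun z ↦
        hlim _ _ (hTmono (Fin.castSucc_le_succ i)) z
    -- Independence makes the joint laws products, and products depend continuously on their factors
    -- for weak convergence.
    have hprod := (ProbabilityMeasure.continuous_pi (ι := Fin m) (α := fun _ ↦ ℝ)).tendsto _
      |>.comp (tendsto_pi_nhds.2 hpt)
    have hlimeq : (⟨Q.map fun ω (i : Fin m) ↦ L (T i.succ) ω - L (T i.castSucc) ω,
        Measure.isProbabilityMeasure_map (aemeasurable_pi_lambda _ hDLm)⟩ :
          ProbabilityMeasure (Fin m → ℝ)) =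
        ProbabilityMeasure.pi fun i ↦ ⟨Q.map fun ω ↦ L (T i.succ) ω - L (T i.castSucc) ω,
          Measure.isProbabilityMeasure_map (hDLm i)⟩ :=
      Subtype.ext ((iIndepFun_iff_map_fun_eq_pi_map hDLm).1 (hLi m T hTmono))
    rw [hlimeq]
    refine hprod.congr fun n ↦ ?_
    exact Subtype.ext ((iIndepFun_iff_map_fun_eq_pi_map (hDm n)).1 (hYi n m T hTmono)).symm
  refine (hD.continuous_comp hgc).congr (fun n ↦ ?_) ?_
  · filter_upwards [hY0 n] with ω hω
    ext i
    have := Fin.sum_ite_le_succ_sub_castSucc (fun k ↦ Y n (T k) ω) (σ.symm i)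
    simp only [Function.comp_apply, hg, this]
    simp [hT, hω]
  · filter_upwards [hL0] with ω hω
    ext i
    have := Fin.sum_ite_le_succ_sub_castSucc (fun k ↦ L (T k) ω) (σ.symm i)
    simp only [Function.comp_apply, hg, this]
    simp [hT, hω]

/-! ### Compensated Poisson sums and integrals. -/

section CompoundPoisson

variable {E : Type*} [MeasurableSpace E]

/-- The sum `∑_{i < N} g(ξ_i)` over the first `N` points, as a function of `(N, ξ)`. -/
def pointSum (g : E → ℝ) (p : ℕ × (ℕ → E)) : ℝ := ∑ i ∈ Finset.range p.1, g (p.2 i)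

/-- The law of a Poisson number together with an i.i.d. sequence of points, such that the resulting
point process has intensity `ν`. -/
def poissonPoints (ν : Measure E) : Measure (ℕ × (ℕ → E)) :=
  (poissonMeasure (ν Set.univ).toNNReal).prod
    (Measure.infinitePi fun _ ↦ (ν Set.univ)⁻¹ • ν)

lemma measurable_pointSum {g : E → ℝ} (hg : Measurable g) : Measurable (pointSum g) := by
  refine measurable_from_prod_countable_right fun n ↦ ?_
  exact Finset.measurable_fun_sum (Finset.range n) fun i _ ↦ hg.comp (measurable_pi_apply i)

instance isProbabilityMeasure_inv_smul (ν : Measure E) [IsFiniteMeasure ν] [NeZero ν] :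
    IsProbabilityMeasure ((ν Set.univ)⁻¹ • ν) :=
  ⟨by simp⟩

instance isProbabilityMeasure_poissonPoints (ν : Measure E) [IsFiniteMeasure ν] [NeZero ν] :
    IsProbabilityMeasure (poissonPoints ν) := by
  unfold poissonPoints; infer_instance

/-- Given `N = n` the integral is `q^n`, with `q` the characteristic function of one point;
averaging over the Poisson number of mean `r` gives `e^{r(q-1)}`. -/
lemma integral_cexp_pointSum (ν : Measure E) [IsFiniteMeasure ν] [NeZero ν] {g : E → ℝ}
    (hg : Measurable g) :
    ∫ p, Complex.exp (pointSum g p * Complex.I) ∂(poissonPoints ν) =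
      Complex.exp (∫ x, (Complex.exp (g x * Complex.I) - 1) ∂ν) := by
  set ρ := (ν Set.univ)⁻¹ • ν with hρ
  set q : ℂ := ∫ x, Complex.exp (g x * Complex.I) ∂ρ with hq
  have hm := measurable_pointSum hg
  have hint : Integrable (fun p ↦ Complex.exp (pointSum g p * Complex.I)) (poissonPoints ν) := by
    refine Integrable.of_bound (C := 1) ?_ ?_
    · exact (by fun_prop : Measurable _).aestronglyMeasurable
    · exact Eventually.of_forall fun p ↦ by simp [Complex.norm_exp_ofReal_mul_I]
  have hinner (n : ℕ) : ∫ ξ, Complex.exp (pointSum g (n, ξ) * Complex.I)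
      ∂(Measure.infinitePi fun _ : ℕ ↦ ρ) = q ^ n := by
    have hind : iIndepFun (fun (i : ℕ) (ξ : ℕ → E) ↦ g (ξ i)) (Measure.infinitePi fun _ : ℕ ↦ ρ) :=
      iIndepFun_infinitePi fun _ ↦ hg
    have hgm (i : ℕ) : Measurable fun ξ : ℕ → E ↦ g (ξ i) := hg.comp (measurable_pi_apply i)
    have h := congrFun (iIndepFun.charFun_map_fun_finsetSum_eq_prod (s := Finset.range n)
      (fun i _ ↦ (hgm i).aemeasurable) (hind.restrict _)) 1
    rw [charFun_apply_real, integral_map (Finset.measurable_fun_sum _ fun i _ ↦ hgm i).aemeasurable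
      (by fun_prop), Finset.prod_apply] at h
    have hone (i : ℕ) : charFun ((Measure.infinitePi fun _ : ℕ ↦ ρ).map fun ξ ↦ g (ξ i)) 1 = q := by
      have : ((Measure.infinitePi fun _ : ℕ ↦ ρ).map fun ξ ↦ g (ξ i)) = ρ.map g := by
        conv_rhs => rw [← Measure.infinitePi_map_eval (fun _ : ℕ ↦ ρ) i]
        rw [Measure.map_map hg (by fun_prop)]
        rfl
      rw [this, charFun_apply_real, integral_map hg.aemeasurable (by fun_prop)]
      simp [hq]
    simp only [hone, Finset.prod_const, Finset.card_range] at h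
    rw [← h]
    simp [pointSum]
  have hν0 : ν Set.univ ≠ 0 := by simpa using NeZero.ne ν
  have hν1 : ν Set.univ ≠ ∞ := measure_ne_top _ _
  unfold poissonPoints
  rw [integral_prod _ hint]
  simp_rw [← hρ, hinner]
  rw [integral_poissonMeasure]
  have hexp : (fun x ↦ Complex.exp (g x * Complex.I)) = fun x ↦ Complex.exp (g x * Complex.I) := rfl
  have hI : Integrable (fun x ↦ Complex.exp (g x * Complex.I)) ν := by
    refine Integrable.of_bound (C := 1) ?_ ?_
    · exact (by fun_prop : Measurable _).aestronglyMeasurable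
    · exact Eventually.of_forall fun p ↦ by simp [Complex.norm_exp_ofReal_mul_I]
  rw [integral_sub hI (integrable_const _)]
  set r : ℝ≥0 := (ν Set.univ).toNNReal with hr
  have hr0 : (r : ℂ) ≠ 0 := by
    simp [hr, ENNReal.toNNReal_eq_zero_iff, hν1, NeZero.ne ν]
  have hqν : ∫ x, Complex.exp (g x * Complex.I) ∂ν = r * q := by
    rw [hq, hρ, integral_smul_measure, ENNReal.toReal_inv, Complex.real_smul, ← mul_assoc]
    have : ((((ν Set.univ).toReal)⁻¹ : ℝ) : ℂ) = (r : ℂ)⁻¹ := by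
      rw [hr]; push_cast; rfl
    rw [this, mul_inv_cancel₀ hr0, one_mul]
  have hone : ∫ _, (1 : ℂ) ∂ν = r := by
    simp [integral_const, Measure.real, hr, ENNReal.toReal]
  rw [hqν, hone]
  calc ∑' n : ℕ, (Real.exp (-r) * r ^ n / n.factorial) • q ^ n
      = ∑' n : ℕ, (Real.exp (-r) : ℂ) * ((r * q) ^ n / n.factorial) := by
        congr with n
        rw [Complex.real_smul]
        push_cast
        ring
    _ = (Real.exp (-r) : ℂ) * Complex.exp (r * q) := by
        rw [tsum_mul_left, (NormedSpace.expSeries_div_hasSum_exp ((r : ℂ) * q)).tsum_eq,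
          Complex.exp_eq_exp_ℂ]
    _ = Complex.exp (r * q - r) := by
        rw [Complex.ofReal_exp, ← Complex.exp_add]
        push_cast
        ring_nf

/-- The compensated sum over a Poisson point process. -/
def compensatedSum (ν : Measure E) (g : E → ℝ) (p : ℕ × (ℕ → E)) : ℝ :=
  pointSum g p - ∫ x, g x ∂ν

lemma measurable_compensatedSum (ν : Measure E) {g : E → ℝ} (hg : Measurable g) :
    Measurable (compensatedSum ν g) :=
  (measurable_pointSum hg).sub_const _

lemma compensatedSum_sum {ν : Measure E} {ι : Type*} (s : Finset ι) (z : ι → ℝ) (g : ι → E → ℝ)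
    (hg : ∀ i, Integrable (g i) ν) (p : ℕ × (ℕ → E)) :
    compensatedSum ν (fun x ↦ ∑ i ∈ s, z i * g i x) p =
      ∑ i ∈ s, z i * compensatedSum ν (g i) p := by
  simp only [compensatedSum, pointSum]
  rw [integral_finsetSum _ (fun i _ ↦ (hg i).const_mul _), Finset.sum_comm]
  simp_rw [integral_const_mul, mul_sub, Finset.mul_sum]
  rw [Finset.sum_sub_distrib]

lemma integral_cexp_compensatedSum (ν : Measure E) [IsFiniteMeasure ν] [NeZero ν] {g : E → ℝ}
    (hg : Measurable g) (hgi : Integrable g ν) :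
    ∫ p, Complex.exp (compensatedSum ν g p * Complex.I) ∂(poissonPoints ν) =
      Complex.exp (∫ x, compExp (g x) ∂ν) := by
  have h (p : ℕ × (ℕ → E)) : Complex.exp (compensatedSum ν g p * Complex.I) =
      Complex.exp (-(((∫ x, g x ∂ν : ℝ) : ℂ) * Complex.I)) *
        Complex.exp (pointSum g p * Complex.I) := by
    rw [← Complex.exp_add, compensatedSum]
    push_cast
    ring_nf
  simp_rw [h]
  rw [integral_const_mul, integral_cexp_pointSum ν hg, ← Complex.exp_add]
  congr 1
  have hI : Integrable (fun x ↦ Complex.exp (g x * Complex.I) - 1) ν := by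
    refine Integrable.of_bound (C := 2) ?_ ?_
    · exact (by fun_prop : Measurable _).aestronglyMeasurable
    · refine Eventually.of_forall fun p ↦ (norm_sub_le _ _).trans ?_
      rw [Complex.norm_exp_ofReal_mul_I, norm_one]; norm_num
  simp only [compExp]
  have hgc : Integrable (fun x ↦ (g x : ℂ) * Complex.I) ν := hgi.ofReal.mul_const _
  have hgI : ∫ x, (g x : ℂ) * Complex.I ∂ν = (∫ x, g x ∂ν : ℝ) * Complex.I := by
    rw [integral_mul_const, integral_complex_ofReal]
  rw [integral_sub hI hgc, hgI]
  ring

lemma compExp_re_nonpos (x : ℝ) : (compExp x).re ≤ 0 := by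
  simp [compExp, Complex.exp_re, Real.cos_le_one]

/-- A Chebyshev-type bound read off the characteristic function `φ`: `|1 - φ(t)| ≤ t² ∫ g²` is
integrated over `[-2/r, 2/r]`, and `(r/2)(4/r²)(4/r) = 8/r²`. -/
lemma measureReal_compensatedSum_gt_le (ν : Measure E) [IsFiniteMeasure ν] [NeZero ν] {g : E → ℝ}
    (hg : Measurable g) (hgi : Integrable g ν) (hg2 : Integrable (fun x ↦ g x ^ 2) ν) {r : ℝ}
    (hr : 0 < r) :
    (poissonPoints ν).real {p | r < |compensatedSum ν g p|} ≤ 8 / r ^ 2 * ∫ x, g x ^ 2 ∂ν := by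
  have hm := measurable_compensatedSum ν hg
  set μ := (poissonPoints ν).map (compensatedSum ν g) with hμ
  have : IsProbabilityMeasure μ := Measure.isProbabilityMeasure_map hm.aemeasurable
  have h := measureReal_abs_gt_le_integral_charFun (μ := μ) hr
  rw [map_measureReal_apply hm (by measurability)] at h
  refine h.trans ?_
  set F := ∫ x, g x ^ 2 ∂ν with hF
  have hF0 : 0 ≤ F := integral_nonneg fun x ↦ sq_nonneg _
  have hchar (t : ℝ) : ‖1 - charFun μ t‖ ≤ t ^ 2 * F := by
    have hcf : charFun μ t = Complex.exp (∫ x, compExp (t * g x) ∂ν) := by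
      rw [charFun_apply_real, integral_map hm.aemeasurable (by fun_prop),
        ← integral_cexp_compensatedSum ν (hg.const_mul t) (hgi.const_mul t)]
      congr with p
      have := compensatedSum_sum (ν := ν) {()} (fun _ ↦ t) (fun _ ↦ g) (fun _ ↦ hgi) p
      simp only [Finset.sum_singleton] at this
      rw [this]
      push_cast; ring_nf
    rw [hcf]
    have hci : Integrable (fun x ↦ compExp (t * g x)) ν := by
      refine Integrable.mono' (hg2.const_mul (t ^ 2)) ?_ ?_
      · exact (continuous_compExp.measurable.comp (hg.const_mul t)).aestronglyMeasurable
      · exact Eventually.of_forall fun x ↦ (norm_compExp_le_sq _).trans (by rw [mul_pow])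
    have hre : 0 ≤ (-∫ x, compExp (t * g x) ∂ν).re := by
      rw [Complex.neg_re, ← RCLike.re_eq_complex_re, ← integral_re hci, neg_nonneg]
      exact integral_nonpos fun x ↦ compExp_re_nonpos _
    have h1 := norm_one_sub_cexp_neg_le hre
    rw [neg_neg, norm_neg] at h1
    refine h1.trans ((norm_integral_le_integral_norm _).trans ?_)
    rw [hF, ← integral_const_mul]
    refine integral_mono hci.norm (hg2.const_mul _) fun x ↦ ?_
    exact (norm_compExp_le_sq _).trans (by rw [mul_pow])
  have hbound : ‖∫ t in (-2 * r⁻¹)..(2 * r⁻¹), 1 - charFun μ t‖ ≤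
      ((2 * r⁻¹) ^ 2 * F) * |2 * r⁻¹ - (-2 * r⁻¹)| := by
    refine intervalIntegral.norm_integral_le_of_norm_le_const fun t ht ↦ (hchar t).trans ?_
    have hr' : 0 < r⁻¹ := inv_pos.2 hr
    rw [Set.uIoc_of_le (by linarith)] at ht
    have : t ^ 2 ≤ (2 * r⁻¹) ^ 2 := sq_le_sq' (by linarith [ht.1]) ht.2
    gcongr
  calc 2⁻¹ * r * ‖∫ t in (-2 * r⁻¹)..(2 * r⁻¹), 1 - charFun μ t‖
      ≤ 2⁻¹ * r * (((2 * r⁻¹) ^ 2 * F) * |2 * r⁻¹ - (-2 * r⁻¹)|) := by gcongr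
    _ = 8 / r ^ 2 * F := by
        have hr' : 0 < r⁻¹ := inv_pos.2 hr
        rw [abs_of_pos (by linarith)]
        field_simp
        ring

end CompoundPoisson

/-- Existence of compensated Poisson integrals of a family of functions `f t` with respect to an
intensity `∑ l, ν l`, under a summability condition on the second moments over the pieces `ν l`. -/
theorem exists_compensated_poisson_integral {E : Type} {T : Type*} [MeasurableSpace E] (ν : ℕ → Measure E)
    [∀ l, IsFiniteMeasure (ν l)] [∀ l, NeZero (ν l)] (f : T → E → ℝ) (hf : ∀ t, Measurable (f t))
    (hfi : ∀ t l, Integrable (f t) (ν l))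
    (hf2 : ∀ t, ∃ (l₀ : ℕ) (K : ℝ), ∀ l, l₀ ≤ l → Integrable (fun x ↦ f t x ^ 2) (ν l) ∧
      ∫ x, f t x ^ 2 ∂(ν l) ≤ K * (1 / 8) ^ l) :
    ∃ (Ω : Type) (_ : MeasurableSpace Ω) (Q : Measure Ω) (L : T → Ω → ℝ),
      IsProbabilityMeasure Q ∧ (∀ t, Measurable (L t)) ∧
      ∀ {ι : Type} [Fintype ι] (t : ι → T) (z : ι → ℝ),
        Integrable (fun x ↦ compExp (∑ i, z i * f (t i) x)) (Measure.sum ν) →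
        ∫ ω, Complex.exp ((∑ i, z i * L (t i) ω : ℝ) * Complex.I) ∂Q =
          Complex.exp (∫ x, compExp (∑ i, z i * f (t i) x) ∂(Measure.sum ν)) := by
  set Q : Measure (ℕ → ℕ × (ℕ → E)) := Measure.infinitePi fun l ↦ poissonPoints (ν l) with hQ
  have hQmap (l : ℕ) : Q.map (fun ω ↦ ω l) = poissonPoints (ν l) :=
    Measure.infinitePi_map_eval (fun l ↦ poissonPoints (ν l)) l
  set J : T → ℕ → (ℕ → ℕ × (ℕ → E)) → ℝ := fun t l ω ↦ compensatedSum (ν l) (f t) (ω l) with hJ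
  have hJm (t : T) (l : ℕ) : Measurable (J t l) :=
    (measurable_compensatedSum (ν l) (hf t)).comp (measurable_pi_apply l)
  have hsummable (t : T) : ∀ᵐ ω ∂Q, Summable fun l ↦ J t l ω := by
    obtain ⟨l₀, K, hK⟩ := hf2 t
    -- With threshold `2^{-l}` the tail bound loses `4^l` against the second moment `K 8^{-l}`,
    -- leaving a summable `2^{-l}` for Borel–Cantelli; the thresholds themselves are summable too.
    have hprob (l : ℕ) (hl : l₀ ≤ l) :
        Q.real {ω | (1 / 2 : ℝ) ^ l < |J t l ω|} ≤ 8 * K * (1 / 2) ^ l := by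
      have hset : MeasurableSet {p | (1 / 2 : ℝ) ^ l < |compensatedSum (ν l) (f t) p|} :=
        measurableSet_lt measurable_const (measurable_compensatedSum (ν l) (hf t)).norm
      have h := measureReal_compensatedSum_gt_le (ν l) (hf t) (hfi t l) (hK l hl).1
        (r := (1 / 2) ^ l) (by positivity)
      rw [← hQmap l, map_measureReal_apply (by fun_prop) hset] at h
      refine h.trans ?_
      calc 8 / ((1 / 2 : ℝ) ^ l) ^ 2 * ∫ x, f t x ^ 2 ∂ν l
          ≤ 8 / ((1 / 2 : ℝ) ^ l) ^ 2 * (K * (1 / 8) ^ l) := by gcongr; exact (hK l hl).2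
        _ = 8 * K * (1 / 2) ^ l := by
          have h8 : (1 / 8 : ℝ) ^ l = (1 / 2) ^ l * ((1 / 2) ^ l) ^ 2 := by
            rw [← pow_succ', ← pow_mul, mul_comm l, pow_mul]; norm_num
          rw [h8]
          field_simp
    have hsum : ∑' l, Q {ω | (1 / 2 : ℝ) ^ (l + l₀) < |J t (l + l₀) ω|} ≠ ∞ := by
      have hle (l : ℕ) : Q {ω | (1 / 2 : ℝ) ^ (l + l₀) < |J t (l + l₀) ω|} ≤
          ENNReal.ofReal (8 * K * (1 / 2) ^ (l + l₀)) := by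
        rw [← ofReal_measureReal]
        exact ENNReal.ofReal_le_ofReal (hprob _ (Nat.le_add_left _ _))
      have hK0 : 0 ≤ K := by
        have h := (hK l₀ le_rfl).2
        have h' : 0 ≤ ∫ x, f t x ^ 2 ∂(ν l₀) := integral_nonneg fun x ↦ sq_nonneg _
        exact nonneg_of_mul_nonneg_left (h'.trans h) (by positivity)
      refine ne_top_of_le_ne_top ?_ (ENNReal.tsum_le_tsum hle)
      have hs : Summable fun l : ℕ ↦ 8 * K * (1 / 2 : ℝ) ^ (l + l₀) :=
        ((summable_nat_add_iff l₀).2 summable_geometric_two).mul_left _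
      rw [← ENNReal.ofReal_tsum_of_nonneg (fun l ↦ by positivity) hs]
      exact ENNReal.ofReal_ne_top
    filter_upwards [ae_eventually_notMem hsum] with ω hω
    rw [← summable_nat_add_iff l₀]
    have hs : Summable fun l : ℕ ↦ (1 / 2 : ℝ) ^ (l + l₀) :=
      (summable_nat_add_iff l₀).2 summable_geometric_two
    refine hs.of_norm_bounded_eventually_nat ?_
    filter_upwards [hω] with l hl
    simpa using hl
  have hlim (t : T) : ∀ᵐ ω ∂Q, Tendsto (fun n ↦ ∑ l ∈ Finset.range n, J t l ω) atTop
      (𝓝 (∑' l, J t l ω)) := by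
    filter_upwards [hsummable t] with ω hω
    exact hω.hasSum.tendsto_sum_nat
  have hLm (t : T) : AEMeasurable (fun ω ↦ ∑' l, J t l ω) Q :=
    aemeasurable_of_tendsto_metrizable_ae atTop
      (fun n ↦ (Finset.measurable_fun_sum _ fun l _ ↦ hJm t l).aemeasurable) (hlim t)
  -- The sum over the pieces is only an almost sure limit, hence a measurable version of it is
  -- taken.
  refine ⟨ℕ → ℕ × (ℕ → E), inferInstance, Q, fun t ↦ (hLm t).mk _, inferInstance,
    fun t ↦ (hLm t).measurable_mk, fun {ι} _ t z hint ↦ ?_⟩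
  set X : ℕ → (ℕ → ℕ × (ℕ → E)) → ℝ := fun l ω ↦ ∑ i, z i * J (t i) l ω with hX
  have hXm (l : ℕ) : Measurable (X l) :=
    Finset.measurable_fun_sum _ fun i _ ↦ (hJm (t i) l).const_mul (z i)
  have hgm : Measurable fun x ↦ ∑ i, z i * f (t i) x :=
    Finset.measurable_fun_sum _ fun i _ ↦ (hf (t i)).const_mul (z i)
  have hgi (l : ℕ) : Integrable (fun x ↦ ∑ i, z i * f (t i) x) (ν l) :=
    integrable_finsetSum _ fun i _ ↦ (hfi (t i) l).const_mul (z i)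
  have hXeq (l : ℕ) : X l = fun ω ↦ compensatedSum (ν l) (fun x ↦ ∑ i, z i * f (t i) x) (ω l) := by
    ext ω
    rw [compensatedSum_sum _ _ _ fun i ↦ hfi (t i) l]
  have hXchar (l : ℕ) : charFun (Q.map (X l)) 1 =
      Complex.exp (∫ x, compExp (∑ i, z i * f (t i) x) ∂(ν l)) := by
    rw [← integral_cexp_compensatedSum (ν l) hgm (hgi l), ← hQmap l,
      integral_map (measurable_pi_apply l).aemeasurable (by
        have := measurable_compensatedSum (ν l) hgm
        fun_prop), charFun_apply_real, integral_map (hXm l).aemeasurable (by fun_prop), hXeq]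
    simp
  have hXind : iIndepFun X Q := by
    rw [funext hXeq]
    exact iIndepFun_infinitePi (X := fun l ↦ compensatedSum (ν l) fun x ↦ ∑ i, z i * f (t i) x)
      fun l ↦ measurable_compensatedSum (ν l) hgm
  have hpartial (n : ℕ) :
      ∫ ω, Complex.exp ((∑ l ∈ Finset.range n, X l ω : ℝ) * Complex.I) ∂Q =
        Complex.exp (∑ l ∈ Finset.range n, ∫ x, compExp (∑ i, z i * f (t i) x) ∂(ν l)) := by
    have h := congrFun (iIndepFun.charFun_map_fun_finsetSum_eq_prod (s := Finset.range n)
      (fun l _ ↦ (hXm l).aemeasurable) (hXind.restrict _)) 1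
    rw [charFun_apply_real, integral_map (Finset.measurable_fun_sum _ fun i _ ↦ hXm i).aemeasurable
      (by fun_prop), Finset.prod_apply] at h
    simp only [hXchar] at h
    rw [Complex.exp_sum, ← h]
    simp
  have hlim1 : Tendsto (fun n ↦ Complex.exp (∑ l ∈ Finset.range n,
      ∫ x, compExp (∑ i, z i * f (t i) x) ∂(ν l))) atTop
      (𝓝 (Complex.exp (∫ x, compExp (∑ i, z i * f (t i) x) ∂(Measure.sum ν)))) :=
    (Complex.continuous_exp.tendsto _).comp (hasSum_integral_measure hint).tendsto_sum_nat
  refine tendsto_nhds_unique (f := fun n ↦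
    ∫ ω, Complex.exp ((∑ l ∈ Finset.range n, X l ω : ℝ) * Complex.I) ∂Q) ?_
    (hlim1.congr fun n ↦ (hpartial n).symm)
  refine tendsto_integral_of_dominated_convergence (fun _ ↦ 1) (fun n ↦ ?_) (integrable_const _)
    (fun n ↦ Eventually.of_forall fun ω ↦ (Complex.norm_exp_ofReal_mul_I _).le) ?_
  · have : Measurable fun ω ↦ ∑ l ∈ Finset.range n, X l ω :=
      Finset.measurable_fun_sum _ fun l _ ↦ hXm l
    exact (by fun_prop : Measurable _).aestronglyMeasurable
  · have h1 : ∀ᵐ ω ∂Q, ∀ i, Tendsto (fun n ↦ ∑ l ∈ Finset.range n, J (t i) l ω) atTop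
        (𝓝 ((hLm (t i)).mk _ ω)) := by
      refine ae_all_iff.2 fun i ↦ ?_
      filter_upwards [hlim (t i), (hLm (t i)).ae_eq_mk] with ω h1 h2
      rwa [← h2]
    filter_upwards [h1] with ω hω
    have h2 : Tendsto (fun n ↦ ∑ l ∈ Finset.range n, X l ω) atTop
        (𝓝 (∑ i, z i * (hLm (t i)).mk _ ω)) := by
      have : (fun n ↦ ∑ l ∈ Finset.range n, X l ω) =
          fun n ↦ ∑ i, z i * ∑ l ∈ Finset.range n, J (t i) l ω := by
        ext n
        simp only [hX]
        rw [Finset.sum_comm]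
        simp_rw [Finset.mul_sum]
      rw [this]
      exact tendsto_finsetSum _ fun i _ ↦ (hω i).const_mul _
    have hc : Continuous fun x : ℝ ↦ Complex.exp (x * Complex.I) := by fun_prop
    exact (hc.tendsto _).comp h2

/-! ### Construction of the skewed stable Lévy process. -/

/-- The kernel `1(u ≤ t) (c₀ / w)^{1/α}` on the quarter plane. -/
def stableKernel (α c₀ : ℝ) (t : ℝ≥0) (p : ℝ × ℝ) : ℝ :=
  (Set.Iic (t : ℝ)).indicator 1 p.1 * (c₀ / p.2) ^ (1 / α)

lemma measurable_stableKernel (α c₀ : ℝ) (t : ℝ≥0) : Measurable (stableKernel α c₀ t) := by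
  have h : Measurable ((Set.Iic (t : ℝ)).indicator (1 : ℝ → ℝ)) :=
    measurable_one.indicator measurableSet_Iic
  exact (h.comp measurable_fst).mul (by fun_prop)

lemma integrableOn_div_rpow_Ioi {α c₀ b : ℝ} (hα₁ : 1 < α) (hα₂ : α < 2) (hc₀ : 0 < c₀)
    (hb : 0 < b) :
    IntegrableOn (fun w : ℝ ↦ ((c₀ / w) ^ (1 / α)) ^ 2) (Set.Ioi b) ∧
      ∫ w in Set.Ioi b, ((c₀ / w) ^ (1 / α)) ^ 2 =
        c₀ ^ (2 / α) / (2 / α - 1) * b ^ (-(2 / α - 1)) := by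
  have hα0 : 0 < α := by linarith
  have h2 : 1 < 2 / α := by rw [lt_div_iff₀ hα0]; linarith
  have heq : ∀ w ∈ Set.Ioi b, c₀ ^ (2 / α) * w ^ (-(2 / α)) = ((c₀ / w) ^ (1 / α)) ^ 2 := by
    intro w hw
    have hw0 : 0 < w := hb.trans hw
    rw [div_rpow_one_div hc₀.le hw0, mul_pow, ← Real.rpow_natCast, ← Real.rpow_natCast,
      ← Real.rpow_mul hc₀.le, ← Real.rpow_mul hw0.le]
    congr 2 <;> · push_cast; ring
  constructor
  · exact IntegrableOn.congr_fun ((integrableOn_Ioi_rpow_of_lt (by linarith) hb).const_mul _) heq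
      measurableSet_Ioi
  · rw [← setIntegral_congr_fun measurableSet_Ioi heq, integral_const_mul,
      integral_Ioi_rpow_of_lt (by linarith) hb]
    have h3 : -(2 / α) + 1 = -(2 / α - 1) := by ring
    rw [h3, neg_div_neg_eq]
    ring

lemma integrableOn_stableKernel {α c₀ : ℝ} (hα₁ : 1 < α) (hc₀ : 0 < c₀) (t : ℝ≥0) (a b : ℝ)
    (hb : 0 ≤ b) :
    IntegrableOn (stableKernel α c₀ t) (Set.Ioc 0 a ×ˢ Set.Ioc 0 b) := by
  have hα0 : 0 < α := by linarith
  unfold IntegrableOn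
  rw [Measure.volume_eq_prod, ← Measure.prod_restrict]
  refine Integrable.mul_prod (f := (Set.Iic (t : ℝ)).indicator 1)
    (g := fun w : ℝ ↦ (c₀ / w) ^ (1 / α)) ?_ ?_
  · exact (integrable_const (1 : ℝ)).indicator measurableSet_Iic
  · have h : IntegrableOn (fun w : ℝ ↦ c₀ ^ (1 / α) * w ^ (-(1 / α))) (Set.Ioc 0 b) := by
      rw [← intervalIntegrable_iff_integrableOn_Ioc_of_le hb]
      refine (intervalIntegral.intervalIntegrable_rpow' ?_).const_mul _
      rw [neg_lt_neg_iff, div_lt_one hα0]; exact hα₁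
    exact h.congr_fun (fun w hw ↦ (div_rpow_one_div hc₀.le hw.1 α).symm) measurableSet_Ioc

/-- The boxes `(0, l] × (0, 8^{κ l}]` exhausting the quarter plane. -/
def quadrantBox (κ : ℝ) (l : ℕ) : Set (ℝ × ℝ) := Set.Ioc 0 (l : ℝ) ×ˢ Set.Ioc 0 ((8 : ℝ) ^ (κ * l))

lemma quadrantBox_mono {κ : ℝ} (hκ : 0 < κ) : Monotone (quadrantBox κ) := by
  intro l l' h
  refine Set.prod_mono (Set.Ioc_subset_Ioc_right (by exact_mod_cast h))
    (Set.Ioc_subset_Ioc_right ?_)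
  refine Real.rpow_le_rpow_of_exponent_le (by norm_num) ?_
  gcongr

/-- The layers between consecutive boxes. -/
def quadrantLayer (κ : ℝ) (l : ℕ) : Set (ℝ × ℝ) := quadrantBox κ (l + 1) \ quadrantBox κ l

lemma measurableSet_quadrantLayer (κ : ℝ) (l : ℕ) : MeasurableSet (quadrantLayer κ l) :=
  (measurableSet_Ioc.prod measurableSet_Ioc).diff (measurableSet_Ioc.prod measurableSet_Ioc)

lemma sum_restrict_quadrantLayer {κ : ℝ} (hκ : 0 < κ) :
    Measure.sum (fun l ↦ (volume : Measure (ℝ × ℝ)).restrict (quadrantLayer κ l)) =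
      (volume.restrict (Set.Ioi 0)).prod (volume.restrict (Set.Ioi 0)) := by
  have hmono := quadrantBox_mono hκ
  rw [← Measure.restrict_iUnion _ (measurableSet_quadrantLayer κ), Measure.prod_restrict,
    ← Measure.volume_eq_prod]
  · congr 1
    ext p
    simp only [Set.mem_iUnion, Set.mem_prod, Set.mem_Ioi]
    constructor
    · rintro ⟨l, hl, -⟩
      exact ⟨hl.1.1, hl.2.1⟩
    · rintro ⟨h1, h2⟩
      have hex : ∃ n, p ∈ quadrantBox κ n := by
        have ht : Tendsto (fun n : ℕ ↦ (8 : ℝ) ^ (κ * n)) atTop atTop := by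
          have := tendsto_pow_atTop_atTop_of_one_lt (r := (8 : ℝ) ^ κ)
            (Real.one_lt_rpow (by norm_num) hκ)
          refine this.congr fun n ↦ ?_
          rw [← Real.rpow_natCast, ← Real.rpow_mul (by norm_num)]
        obtain ⟨n, hn1, hn2⟩ := ((tendsto_natCast_atTop_atTop.eventually_ge_atTop p.1).and
          (ht.eventually_ge_atTop p.2)).exists
        exact ⟨n, ⟨h1, hn1⟩, ⟨h2, hn2⟩⟩
      classical
      have hspec := Nat.find_spec hex
      have hmin := fun m ↦ Nat.find_min hex (m := m)
      -- The box with index zero is empty, so the first box containing `p` has a positive index `N +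
      -- 1`, and `p` lies in layer `N`.
      rcases hN : Nat.find hex with _ | N
      · rw [hN] at hspec
        simp [quadrantBox] at hspec
      · exact ⟨N, by rw [hN] at hspec; exact hspec, hmin N (by omega)⟩
  · have key : ∀ l l', l < l' → Disjoint (quadrantLayer κ l) (quadrantLayer κ l') := by
      intro l l' h
      refine Set.disjoint_left.2 fun p hp hp' ↦ hp'.2 ?_
      exact hmono (Nat.succ_le_of_lt h) hp.1
    intro l l' h
    rcases lt_or_gt_of_ne h with h | h
    · exact key _ _ h
    · exact (key _ _ h).symm

lemma isFiniteMeasure_restrict_quadrantLayer (κ : ℝ) (l : ℕ) :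
    IsFiniteMeasure ((volume : Measure (ℝ × ℝ)).restrict (quadrantLayer κ l)) := by
  refine ⟨?_⟩
  rw [Measure.restrict_apply_univ]
  refine (measure_mono Set.sdiff_subset).trans_lt ?_
  rw [quadrantBox, Measure.volume_eq_prod, Measure.prod_prod]
  exact ENNReal.mul_lt_top measure_Ioc_lt_top measure_Ioc_lt_top

lemma neZero_restrict_quadrantLayer {κ : ℝ} (hκ : 0 < κ) (l : ℕ) :
    NeZero ((volume : Measure (ℝ × ℝ)).restrict (quadrantLayer κ l)) := by
  refine ⟨fun h ↦ ?_⟩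
  rw [Measure.restrict_eq_zero] at h
  have hsub : Set.Ioc (l : ℝ) (l + 1) ×ˢ Set.Ioc (0 : ℝ) 1 ⊆ quadrantLayer κ l := by
    rintro p ⟨h1, h2⟩
    refine ⟨⟨⟨lt_of_le_of_lt (Nat.cast_nonneg l) h1.1, by push_cast; exact h1.2⟩, h2.1, ?_⟩, ?_⟩
    · exact h2.2.trans (Real.one_le_rpow (by norm_num) (by positivity))
    · rintro ⟨h3, -⟩
      exact absurd h3.2 (not_le.2 h1.1)
  have h0 := measure_mono_null hsub h
  rw [Measure.volume_eq_prod, Measure.prod_prod] at h0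
  simp at h0

/-- Once `l ≥ t`, a point of layer `l` with `u ≤ t` can be outside the smaller box only through `w >
8^{κ l}`. The second moment of the kernel beyond height `b` is a multiple of `b^{-(2/α-1)}`, and `κ
= 1/(2/α-1)` turns this into `8^{-l}`. -/
lemma integral_stableKernel_sq_le {α c₀ : ℝ} (hα₁ : 1 < α) (hα₂ : α < 2) (hc₀ : 0 < c₀)
    (t : ℝ≥0) {l : ℕ} (hl : (t : ℝ) ≤ l) :
    IntegrableOn (fun p ↦ stableKernel α c₀ t p ^ 2) (quadrantLayer (1 / (2 / α - 1)) l) ∧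
      ∫ p in quadrantLayer (1 / (2 / α - 1)) l, stableKernel α c₀ t p ^ 2 ≤
        (t * (c₀ ^ (2 / α) / (2 / α - 1))) * (1 / 8) ^ l := by
  have hα0 : 0 < α := by linarith
  have h2 : 0 < 2 / α - 1 := by rw [sub_pos, lt_div_iff₀ hα0]; linarith
  set κ := 1 / (2 / α - 1) with hκ
  have hκ0 : 0 < κ := by positivity
  set b : ℝ := (8 : ℝ) ^ (κ * l) with hb
  have hb0 : 0 < b := by positivity
  obtain ⟨hint, hval⟩ := integrableOn_div_rpow_Ioi hα₁ hα₂ hc₀ hb0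
  set G : ℝ × ℝ → ℝ := fun p ↦ (Set.Ioc 0 (t : ℝ)).indicator 1 p.1 *
    (Set.Ioi b).indicator (fun w ↦ ((c₀ / w) ^ (1 / α)) ^ 2) p.2 with hG
  have hi1 : Integrable ((Set.Ioc 0 (t : ℝ)).indicator (1 : ℝ → ℝ)) :=
    (integrable_indicator_iff measurableSet_Ioc).2 (integrableOn_const (by simp))
  have hi2 : Integrable ((Set.Ioi b).indicator fun w : ℝ ↦ ((c₀ / w) ^ (1 / α)) ^ 2) :=
    (integrable_indicator_iff measurableSet_Ioi).2 hint
  have hGi : Integrable G := hi1.mul_prod hi2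
  have hGnn (p : ℝ × ℝ) : 0 ≤ G p :=
    mul_nonneg (Set.indicator_nonneg (fun _ _ ↦ zero_le_one) _)
      (Set.indicator_nonneg (fun _ _ ↦ sq_nonneg _) _)
  have hle : ∀ p ∈ quadrantLayer κ l, stableKernel α c₀ t p ^ 2 ≤ G p := by
    rintro p ⟨⟨h1, h1'⟩, h3⟩
    by_cases hp : p.1 ≤ t
    · have hp2 : b < p.2 := by
        by_contra hcon
        exact h3 ⟨⟨h1.1, hp.trans hl⟩, h1'.1, not_lt.1 hcon⟩
      simp only [stableKernel, hG]
      rw [Set.indicator_of_mem (by exact hp), Set.indicator_of_mem (by exact ⟨h1.1, hp⟩),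
        Set.indicator_of_mem (by exact hp2), mul_pow]
      simp
    · have : stableKernel α c₀ t p = 0 := by
        simp only [stableKernel]
        rw [Set.indicator_of_notMem (by exact hp), zero_mul]
      rw [this]
      simpa using hGnn p
  have hm := measurable_stableKernel α c₀ t
  have hfi : IntegrableOn (fun p ↦ stableKernel α c₀ t p ^ 2) (quadrantLayer κ l) := by
    refine Integrable.mono' hGi.integrableOn (by fun_prop) ?_
    filter_upwards [ae_restrict_mem (measurableSet_quadrantLayer κ l)] with p hp
    rw [Real.norm_of_nonneg (sq_nonneg _)]
    exact hle p hp
  refine ⟨hfi, (setIntegral_mono_on hfi hGi.integrableOn (measurableSet_quadrantLayer κ l)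
    hle).trans ((setIntegral_le_integral hGi (Eventually.of_forall hGnn)).trans (le_of_eq ?_))⟩
  rw [hG, Measure.volume_eq_prod, integral_prod_mul, integral_indicator measurableSet_Ioc,
    integral_indicator measurableSet_Ioi, hval]
  have hb' : b ^ (-(2 / α - 1)) = (1 / 8) ^ l := by
    have he : κ * l * -(2 / α - 1) = -(l : ℝ) := by
      rw [hκ, mul_neg, mul_right_comm, one_div_mul_cancel h2.ne', one_mul]
    rw [hb, ← Real.rpow_mul (by norm_num), he, Real.rpow_neg (by norm_num), Real.rpow_natCast,
      one_div_pow, one_div]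
  rw [hb']
  simp
  ring

lemma integrable_compExp_sum_stableKernel {α c₀ : ℝ} (hα₁ : 1 < α) (hα₂ : α < 2) (hc₀ : 0 < c₀)
    {ι : Type*} [Fintype ι] (t : ι → ℝ≥0) (z : ι → ℝ) :
    Integrable (fun p ↦ compExp (∑ i, z i * stableKernel α c₀ (t i) p))
      ((volume.restrict (Set.Ioi (0 : ℝ))).prod (volume.restrict (Set.Ioi (0 : ℝ)))) := by
  set K : ℝ := (∑ i, |z i|) * c₀ ^ (1 / α) with hK
  set T : ℝ := ∑ i, (t i : ℝ) with hT
  have hbound : Integrable (fun p : ℝ × ℝ ↦ (2 * K + K ^ 2) *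
      ((Set.Iic T).indicator 1 p.1 * min (p.2 ^ (-(1 / α))) (p.2 ^ (-(2 / α)))))
      ((volume.restrict (Set.Ioi (0 : ℝ))).prod (volume.restrict (Set.Ioi (0 : ℝ)))) := by
    refine Integrable.const_mul (Integrable.mul_prod (f := (Set.Iic T).indicator (1 : ℝ → ℝ))
      (g := fun w : ℝ ↦ min (w ^ (-(1 / α))) (w ^ (-(2 / α)))) ?_ ?_) _
    · rw [integrable_indicator_iff measurableSet_Iic]
      refine integrableOn_const ?_
      rw [Measure.restrict_apply measurableSet_Iic, Set.inter_comm, Set.Ioi_inter_Iic]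
      simp
    · exact integrableOn_min_rpow hα₁ hα₂
  have hm : Measurable fun p ↦ ∑ i, z i * stableKernel α c₀ (t i) p :=
    Finset.measurable_fun_sum _ fun i _ ↦ (measurable_stableKernel α c₀ (t i)).const_mul (z i)
  refine Integrable.mono' hbound
    (continuous_compExp.measurable.comp hm).aestronglyMeasurable ?_
  have hae : ∀ᵐ p ∂((volume.restrict (Set.Ioi (0 : ℝ))).prod (volume.restrict (Set.Ioi (0 : ℝ)))),
      p ∈ Set.Ioi (0 : ℝ) ×ˢ Set.Ioi (0 : ℝ) := by
    rw [Measure.prod_restrict]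
    exact ae_restrict_mem (measurableSet_Ioi.prod measurableSet_Ioi)
  filter_upwards [hae] with p hp
  by_cases h : p.1 ≤ T
  · rw [Set.indicator_of_mem (by exact h)]
    simp only [Pi.one_apply, one_mul]
    refine norm_compExp_le_min_rpow hp.2 ?_
    refine (Finset.abs_sum_le_sum_abs _ _).trans ?_
    rw [hK, Finset.sum_mul, Finset.sum_mul]
    refine Finset.sum_le_sum fun i _ ↦ ?_
    rw [abs_mul, mul_assoc, ← div_rpow_one_div hc₀.le hp.2]
    refine mul_le_mul_of_nonneg_left ?_ (abs_nonneg _)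
    have hw : (0 : ℝ) < p.2 := hp.2
    have hnn : 0 ≤ (c₀ / p.2) ^ (1 / α) := by positivity
    simp only [stableKernel, abs_mul, abs_of_nonneg hnn]
    refine mul_le_of_le_one_left hnn ?_
    by_cases hi : p.1 ∈ Set.Iic (t i : ℝ) <;> simp [hi]
  · have h0 : ∑ i, z i * stableKernel α c₀ (t i) p = 0 := by
      refine Finset.sum_eq_zero fun i _ ↦ ?_
      have hi : p.1 ∉ Set.Iic (t i : ℝ) := fun hcon ↦ h (le_trans hcon
        (Finset.single_le_sum (f := fun i ↦ (t i : ℝ)) (fun i _ ↦ (t i).2) (Finset.mem_univ i)))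
      simp [stableKernel, hi]
    rw [h0, Set.indicator_of_notMem (by exact h)]
    simp

/-- Existence of a process whose joint characteristic functions are those of the skewed stable
Lévy process. -/
theorem exists_process_charFun_stable {α c₀ : ℝ} (hα₁ : 1 < α) (hα₂ : α < 2) (hc₀ : 0 < c₀) :
    ∃ (Ω : Type) (_ : MeasurableSpace Ω) (Q : Measure Ω) (L : ℝ≥0 → Ω → ℝ),
      IsProbabilityMeasure Q ∧ (∀ t, Measurable (L t)) ∧
      ∀ {ι : Type} [Fintype ι] (t : ι → ℝ≥0) (z : ι → ℝ),
        ∫ ω, Complex.exp ((∑ i, z i * L (t i) ω : ℝ) * Complex.I) ∂Q =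
          Complex.exp (∫ u in Set.Ioi (0 : ℝ),
            stableExponent α c₀ (∑ i, z i * (Set.Iic (t i : ℝ)).indicator 1 u)) := by
  have hα0 : 0 < α := by linarith
  have h2 : 0 < 2 / α - 1 := by rw [sub_pos, lt_div_iff₀ hα0]; linarith
  set κ := 1 / (2 / α - 1) with hκ
  have hκ0 : 0 < κ := by positivity
  have := isFiniteMeasure_restrict_quadrantLayer κ
  have := neZero_restrict_quadrantLayer hκ0
  obtain ⟨Ω, mΩ, Q, L, hQ, hL, hchar⟩ := exists_compensated_poisson_integral
    (fun l ↦ (volume : Measure (ℝ × ℝ)).restrict (quadrantLayer κ l)) (stableKernel α c₀)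
    (measurable_stableKernel α c₀)
    (fun t l ↦ (integrableOn_stableKernel hα₁ hc₀ t _ _ (by positivity)).mono_set
      Set.sdiff_subset)
    (fun t ↦ by
      obtain ⟨l₀, hl₀⟩ := exists_nat_ge (t : ℝ)
      exact ⟨l₀, _, fun l hl ↦ integral_stableKernel_sq_le hα₁ hα₂ hc₀ t
        (hl₀.trans (by exact_mod_cast hl))⟩)
  refine ⟨Ω, mΩ, Q, L, hQ, hL, fun {ι} _ t z ↦ ?_⟩
  -- Fubini: for fixed `u` the kernels share the factor `(c₀/w)^{1/α}`, so the inner integral over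
  -- `w` is the stable exponent at `∑ z_i 1(u ≤ t_i)`.
  have hint := integrable_compExp_sum_stableKernel hα₁ hα₂ hc₀ t z
  rw [hchar t z (by rwa [sum_restrict_quadrantLayer hκ0]), sum_restrict_quadrantLayer hκ0,
    integral_prod _ hint]
  congr 2 with u
  rw [← integral_compExp_eq_stableExponent hα₁ hα₂ hc₀]
  congr 1 with w
  simp only [stableKernel]
  rw [Finset.sum_mul]
  simp_rw [mul_assoc]

/-- Each `u` lies in at most one of the intervals, and the exponent vanishes at zero; the exponent
of the sum is therefore the sum of the exponents. -/
lemma integral_stableExponent_sum_indicator {α c₀ : ℝ} (hα₁ : 1 < α)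
    {ι : Type*} [Fintype ι] (s t : ι → ℝ≥0) (hst : ∀ i, s i ≤ t i)
    (hdisj : Pairwise fun i j ↦ Disjoint (Set.Ioc (s i) (t i)) (Set.Ioc (s j) (t j))) (y : ι → ℝ) :
    ∫ u in Set.Ioi (0 : ℝ), stableExponent α c₀
        (∑ i, y i * ((Set.Iic (t i : ℝ)).indicator 1 u - (Set.Iic (s i : ℝ)).indicator 1 u)) =
      ∑ i, ((t i - s i : ℝ) : ℂ) * stableExponent α c₀ (y i) := by
  have hpt : ∀ u ∈ Set.Ioi (0 : ℝ), stableExponent α c₀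
      (∑ i, y i * ((Set.Iic (t i : ℝ)).indicator 1 u - (Set.Iic (s i : ℝ)).indicator 1 u)) =
      ∑ i, (Set.Ioc (s i : ℝ) (t i)).indicator (fun _ ↦ stableExponent α c₀ (y i)) u := by
    intro u hu
    have hind (i : ι) : ((Set.Iic (t i : ℝ)).indicator 1 u - (Set.Iic (s i : ℝ)).indicator 1 u : ℝ)
        = (Set.Ioc (s i : ℝ) (t i)).indicator 1 u := by
      have h := hst i
      simp only [Set.indicator_apply, Set.mem_Iic, Set.mem_Ioc, Pi.one_apply]
      by_cases h1 : u ≤ s i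
      · have h2 : u ≤ t i := h1.trans (by exact_mod_cast h)
        simp [h1, h2]
      · simp [h1, not_le.1 h1]
    simp_rw [hind]
    by_cases hex : ∃ i, u ∈ Set.Ioc (s i : ℝ) (t i)
    · obtain ⟨i, hi⟩ := hex
      have hne (j : ι) (hj : j ≠ i) : u ∉ Set.Ioc (s j : ℝ) (t j) := by
        intro hcon
        have hu0 : (0 : ℝ) ≤ u := le_of_lt hu
        have h1 : (⟨u, hu0⟩ : ℝ≥0) ∈ Set.Ioc (s j) (t j) := by
          exact ⟨NNReal.coe_lt_coe.1 hcon.1, NNReal.coe_le_coe.1 hcon.2⟩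
        have h2 : (⟨u, hu0⟩ : ℝ≥0) ∈ Set.Ioc (s i) (t i) := by
          exact ⟨NNReal.coe_lt_coe.1 hi.1, NNReal.coe_le_coe.1 hi.2⟩
        exact Set.disjoint_left.1 (hdisj hj) h1 h2
      rw [Finset.sum_eq_single i (fun j _ hj ↦ by simp [hne j hj]) (by simp),
        Finset.sum_eq_single i (fun j _ hj ↦ by simp [hne j hj]) (by simp)]
      simp [hi]
    · have hne (j : ι) : u ∉ Set.Ioc (s j : ℝ) (t j) := fun h ↦ hex ⟨j, h⟩
      simp [hne, stableExponent_zero (by linarith : α ≠ 0)]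
  rw [setIntegral_congr_fun measurableSet_Ioi hpt, integral_finsetSum]
  · refine Finset.sum_congr rfl fun i _ ↦ ?_
    rw [setIntegral_indicator measurableSet_Ioc, setIntegral_const]
    have hsub : Set.Ioi (0 : ℝ) ∩ Set.Ioc (s i : ℝ) (t i) = Set.Ioc (s i : ℝ) (t i) :=
      Set.inter_eq_right.2 fun u hu ↦ lt_of_le_of_lt (s i).2 hu.1
    have h := hst i
    rw [hsub, Real.volume_real_Ioc_of_le (by exact_mod_cast h), Complex.real_smul]
  · intro i _
    refine (integrable_indicator_iff measurableSet_Ioc).2 ?_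
    refine integrableOn_const ?_
    exact ((Measure.restrict_apply_le _ _).trans_lt measure_Ioc_lt_top).ne

/-- Independence and stationarity of increments are read off the joint characteristic function,
which factorizes over disjoint time intervals into factors depending only on their lengths. -/
theorem exists_isSkewedStableLevy {α c₀ : ℝ} (hα₁ : 1 < α) (hα₂ : α < 2) (hc₀ : 0 < c₀) :
    ∃ (Ω : Type) (_ : MeasurableSpace Ω) (Q : Measure Ω) (L : ℝ≥0 → Ω → ℝ),
      IsProbabilityMeasure Q ∧ IsSkewedStableLevy α c₀ L Q := by
  obtain ⟨Ω, mΩ, Q, L, hQ, hL, hchar⟩ := exists_process_charFun_stable hα₁ hα₂ hc₀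
  refine ⟨Ω, mΩ, Q, L, hQ, ?_⟩
  have hincr {n : ℕ} (s t : Fin n → ℝ≥0) (hst : ∀ i, s i ≤ t i)
      (hdisj : Pairwise fun i j ↦ Disjoint (Set.Ioc (s i) (t i)) (Set.Ioc (s j) (t j)))
      (y : Fin n → ℝ) :
      ∫ ω, Complex.exp ((∑ i, y i * (L (t i) ω - L (s i) ω) : ℝ) * Complex.I) ∂Q =
        ∏ i, Complex.exp (((t i - s i : ℝ) : ℂ) * stableExponent α c₀ (y i)) := by
    rw [← Complex.exp_sum, ← integral_stableExponent_sum_indicator hα₁ s t hst hdisj y]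
    -- Increments are linear combinations of values: weights `y` at the right endpoints and `-y` at
    -- the left ones.
    have h := hchar (Sum.elim t s) (Sum.elim y (-y))
    simp only [Fintype.sum_sum_type, Sum.elim_inl, Sum.elim_inr, Pi.neg_apply] at h
    convert h using 4
    · congr 2
      rw [← Finset.sum_add_distrib]
      congr 1 with i
      ring
    · congr 1
      rw [← Finset.sum_add_distrib]
      congr 1 with i
      ring
  have hincr1 (s t : ℝ≥0) (hst : s ≤ t) (y : ℝ) :
      charFun (Q.map fun ω ↦ L t ω - L s ω) y =
        Complex.exp (((t - s : ℝ) : ℂ) * stableExponent α c₀ y) := by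
    have h := hincr (n := 1) (fun _ ↦ s) (fun _ ↦ t) (fun _ ↦ hst)
      (fun i j hij ↦ absurd (Subsingleton.elim i j) hij) (fun _ ↦ y)
    simp only [Finset.univ_unique, Finset.sum_singleton, Finset.prod_singleton] at h
    have hm := (hL t).sub (hL s)
    rw [charFun_apply_real, integral_map (by fun_prop) (by fun_prop), ← h]
    push_cast
    rfl
  have hone (t : ℝ≥0) (y : ℝ) :
      charFun (Q.map (L t)) y = Complex.exp ((t : ℝ) * stableExponent α c₀ y) := by
    have h := hchar (ι := Unit) (fun _ ↦ t) (fun _ ↦ y)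
    have h' := integral_stableExponent_sum_indicator (c₀ := c₀) hα₁ (ι := Unit) (fun _ ↦ 0)
      (fun _ ↦ t) (fun _ ↦ zero_le) (fun i j hij ↦ absurd (Subsingleton.elim i j) hij)
      (fun _ ↦ y)
    simp only [Finset.univ_unique, Finset.sum_singleton, NNReal.coe_zero, sub_zero] at h h'
    rw [charFun_apply_real, integral_map (hL t).aemeasurable (by fun_prop)]
    rw [← h']
    have hset : ∫ u in Set.Ioi (0 : ℝ), stableExponent α c₀ (y * ((Set.Iic (t : ℝ)).indicator 1 u -
        (Set.Iic (0 : ℝ)).indicator 1 u)) =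
        ∫ u in Set.Ioi (0 : ℝ), stableExponent α c₀ (y * (Set.Iic (t : ℝ)).indicator 1 u) := by
      refine setIntegral_congr_fun measurableSet_Ioi fun u hu ↦ ?_
      have : u ∉ Set.Iic (0 : ℝ) := fun h ↦ absurd (Set.mem_Iic.1 h) (not_le.2 (Set.mem_Ioi.1 hu))
      simp [this]
    rw [hset, ← h]
    push_cast
    rfl
  have hzero : ∀ᵐ ω ∂Q, L 0 ω = 0 := by
    have h : Q.map (L 0) = Measure.dirac 0 := by
      have := Measure.isProbabilityMeasure_map (μ := Q) (hL 0).aemeasurable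
      refine Measure.ext_of_charFun (funext fun y ↦ ?_)
      rw [hone]
      simp
    have h' : ∀ᵐ x ∂(Q.map (L 0)), x = 0 := by
      rw [h]
      simp [ae_dirac_eq]
    exact ae_of_ae_map (hL 0).aemeasurable h'
  refine ⟨⟨hL, hzero, ?_, ?_, ?_⟩, fun t z ↦ ?_⟩
  · intro n t ht
    have hm (i : Fin n) : Measurable fun ω ↦ L (t i.succ) ω - L (t i.castSucc) ω :=
      (hL _).sub (hL _)
    rw [iIndepFun_iff_charFun_pi fun i ↦ (hm i).aemeasurable]
    intro y
    have hkey : ∀ i j : Fin n, i < j → Disjoint (Set.Ioc (t i.castSucc) (t i.succ))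
        (Set.Ioc (t j.castSucc) (t j.succ)) := by
      intro i j hij
      refine Set.disjoint_left.2 fun u hu hu' ↦ ?_
      have : t i.succ ≤ t j.castSucc := ht (by
        rw [Fin.le_def]; simpa using hij)
      exact absurd (hu.2.trans this) (not_le.2 hu'.1)
    have h := hincr (fun i : Fin n ↦ t i.castSucc) (fun i ↦ t i.succ)
      (fun i ↦ ht (Fin.castSucc_le_succ i)) (fun i j hij ↦ by
        rcases lt_or_gt_of_ne hij with h | h
        · exact hkey i j h
        · exact (hkey j i h).symm) (fun i ↦ y i)
    have hmv : Measurable fun ω ↦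
        WithLp.toLp 2 (fun i : Fin n ↦ L (t i.succ) ω - L (t i.castSucc) ω) := by fun_prop
    rw [charFun_apply, integral_map hmv.aemeasurable (by fun_prop)]
    simp_rw [hincr1 _ _ (ht (Fin.castSucc_le_succ _))]
    rw [← h]
    congr 1 with ω
  · intro s h
    refine ⟨((hL _).sub (hL _)).aemeasurable, (hL h).aemeasurable, ?_⟩
    have := Measure.isProbabilityMeasure_map (μ := Q) (hL h).aemeasurable
    have := Measure.isProbabilityMeasure_map (μ := Q) ((hL (s + h)).sub (hL s)).aemeasurable
    refine Measure.ext_of_charFun (funext fun y ↦ ?_)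
    rw [hone, hincr1 _ _ (by simp)]
    have hsh : ((((s + h : ℝ≥0) : ℝ) - (s : ℝ) : ℝ) : ℂ) = ((h : ℝ) : ℂ) := by
      push_cast
      ring
    rw [hsh]
  · intro t
    rw [tendstoInMeasure_iff_norm]
    intro ε hε
    -- Halving passes from the event `≥ ε` to the strict event `> r` of the tail inequality.
    set r := ε / 2 with hr
    have hr0 : 0 < r := by positivity
    -- The tail inequality only involves frequencies in `[-2/r, 2/r]`, where the continuous exponent
    -- is bounded by `M`. As its real part is nonpositive, `|1 - φ|` is at most `M` times the time
    -- lag.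
    obtain ⟨M, hM⟩ := (isCompact_Icc (a := -2 * r⁻¹) (b := 2 * r⁻¹)).exists_bound_of_continuousOn
      (continuous_stableExponent hα₁ hα₂ hc₀).continuousOn
    have hle (u v : ℝ≥0) (huv : u ≤ v) : Q.real {ω | r < |L v ω - L u ω|} ≤ 4 * M * (v - u) := by
      have hvu : (0 : ℝ) ≤ v - u := sub_nonneg.2 (by exact_mod_cast huv)
      have hm : Measurable fun ω ↦ L v ω - L u ω := (hL v).sub (hL u)
      have := Measure.isProbabilityMeasure_map (μ := Q) hm.aemeasurable
      have h := measureReal_abs_gt_le_integral_charFun (μ := Q.map fun ω ↦ L v ω - L u ω) hr0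
      rw [map_measureReal_apply hm (measurableSet_lt measurable_const (by fun_prop))] at h
      refine h.trans ?_
      have hbound : ‖∫ y in (-2 * r⁻¹)..(2 * r⁻¹), 1 - charFun (Q.map fun ω ↦ L v ω - L u ω) y‖ ≤
          (M * (v - u)) * |2 * r⁻¹ - (-2 * r⁻¹)| := by
        refine intervalIntegral.norm_integral_le_of_norm_le_const fun y hy ↦ ?_
        have hr' : 0 < r⁻¹ := inv_pos.2 hr0
        rw [Set.uIoc_of_le (by linarith)] at hy
        rw [hincr1 u v huv]
        have hre : 0 ≤ (-(((v - u : ℝ) : ℂ) * stableExponent α c₀ y)).re := by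
          rw [Complex.neg_re, Complex.re_ofReal_mul, neg_nonneg]
          exact mul_nonpos_of_nonneg_of_nonpos hvu (stableExponent_re_nonpos hα₁ hα₂ hc₀ y)
        have h1 := norm_one_sub_cexp_neg_le hre
        rw [neg_neg, norm_neg, norm_mul, Complex.norm_real, Real.norm_of_nonneg hvu] at h1
        refine h1.trans ?_
        rw [mul_comm]
        gcongr
        exact hM y ⟨hy.1.le, hy.2⟩
      calc 2⁻¹ * r * ‖∫ y in (-2 * r⁻¹)..(2 * r⁻¹),
            1 - charFun (Q.map fun ω ↦ L v ω - L u ω) y‖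
          ≤ 2⁻¹ * r * ((M * (v - u)) * |2 * r⁻¹ - (-2 * r⁻¹)|) := by gcongr
        _ = 4 * M * (v - u) / 2 := by
            have hr' : 0 < r⁻¹ := inv_pos.2 hr0
            rw [abs_of_pos (by linarith)]
            field_simp
            ring
        _ ≤ 4 * M * (v - u) := by
            have hM0 : 0 ≤ M := (norm_nonneg _).trans (hM 0 ⟨by
              have : 0 < r⁻¹ := inv_pos.2 hr0
              linarith, by positivity⟩)
            have : 0 ≤ 4 * M * (v - u : ℝ) := by positivity
            linarith
    have hbd (s : ℝ≥0) : Q {ω | ε ≤ ‖L s ω - L t ω‖} ≤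
        ENNReal.ofReal (4 * M * |(s : ℝ) - t|) := by
      have hsub : Q {ω | ε ≤ ‖L s ω - L t ω‖} ≤ Q {ω | r < |L s ω - L t ω|} :=
        measure_mono fun ω hω ↦ by
          have h1 : ε ≤ |L s ω - L t ω| := hω
          change r < |L s ω - L t ω|
          linarith
      refine hsub.trans ?_
      rw [← ofReal_measureReal]
      refine ENNReal.ofReal_le_ofReal ?_
      rcases le_total s t with h | h
      · have := hle s t h
        simp_rw [abs_sub_comm (L s _)]
        rwa [abs_sub_comm, abs_of_nonneg (sub_nonneg.2 (by exact_mod_cast h))]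
      · rw [abs_of_nonneg (sub_nonneg.2 (by exact_mod_cast h))]
        exact hle t s h
    refine tendsto_of_tendsto_of_tendsto_of_le_of_le tendsto_const_nhds ?_ (fun _ ↦ zero_le) hbd
    have hc : Continuous fun s : ℝ≥0 ↦ ENNReal.ofReal (4 * M * |(s : ℝ) - t|) :=
      ENNReal.continuous_ofReal.comp (by fun_prop)
    exact hc.tendsto' _ _ (by simp)
  · rw [hone, stableExponent]
    congr 1
    push_cast
    ring

/-! ### Jump paths and moments of the seed process. -/

namespace IsJumpSequence

variable {τ : ℕ → ℝ≥0∞}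

lemma monotone (h : IsJumpSequence τ) : Monotone τ := by
  refine monotone_nat_of_le_succ fun k ↦ ?_
  by_cases hk : τ k = ∞
  · rw [h.top_succ k hk]; exact le_top
  · exact (h.lt_succ k hk).le

lemma one_pos (h : IsJumpSequence τ) : 0 < τ 1 := by
  have := h.lt_succ 0 (by simp [h.zero])
  rwa [h.zero] at this

lemma jumpPath_eq (h : IsJumpSequence τ) {u : ℝ≥0} {k : ℕ} (h1 : τ k ≤ u) (h2 : u < τ (k + 1)) :
    jumpPath τ u = k := by
  unfold jumpPath
  rw [tsum_eq_single k, Set.indicator_of_mem (Set.mem_Ico.2 ⟨h1, h2⟩)]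
  intro l hl
  refine Set.indicator_of_notMem (fun hu ↦ ?_) _
  rcases lt_or_gt_of_ne hl with hl | hl
  · exact absurd (hu.2.trans_le (h.monotone (Nat.succ_le_of_lt hl))) (not_lt.2 h1)
  · exact absurd (h2.trans_le (h.monotone (Nat.succ_le_of_lt hl))) (not_lt.2 hu.1)

lemma exists_mem_Ico (h : IsJumpSequence τ) (u : ℝ≥0) :
    ∃ k, τ k ≤ u ∧ u < τ (k + 1) ∧ jumpPath τ u = k := by
  have hex : ∃ k, (u : ℝ≥0∞) < τ k :=
    (h.tendsto_top.eventually (lt_mem_nhds ENNReal.coe_lt_top)).exists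
  classical
  have h0 : Nat.find hex ≠ 0 := fun h0 ↦ by
    have := Nat.find_spec hex
    rw [h0, h.zero] at this
    exact not_lt_bot this
  obtain ⟨k, hk⟩ := Nat.exists_eq_succ_of_ne_zero h0
  have h1 : τ k ≤ u := not_lt.1 (Nat.find_min hex (by omega))
  have h2 : (u : ℝ≥0∞) < τ (k + 1) := by
    have := Nat.find_spec hex
    rwa [hk] at this
  exact ⟨k, h1, h2, h.jumpPath_eq h1 h2⟩

lemma min_jumpPath_one (h : IsJumpSequence τ) (u : ℝ≥0) :
    min (jumpPath τ u) 1 = if τ 1 ≤ u then 1 else 0 := by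
  obtain ⟨k, h1, h2, hk⟩ := h.exists_mem_Ico u
  rw [hk]
  split_ifs with hu
  · have : 1 ≤ k := by
      by_contra hlt
      obtain rfl : k = 0 := by omega
      exact absurd hu (not_le.2 h2)
    simpa using this
  · have : k = 0 := by
      by_contra hne
      exact hu ((h.monotone (Nat.one_le_iff_ne_zero.2 hne)).trans h1)
    simp [this]

/-- The entry point of the second-jump moment condition: before the second jump the path is at most
one and truncation removes nothing. -/
lemma jumpPath_sub_min_le (h : IsJumpSequence τ) (u : ℝ≥0) :
    jumpPath τ u - min (jumpPath τ u) 1 ≤ if τ 2 ≤ u then jumpPath τ u else 0 := by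
  obtain ⟨k, h1, h2, hk⟩ := h.exists_mem_Ico u
  rw [hk]
  split_ifs with hu
  · have : (0 : ℝ) ≤ min (k : ℝ) 1 := by positivity
    linarith
  · have : k ≤ 1 := by
      by_contra hne
      exact hu ((h.monotone (show 2 ≤ k by omega)).trans h1)
    have : (k : ℝ) ≤ 1 := by exact_mod_cast this
    simp [this]

/-- Paths take values in the natural numbers, on which powers increase with the exponent; this gives
the finite second moments. -/
lemma jumpPath_sq_le_rpow (h : IsJumpSequence τ) (u : ℝ≥0) {δ : ℝ} (hδ : 0 ≤ δ) :
    jumpPath τ u ^ 2 ≤ jumpPath τ u ^ (2 + δ) := by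
  obtain ⟨k, -, -, hk⟩ := h.exists_mem_Ico u
  rw [hk, ← Real.rpow_natCast]
  rcases Nat.eq_zero_or_pos k with rfl | hpos
  · rw [Nat.cast_zero, Real.zero_rpow (by norm_num), Real.zero_rpow (by linarith)]
  · exact Real.rpow_le_rpow_of_exponent_le (by exact_mod_cast hpos) (by push_cast; linarith)

lemma jumpPath_zero (h : IsJumpSequence τ) : jumpPath τ 0 = 0 := by
  have := h.jumpPath_eq (u := 0) (k := 0) (by simp [h.zero]) (by simpa using h.one_pos)
  simpa using this

end IsJumpSequence

lemma jumpPath_nonneg (τ : ℕ → ℝ≥0∞) (u : ℝ≥0) : 0 ≤ jumpPath τ u :=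
  tsum_nonneg fun k ↦ Set.indicator_nonneg (fun _ _ ↦ Nat.cast_nonneg k) _

/-- The part of a nonnegative number exceeding one. -/
def excess (x : ℝ) : ℝ := x - min x 1

lemma excess_nonneg (x : ℝ) : 0 ≤ excess x := sub_nonneg.2 (min_le_left _ _)

lemma continuous_excess : Continuous excess := by unfold excess; fun_prop

lemma min_add_excess (x : ℝ) : min x 1 + excess x = x := by unfold excess; ring

lemma excess_le {x : ℝ} (hx : 0 ≤ x) : excess x ≤ x := by
  have : 0 ≤ min x 1 := by positivity
  unfold excess
  linarith

section Seed

variable {Ω : Type*} [MeasurableSpace Ω] {P : Measure Ω} {τ : ℕ → Ω → ℝ≥0∞} {α c₀ : ℝ}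
  {a : ℕ → ℝ≥0}

/-- The comparison sequence is shifted to `j + 1` so that it never vanishes; a bound for large `j`
then extends to all `j`, including `j = 0`. -/
lemma isBigO_add_one_rpow (hα : 0 ≤ α)
    (ha : (fun j : ℕ ↦ (a j : ℝ)) ~[atTop] fun j : ℕ ↦ c₀ * (j : ℝ) ^ (-α)) :
    (fun j : ℕ ↦ (a j : ℝ)) =O[atTop] fun j : ℕ ↦ ((j : ℝ) + 1) ^ (-α) := by
  refine ha.isBigO.trans ((isBigO_const_mul_self c₀ _ _).trans ?_)
  refine IsBigO.of_bound (2 ^ α) ?_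
  filter_upwards [eventually_ge_atTop 1] with j hj
  have hj' : (1 : ℝ) ≤ j := by exact_mod_cast hj
  rw [Real.norm_of_nonneg (by positivity), Real.norm_of_nonneg (by positivity)]
  have h1 : ((j : ℝ) + 1) ^ α ≤ (2 * j) ^ α := Real.rpow_le_rpow (by positivity) (by linarith) hα
  rw [Real.mul_rpow (by norm_num) (by positivity)] at h1
  rw [Real.rpow_neg (by positivity), Real.rpow_neg (by positivity), ← div_eq_mul_inv,
    inv_eq_one_div, div_le_div_iff₀ (by positivity) (by positivity)]
  linarith

lemma tendsto_zero_of_isEquivalent (hα : 0 < α)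
    (ha : (fun j : ℕ ↦ (a j : ℝ)) ~[atTop] fun j : ℕ ↦ c₀ * (j : ℝ) ^ (-α)) :
    Tendsto a atTop (𝓝 0) := by
  have h : Tendsto (fun j : ℕ ↦ c₀ * (j : ℝ) ^ (-α)) atTop (𝓝 0) := by
    have := ((tendsto_rpow_neg_atTop hα).comp tendsto_natCast_atTop_atTop).const_mul c₀
    simpa using this
  have := ha.symm.tendsto_nhds h
  rw [← NNReal.tendsto_coe, NNReal.coe_zero]
  exact this

lemma eventually_pos_of_isEquivalent (hc₀ : 0 < c₀)
    (ha : (fun j : ℕ ↦ (a j : ℝ)) ~[atTop] fun j : ℕ ↦ c₀ * (j : ℝ) ^ (-α)) :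
    ∀ᶠ j in atTop, 0 < a j := by
  have h1 : ∀ᶠ j : ℕ in atTop, 0 < c₀ * (j : ℝ) ^ (-α) := by
    filter_upwards [eventually_gt_atTop 0] with j hj
    have : (0 : ℝ) < j := by exact_mod_cast hj
    positivity
  obtain ⟨w, hw, hv⟩ := ha.exists_eq_mul
  filter_upwards [h1, hv, hw.eventually (lt_mem_nhds one_pos)] with j hj hvj hwj
  have : (0 : ℝ) < a j := by
    rw [hvj]
    exact mul_pos hwj hj
  exact_mod_cast this

lemma integrable_seedProcess_sq (hτ : ∀ᵐ ω ∂P, IsJumpSequence (fun k ↦ τ k ω))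
    (hm : ∀ u, AEMeasurable (seedProcess τ u) P) {δ : ℝ} (hδ : 0 ≤ δ)
    (hZ1 : ∀ u : ℝ≥0, 0 < u → Integrable (fun ω ↦ seedProcess τ u ω ^ (2 + δ)) P) (u : ℝ≥0) :
    Integrable (fun ω ↦ seedProcess τ u ω ^ 2) P := by
  rcases eq_or_ne u 0 with rfl | hu
  · refine (integrable_zero Ω ℝ P).congr ?_
    filter_upwards [hτ] with ω hω
    simp [seedProcess, hω.jumpPath_zero]
  · refine (hZ1 u (pos_iff_ne_zero.2 hu)).mono' ((hm u).pow_const 2).aestronglyMeasurable ?_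
    filter_upwards [hτ] with ω hω
    rw [Real.norm_of_nonneg (by positivity)]
    exact hω.jumpPath_sq_le_rpow u hδ

lemma exists_measureReal_jump_le (hα : 0 ≤ α)
    (ha : (fun j : ℕ ↦ (a j : ℝ)) ~[atTop] fun j : ℕ ↦ c₀ * (j : ℝ) ^ (-α))
    (hτ : ∀ᵐ ω ∂P, IsJumpSequence (fun k ↦ τ k ω))
    {θ : ℝ → ℝ} (hθ_nonneg : ∀ y, 0 ≤ θ y)
    (hθ_bdd : ∃ C, ∀ y, θ y ≤ C)
    (hθ_density : ∀ u : ℝ≥0, P.real {ω | 0 < τ 1 ω ∧ τ 1 ω ≤ u} = ∫ y in (0 : ℝ)..u, θ y) :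
    ∃ C, ∀ j, P.real {ω | τ 1 ω ≤ a j} ≤ C * ((j : ℝ) + 1) ^ (-α) := by
  obtain ⟨K, hK⟩ := hθ_bdd
  have hpos (j : ℕ) : ((j : ℝ) + 1) ^ (-α) ≠ 0 := by positivity
  obtain ⟨C, hC, h⟩ := bound_of_isBigO_nat_atTop (isBigO_add_one_rpow hα ha)
  refine ⟨K * C, fun j ↦ ?_⟩
  have hj := h (hpos j)
  rw [Real.norm_of_nonneg (by positivity), Real.norm_of_nonneg (by positivity)] at hj
  have hK0 : 0 ≤ K := (hθ_nonneg 0).trans (hK 0)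
  have heq : P.real {ω | τ 1 ω ≤ a j} = ∫ y in (0 : ℝ)..a j, θ y := by
    rw [← hθ_density]
    refine measureReal_congr ?_
    filter_upwards [hτ] with ω hω
    refine propext ⟨fun h ↦ ⟨hω.one_pos, h⟩, fun h ↦ h.2⟩
  have hb := intervalIntegral.norm_integral_le_of_norm_le_const (a := 0) (b := (a j : ℝ)) (f := θ)
    (C := K) fun y _ ↦ by
      rw [Real.norm_of_nonneg (hθ_nonneg y)]
      exact hK y
  rw [heq]
  refine (le_abs_self _).trans (hb.trans ?_)
  rw [sub_zero, abs_of_nonneg (by positivity), mul_assoc]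
  gcongr

lemma exists_integral_excess_sq_le (hα : 0 < α) (hc₀ : 0 < c₀)
    (ha : (fun j : ℕ ↦ (a j : ℝ)) ~[atTop] fun j : ℕ ↦ c₀ * (j : ℝ) ^ (-α))
    (hτ : ∀ᵐ ω ∂P, IsJumpSequence (fun k ↦ τ k ω)) (hτm : Measurable (τ 2))
    (hsq : ∀ u, Integrable (fun ω ↦ seedProcess τ u ω ^ 2) P)
    (hZ2 : (fun u : ℝ≥0 ↦ ∫ ω, {ω | τ 2 ω ≤ u}.indicator (fun ω ↦ seedProcess τ u ω ^ 2) ω ∂P)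
      =O[𝓝[>] 0] fun u : ℝ≥0 ↦ (u : ℝ) ^ 2) :
    ∃ C, ∀ j, ∫ ω, excess (seedProcess τ (a j) ω) ^ 2 ∂P ≤ C * ((j : ℝ) + 1) ^ (-(2 * α)) := by
  have hpos (j : ℕ) : ((j : ℝ) + 1) ^ (-(2 * α)) ≠ 0 := by positivity
  -- The moment condition is a statement about `u → 0` through positive values, so it is applied
  -- along the eventually positive `a_j`.
  have hlim : Tendsto a atTop (𝓝[>] 0) := tendsto_nhdsWithin_iff.2
    ⟨tendsto_zero_of_isEquivalent hα ha, eventually_pos_of_isEquivalent hc₀ ha⟩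
  have hO : (fun j ↦ ∫ ω, excess (seedProcess τ (a j) ω) ^ 2 ∂P) =O[atTop]
      fun j : ℕ ↦ ((j : ℝ) + 1) ^ (-(2 * α)) := by
    have h1 : (fun j ↦ ∫ ω, excess (seedProcess τ (a j) ω) ^ 2 ∂P) =O[atTop]
        fun j ↦ ∫ ω, {ω | τ 2 ω ≤ a j}.indicator (fun ω ↦ seedProcess τ (a j) ω ^ 2) ω ∂P := by
      refine IsBigO.of_bound' (Eventually.of_forall fun j ↦ ?_)
      rw [Real.norm_of_nonneg (integral_nonneg fun ω ↦ sq_nonneg _), Real.norm_of_nonneg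
        (integral_nonneg fun ω ↦ Set.indicator_nonneg (fun _ _ ↦ sq_nonneg _) _)]
      refine integral_mono_of_nonneg (Eventually.of_forall fun ω ↦ sq_nonneg _)
        ((hsq _).indicator (measurableSet_le hτm measurable_const)) ?_
      filter_upwards [hτ] with ω hω
      have h := hω.jumpPath_sub_min_le (a j)
      have h0 := excess_nonneg (seedProcess τ (a j) ω)
      by_cases hmem : τ 2 ω ≤ a j
      · rw [Set.indicator_of_mem (show ω ∈ {ω | τ 2 ω ≤ a j} from hmem)]
        rw [if_pos hmem] at h
        exact pow_le_pow_left₀ h0 h 2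
      · rw [Set.indicator_of_notMem (show ω ∉ {ω | τ 2 ω ≤ a j} from hmem)]
        rw [if_neg hmem] at h
        have : excess (seedProcess τ (a j) ω) = 0 := le_antisymm h h0
        simp [this]
    refine h1.trans ((hZ2.comp_tendsto hlim).trans (((isBigO_add_one_rpow hα.le ha).pow 2).trans ?_))
    refine (isBigO_refl _ _).congr_right fun j ↦ ?_
    rw [← Real.rpow_natCast, ← Real.rpow_mul (by positivity)]
    congr 1
    push_cast
    ring
  obtain ⟨C, hC, h⟩ := bound_of_isBigO_nat_atTop hO
  refine ⟨C, fun j ↦ (le_abs_self _).trans ?_⟩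
  have hj := h (hpos j)
  rwa [Real.norm_of_nonneg (show (0 : ℝ) ≤ ((j : ℝ) + 1) ^ (-(2 * α)) by positivity)] at hj

end Seed

/-! ### Series of random variables, shifts and centred sums. -/

section SeriesInLp

variable {Ω : Type*} [MeasurableSpace Ω] {P : Measure Ω}

lemma memLp_tsum {p : ℝ≥0∞} [Fact (1 ≤ p)] {f : ℕ → Ω → ℝ} (hf : ∀ j, MemLp (f j) p P)
    (hs : ∑' j, eLpNorm (f j) p P ≠ ∞) :
    (∀ᵐ ω ∂P, Summable fun j ↦ f j ω) ∧ MemLp (fun ω ↦ ∑' j, f j ω) p P := by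
  refine ⟨?_, ?_⟩
  · filter_upwards [summable_norm_of_tsum_eLpNorm_ne_top Fact.out (fun j ↦ (hf j).1) hs] with ω hω
    exact hω.of_norm
  · have h := Lp.coeFn_tsum (f := fun j ↦ (hf j).toLp (f j)) (by simpa [Lp.enorm_toLp] using hs)
    refine (Lp.memLp (∑' j, (hf j).toLp (f j))).ae_eq (h.trans ?_)
    filter_upwards [ae_all_iff.2 fun j ↦ (hf j).coeFn_toLp] with ω hω
    simp_rw [hω]

lemma memLp_two_tsum {f : ℕ → Ω → ℝ} (hf : ∀ j, MemLp (f j) 2 P) {b : ℕ → ℝ} (hb : Summable b)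
    (hb0 : ∀ j, 0 ≤ b j) (hfb : ∀ j, ∫ ω, f j ω ^ 2 ∂P ≤ b j ^ 2) :
    (∀ᵐ ω ∂P, Summable fun j ↦ f j ω) ∧ MemLp (fun ω ↦ ∑' j, f j ω) 2 P := by
  refine memLp_tsum hf (ne_of_lt (lt_of_le_of_lt (ENNReal.tsum_le_tsum fun j ↦ ?_)
    (hb.tsum_ofReal_lt_top)))
  rw [(hf j).eLpNorm_eq_integral_rpow_norm (by simp) (by simp)]
  refine ENNReal.ofReal_le_ofReal ?_
  have h2 : ∫ ω, ‖f j ω‖ ^ (2 : ℝ≥0∞).toReal ∂P = ∫ ω, f j ω ^ 2 ∂P := by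
    refine integral_congr_ae (Eventually.of_forall fun ω ↦ ?_)
    simp
  rw [h2]
  have h3 : (∫ ω, f j ω ^ 2 ∂P) ^ ((2 : ℝ≥0∞).toReal⁻¹) = √(∫ ω, f j ω ^ 2 ∂P) := by
    rw [Real.sqrt_eq_rpow]
    simp
  rw [h3]
  exact Real.sqrt_le_iff.2 ⟨hb0 j, hfb j⟩

lemma integrable_tsum_of_summable {f : ℕ → Ω → ℝ} (hf : ∀ j, Integrable (f j) P) {b : ℕ → ℝ}
    (hb : Summable b) (hfb : ∀ j, ∫ ω, |f j ω| ∂P ≤ b j) :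
    (∀ᵐ ω ∂P, Summable fun j ↦ f j ω) ∧ Integrable (fun ω ↦ ∑' j, f j ω) P ∧
      ∫ ω, ∑' j, f j ω ∂P = ∑' j, ∫ ω, f j ω ∂P ∧ ∫ ω, |∑' j, f j ω| ∂P ≤ ∑' j, b j := by
  have hs : Summable fun j ↦ ∫ ω, ‖f j ω‖ ∂P :=
    hb.of_nonneg_of_le (fun j ↦ integral_nonneg fun _ ↦ norm_nonneg _) hfb
  have hn : Summable fun j ↦ ∫ ω, ‖‖f j ω‖‖ ∂P := by simpa using hs
  have hp : ∑' j, eLpNorm (f j) 1 P ≠ ∞ := by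
    refine ne_of_eq_of_ne (tsum_congr fun j ↦ ?_) hs.tsum_ofReal_ne_top
    rw [eLpNorm_one_eq_lintegral_enorm, ofReal_integral_norm_eq_lintegral_enorm (hf j)]
  have hmem (j : ℕ) : MemLp (f j) 1 P := memLp_one_iff_integrable.2 (hf j)
  obtain ⟨h1, h2⟩ := memLp_tsum hmem hp
  have h1' := summable_norm_of_tsum_eLpNorm_ne_top le_rfl (fun j ↦ (hmem j).1) hp
  have h3 := (memLp_tsum (fun j ↦ (hmem j).norm) (by simpa only [eLpNorm_norm] using hp)).2
  refine ⟨h1, memLp_one_iff_integrable.1 h2, (integral_tsum_of_summable_integral_norm hf hs).symm,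
    ?_⟩
  calc ∫ ω, |∑' j, f j ω| ∂P ≤ ∫ ω, ∑' j, ‖f j ω‖ ∂P := by
        refine integral_mono_ae (memLp_one_iff_integrable.1 h2).norm
          (memLp_one_iff_integrable.1 h3) ?_
        filter_upwards [h1'] with ω hω
        exact norm_tsum_le_tsum_norm hω
    _ = ∑' j, ∫ ω, ‖f j ω‖ ∂P :=
        (integral_tsum_of_summable_integral_norm (fun j ↦ (hf j).norm) hn).symm
    _ ≤ ∑' j, b j := hs.tsum_le_tsum hfb hb

lemma sum_Icc_shift_sub (y : ℤ → ℝ) (N : ℕ) :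
    ∑ k ∈ Finset.Icc 1 N, (y ((k : ℤ) - 1) - y k) = y 0 - y N := by
  induction N with
  | zero => simp
  | succ N ih =>
    rw [Finset.sum_Icc_succ_top (by omega), ih]
    push_cast
    rw [add_sub_cancel_right]
    ring

/-- Two competing bounds. Estimating the `N` differences separately gives `2eN`. A shift by one
telescopes to two boundary terms and costs `2e`, so `i` successive shifts cost `2ei`. -/
lemma integral_abs_sum_shift_sub_le {x : ℤ → Ω → ℝ} (hx : ∀ s, Integrable (x s) P) {e : ℝ}
    (he : ∀ s, ∫ ω, |x s ω| ∂P ≤ e) (N i : ℕ) :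
    ∫ ω, |∑ k ∈ Finset.Icc 1 N, (x ((k : ℤ) - i) ω - x k ω)| ∂P ≤ 2 * e * (min i N : ℕ) := by
  have he0 : 0 ≤ e := (integral_nonneg fun _ ↦ abs_nonneg _).trans (he 0)
  have hint (u v : ℤ) : Integrable (fun ω ↦ |x u ω - x v ω|) P := ((hx u).sub (hx v)).abs
  have h2 (u v : ℤ) : ∫ ω, |x u ω - x v ω| ∂P ≤ 2 * e := by
    calc ∫ ω, |x u ω - x v ω| ∂P ≤ ∫ ω, (|x u ω| + |x v ω|) ∂P :=
          integral_mono (hint u v) ((hx u).abs.add (hx v).abs) fun ω ↦ abs_sub _ _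
      _ = ∫ ω, |x u ω| ∂P + ∫ ω, |x v ω| ∂P := integral_add (hx u).abs (hx v).abs
      _ ≤ 2 * e := by linarith [he u, he v]
  have hsum (i : ℕ) : Integrable
      (fun ω ↦ |∑ k ∈ Finset.Icc 1 N, (x ((k : ℤ) - i) ω - x k ω)|) P :=
    (integrable_finsetSum _ fun k _ ↦ (hx _).sub (hx _)).abs
  have hN : ∫ ω, |∑ k ∈ Finset.Icc 1 N, (x ((k : ℤ) - i) ω - x k ω)| ∂P ≤ 2 * e * N := by
    calc _ ≤ ∫ ω, ∑ k ∈ Finset.Icc 1 N, |x ((k : ℤ) - i) ω - x k ω| ∂P :=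
          integral_mono (hsum i) (integrable_finsetSum _ fun k _ ↦ hint _ _)
            fun ω ↦ Finset.abs_sum_le_sum_abs _ _
      _ = ∑ k ∈ Finset.Icc 1 N, ∫ ω, |x ((k : ℤ) - i) ω - x k ω| ∂P :=
          integral_finsetSum _ fun k _ ↦ hint _ _
      _ ≤ ∑ k ∈ Finset.Icc 1 N, 2 * e := Finset.sum_le_sum fun k _ ↦ h2 _ _
      _ = 2 * e * N := by simp [mul_comm]
  have hi : ∫ ω, |∑ k ∈ Finset.Icc 1 N, (x ((k : ℤ) - i) ω - x k ω)| ∂P ≤ 2 * e * i := by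
    clear hN
    induction i with
    | zero => simp
    | succ i ih =>
      have hstep (ω : Ω) : |∑ k ∈ Finset.Icc 1 N, (x ((k : ℤ) - (i + 1 : ℕ)) ω - x k ω)| ≤
          |x (0 - i) ω - x (N - i) ω| + |∑ k ∈ Finset.Icc 1 N, (x ((k : ℤ) - i) ω - x k ω)| := by
        rw [← sum_Icc_shift_sub (fun k ↦ x (k - i) ω) N]
        refine le_trans (le_of_eq ?_) (abs_add_le _ _)
        rw [← Finset.sum_add_distrib]
        congr 1
        refine Finset.sum_congr rfl fun k _ ↦ ?_
        rw [show (k : ℤ) - (i + 1 : ℕ) = (k : ℤ) - 1 - i by push_cast; ring]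
        ring
      calc _ ≤ ∫ ω, (|x (0 - i) ω - x (N - i) ω| +
              |∑ k ∈ Finset.Icc 1 N, (x ((k : ℤ) - i) ω - x k ω)|) ∂P :=
            integral_mono (hsum (i + 1)) ((hint _ _).add (hsum i)) hstep
        _ = ∫ ω, |x (0 - i) ω - x (N - i) ω| ∂P +
              ∫ ω, |∑ k ∈ Finset.Icc 1 N, (x ((k : ℤ) - i) ω - x k ω)| ∂P :=
            integral_add (hint _ _) (hsum i)
        _ ≤ 2 * e + 2 * e * i := add_le_add (h2 _ _) ih
        _ = 2 * e * (i + 1 : ℕ) := by push_cast; ring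
  rcases le_total i N with h | h
  · rwa [min_eq_left h]
  · rwa [min_eq_right h]

end SeriesInLp

/-- Pairwise independence makes variances add, and the `L¹` norm is at most the `L²` norm. -/
lemma integral_abs_sum_centered_le {Ω : Type*} [MeasurableSpace Ω] {P : Measure Ω}
    [IsProbabilityMeasure P] {V : ℕ → Ω → ℝ} (hV : ∀ s, MemLp (V s) 2 P)
    (hind : Pairwise fun s t ↦ IndepFun (V s) (V t) P) {m v : ℝ} (hm : ∀ s, ∫ ω, V s ω ∂P = m)
    (hv : ∀ s, Var[V s; P] = v) (S : Finset ℕ) :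
    ∫ ω, |∑ s ∈ S, (V s ω - m)| ∂P ≤ √v * √(S.card : ℝ) := by
  have hmem : MemLp (fun ω ↦ ∑ s ∈ S, (V s ω - m)) 2 P :=
    memLp_finsetSum _ fun s _ ↦ (hV s).sub (memLp_const m)
  have hvar : ∫ ω, (∑ s ∈ S, (V s ω - m)) ^ 2 ∂P = S.card * v := by
    have h := IndepFun.variance_sum (X := V) (s := S) (fun s _ ↦ hV s)
      (fun s _ t _ hst ↦ hind hst)
    simp only [hv, Finset.sum_const, nsmul_eq_mul] at h
    rw [← h, variance_eq_integral (by
      exact (memLp_finsetSum' _ fun s _ ↦ hV s).aestronglyMeasurable.aemeasurable)]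
    refine integral_congr_ae (Eventually.of_forall fun ω ↦ ?_)
    simp only [Finset.sum_apply]
    rw [integral_finsetSum _ fun s _ ↦ (hV s).integrable one_le_two, Finset.sum_sub_distrib]
    simp only [hm]
  have hsq : (∫ ω, |∑ s ∈ S, (V s ω - m)| ∂P) ^ 2 ≤ ∫ ω, (∑ s ∈ S, (V s ω - m)) ^ 2 ∂P := by
    have h := variance_nonneg (fun ω ↦ |∑ s ∈ S, (V s ω - m)|) P
    rw [variance_eq_sub (show MemLp (fun ω ↦ |∑ s ∈ S, (V s ω - m)|) 2 P from hmem.abs)] at h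
    simpa using h
  rw [hvar, mul_comm] at hsq
  rcases le_total 0 v with h0 | h0
  · rw [← Real.sqrt_mul h0]
    exact Real.le_sqrt_of_sq_le hsq
  · have : v * S.card ≤ 0 := mul_nonpos_of_nonpos_of_nonneg h0 (by positivity)
    have h1 : (∫ ω, |∑ s ∈ S, (V s ω - m)| ∂P) = 0 := by
      have := le_antisymm (hsq.trans this) (sq_nonneg _)
      simpa using this
    rw [h1]
    positivity


/-! ### Reduction of the trawl sum to an i.i.d. sum. -/

/-- The sum of a sequence whose terms are truncated at one. -/
def truncatedSum (x : ℕ → ℝ) : ℝ := ∑' j, min (x j) 1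

lemma measurable_truncatedSum : Measurable truncatedSum :=
  Measurable.tsum fun j ↦ (measurable_pi_apply j).min measurable_const

lemma measurable_tsum_excess : Measurable fun x : ℕ → ℝ ↦ ∑' j, excess (x j) :=
  Measurable.tsum fun j ↦ continuous_excess.measurable.comp (measurable_pi_apply j)

lemma abs_min_one_le (x : ℝ) : |min x 1| ≤ |x| := by
  rcases le_total x 1 with h | h
  · rw [min_eq_left h]
  · rw [min_eq_right h, abs_one]
    exact h.trans (le_abs_self x)

lemma summable_add_one_rpow {p : ℝ} (hp : p < -1) : Summable fun j : ℕ ↦ ((j : ℝ) + 1) ^ p := by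
  have := (summable_nat_add_iff 1).2 (Real.summable_nat_rpow.2 hp)
  simpa using this

/-- Interpolation between the two bounds on the shift error: part of the growth is charged to
summability in `j`, the rest to the power of `N`. -/
lemma min_le_rpow_mul_rpow (j N : ℕ) {κ : ℝ} (h0 : 0 < κ) (h1 : κ < 1) :
    ((min j N : ℕ) : ℝ) ≤ ((j : ℝ) + 1) ^ κ * (N : ℝ) ^ (1 - κ) := by
  have hmin : (0 : ℝ) ≤ (min j N : ℕ) := Nat.cast_nonneg _
  calc ((min j N : ℕ) : ℝ) = ((min j N : ℕ) : ℝ) ^ κ * ((min j N : ℕ) : ℝ) ^ (1 - κ) := by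
        rw [← Real.rpow_add' hmin (by simp)]
        simp
    _ ≤ ((j : ℝ) + 1) ^ κ * (N : ℝ) ^ (1 - κ) := by
        have hj : ((min j N : ℕ) : ℝ) ≤ (j : ℝ) + 1 := by
          have : ((min j N : ℕ) : ℝ) ≤ j := by exact_mod_cast min_le_left j N
          linarith
        have hN : ((min j N : ℕ) : ℝ) ≤ N := by exact_mod_cast min_le_right j N
        have := Real.rpow_le_rpow hmin hN (sub_pos.2 h1).le
        gcongr

lemma natCast_rpow_le_rpow (N : ℕ) {p q : ℝ} (hp : 0 < p) (hpq : p ≤ q) :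
    (N : ℝ) ^ p ≤ (N : ℝ) ^ q := by
  rcases Nat.eq_zero_or_pos N with rfl | hN
  · rw [Nat.cast_zero, Real.zero_rpow hp.ne', Real.zero_rpow (hp.trans_le hpq).ne']
  · exact Real.rpow_le_rpow_of_exponent_le (by exact_mod_cast hN) hpq

section Reduction

variable {Ω : Type*} [MeasurableSpace Ω] {P : Measure Ω} [IsProbabilityMeasure P]
  {ξ : ℤ → ℕ → Ω → ℝ} {α C : ℝ}

/-- The trawl sum of an array of independent identically distributed sequences is, up to a
negligible error, a sum of independent identically distributed variables. -/
theorem exists_integral_abs_trawlSum_sub_le (hα₁ : 1 < α) (hα₂ : α < 2)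
    (hm : ∀ s j, Measurable (ξ s j)) (hindep : iIndepFun (fun s ω j ↦ ξ s j ω) P)
    (hident : ∀ s, IdentDistrib (fun ω j ↦ ξ s j ω) (fun ω j ↦ ξ 0 j ω) P P)
    (hint : ∀ j, Integrable (ξ 0 j) P)
    (hint_le : ∀ j, ∫ ω, |ξ 0 j ω| ∂P ≤ C * ((j : ℝ) + 1) ^ (-α))
    (hexc : ∀ j, MemLp (fun ω ↦ excess (ξ 0 j ω)) 2 P)
    (hexc_le : ∀ j, ∫ ω, excess (ξ 0 j ω) ^ 2 ∂P ≤ (C * ((j : ℝ) + 1) ^ (-α)) ^ 2) :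
    (∀ k : ℤ, (∀ᵐ ω ∂P, Summable fun j : ℕ ↦ ξ (k - j) j ω) ∧
      Integrable (fun ω ↦ ∑' j : ℕ, ξ (k - j) j ω) P) ∧
    (∀ s, Integrable (fun ω ↦ truncatedSum fun j ↦ ξ s j ω) P) ∧
    ∃ K ρ, 0 < ρ ∧ ρ < 1 / α ∧ ∀ N : ℕ,
      ∫ ω, |(∑ k ∈ Finset.Icc 1 N, ∑' j : ℕ, ξ ((k : ℤ) - j) j ω -
          ∫ ω', ∑ k ∈ Finset.Icc 1 N, ∑' j : ℕ, ξ ((k : ℤ) - j) j ω' ∂P) -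
        ∑ s ∈ Finset.Icc 1 N, ((truncatedSum fun j ↦ ξ (s : ℤ) j ω) -
          ∫ ω', (truncatedSum fun j ↦ ξ 0 j ω') ∂P)| ∂P ≤ K * (N : ℝ) ^ ρ := by
  have hC : 0 ≤ C := by
    have h := (integral_nonneg fun _ ↦ abs_nonneg _).trans (hint_le 0)
    simpa using h
  set e : ℕ → ℝ := fun j ↦ C * ((j : ℝ) + 1) ^ (-α) with he
  have he0 (j : ℕ) : 0 ≤ e j := by positivity
  have hes : Summable e := (summable_add_one_rpow (by linarith)).mul_left C
  have hid (s : ℤ) (j : ℕ) : IdentDistrib (ξ s j) (ξ 0 j) P P :=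
    (hident s).comp (measurable_pi_apply j)
  have hsint (s : ℤ) (j : ℕ) : Integrable (ξ s j) P := (hid s j).integrable_iff.2 (hint j)
  have hsint_le (s : ℤ) (j : ℕ) : ∫ ω, |ξ s j ω| ∂P ≤ e j := by
    have := ((hid s j).comp (u := fun x : ℝ ↦ |x|) (by fun_prop)).integral_eq
    exact this.trans_le (hint_le j)
  have hmean (s : ℤ) (j : ℕ) : ∫ ω, ξ s j ω ∂P = ∫ ω, ξ 0 j ω ∂P := (hid s j).integral_eq
  have hT (k : ℤ) := integrable_tsum_of_summable (P := P) (f := fun j : ℕ ↦ ξ (k - j) j)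
    (fun j ↦ hsint _ j) hes (fun j ↦ hsint_le _ j)
  have hZ (s : ℤ) := integrable_tsum_of_summable (P := P) (f := fun j : ℕ ↦ ξ s j)
    (fun j ↦ hsint _ j) hes (fun j ↦ hsint_le _ j)
  have hW (s : ℤ) := integrable_tsum_of_summable (P := P) (f := fun j ω ↦ min (ξ s j ω) 1)
    (fun j ↦ (hsint s j).mono ((hm s j).min measurable_const).aestronglyMeasurable
      (Eventually.of_forall fun ω ↦ abs_min_one_le _)) hes
    (fun j ↦ (integral_mono_of_nonneg (Eventually.of_forall fun _ ↦ abs_nonneg _)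
      (hsint s j).abs (Eventually.of_forall fun ω ↦ abs_min_one_le _)).trans (hsint_le s j))
  have hidV (s : ℤ) : IdentDistrib (fun ω ↦ ∑' j, excess (ξ s j ω))
      (fun ω ↦ ∑' j, excess (ξ 0 j ω)) P P := (hident s).comp measurable_tsum_excess
  have hV (s : ℤ) := memLp_two_tsum (P := P) (f := fun j ω ↦ excess (ξ s j ω))
    (fun j ↦ ((hid s j).comp continuous_excess.measurable).memLp_iff.2 (hexc j)) hes he0
    (fun j ↦ ((hid s j).comp (u := fun x ↦ excess x ^ 2)
      (continuous_excess.pow 2).measurable).integral_eq.trans_le (hexc_le j))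
  refine ⟨fun k ↦ ⟨(hT k).1, (hT k).2.1⟩, fun s ↦ (hW s).2.1, ?_⟩
  -- `κ < α - 1` keeps `∑ j^{κ-α}` finite, and `κ > 1 - 1/α` makes `N^{1-κ}` negligible against
  -- `N^{1/α}`. There is room because `α + 1/α > 2`.
  obtain ⟨κ, hκ1, hκ2⟩ : ∃ κ, 1 - 1 / α < κ ∧ κ < α - 1 := by
    refine exists_between ?_
    have : 2 < α + 1 / α := by
      rw [← sub_pos]
      have : α + 1 / α - 2 = (α - 1) ^ 2 / α := by
        field_simp
        ring
      rw [this]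
      have : 0 < α - 1 := by linarith
      positivity
    linarith
  have hinv : 1 / α < 1 := by rw [div_lt_one (by linarith)]; exact hα₁
  have hκ0 : 0 < κ := by linarith
  have hκ3 : κ < 1 := by linarith
  have hes' : Summable fun j : ℕ ↦ C * ((j : ℝ) + 1) ^ (κ - α) :=
    (summable_add_one_rpow (by linarith)).mul_left C
  set m := ∫ ω, ∑' j, excess (ξ 0 j ω) ∂P with hmdef
  set v := Var[fun ω ↦ ∑' j, excess (ξ 0 j ω); P] with hvdef
  set w := ∫ ω, (truncatedSum fun j ↦ ξ 0 j ω) ∂P with hwdef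
  -- The exponent `1 - κ` comes from the shifts and `1/2` from the centred excesses; both are below
  -- `1/α`, the latter because `α < 2`.
  refine ⟨2 * ∑' j : ℕ, C * ((j : ℝ) + 1) ^ (κ - α) + √v, max (1 - κ) (1 / 2),
    lt_max_of_lt_right (by norm_num), max_lt (by linarith)
      (one_div_lt_one_div_of_lt (by linarith) hα₂), fun N ↦ ?_⟩
  set D : ℕ → Ω → ℝ := fun j ω ↦ ∑ k ∈ Finset.Icc 1 N, (ξ ((k : ℤ) - j) j ω - ξ k j ω) with hD
  have hDint (j : ℕ) : Integrable (D j) P :=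
    integrable_finsetSum _ fun k _ ↦ (hsint _ _).sub (hsint _ _)
  set bD : ℕ → ℝ := fun j ↦ 2 * (C * ((j : ℝ) + 1) ^ (κ - α)) * (N : ℝ) ^ (1 - κ) with hbD
  have hbDs : Summable bD := (hes'.mul_left 2).mul_right _
  have hD_le (j : ℕ) : ∫ ω, |D j ω| ∂P ≤ bD j := by
    refine (integral_abs_sum_shift_sub_le (x := fun s ↦ ξ s j) (fun s ↦ hsint s j)
      (fun s ↦ hsint_le s j) N j).trans ?_
    have h := min_le_rpow_mul_rpow j N hκ0 hκ3
    calc 2 * e j * ((min j N : ℕ) : ℝ)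
        ≤ 2 * e j * (((j : ℝ) + 1) ^ κ * (N : ℝ) ^ (1 - κ)) :=
          mul_le_mul_of_nonneg_left h (by have := he0 j; positivity)
      _ = bD j := by
          simp only [he, hbD]
          rw [sub_eq_add_neg κ α, Real.rpow_add (by positivity)]
          ring
  have hDsum := integrable_tsum_of_summable hDint hbDs hD_le
  -- The mean of each trawl variable is that of the truncated sum plus that of the excess sum, so
  -- the centrings match exactly.
  have hE1 : ∫ ω, ∑ k ∈ Finset.Icc 1 N, ∑' j : ℕ, ξ ((k : ℤ) - j) j ω ∂P = N * (w + m) := by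
    rw [integral_finsetSum (Finset.Icc 1 N) fun (k : ℕ) _ ↦ (hT (k : ℤ)).2.1]
    have h (k : ℤ) : ∫ ω, ∑' j : ℕ, ξ (k - j) j ω ∂P = w + m := by
      rw [(hT k).2.2.1]
      simp_rw [hmean]
      rw [← (hZ 0).2.2.1, hwdef, hmdef]
      refine Eq.trans ?_ (integral_add (hW 0).2.1 ((hV 0).2.integrable one_le_two))
      refine integral_congr_ae ?_
      filter_upwards [(hW 0).1, (hV 0).1] with ω h1 h2
      simp only [truncatedSum]
      rw [← h1.tsum_add h2]
      simp_rw [min_add_excess]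
    simp only [h, Finset.sum_const, Nat.card_Icc, add_tsub_cancel_right, nsmul_eq_mul]
  set V : ℕ → Ω → ℝ := fun s ω ↦ ∑' j, excess (ξ (s : ℤ) j ω) with hVdef
  have hVind : Pairwise fun s t ↦ IndepFun (V s) (V t) P := by
    intro s t hst
    have h : IndepFun (fun ω j ↦ ξ (s : ℤ) j ω) (fun ω j ↦ ξ (t : ℤ) j ω) P :=
      hindep.indepFun (by exact_mod_cast hst)
    exact h.comp measurable_tsum_excess measurable_tsum_excess
  have hVsum := integral_abs_sum_centered_le (V := V) (fun s ↦ (hV s).2) hVind (m := m) (v := v)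
    (fun s ↦ (hidV s).integral_eq) (fun s ↦ (hidV s).variance_eq) (Finset.Icc 1 N)
  have hVsint : Integrable (fun ω ↦ |∑ s ∈ Finset.Icc 1 N, (V s ω - m)|) P :=
    (integrable_finsetSum (f := fun s ω ↦ V s ω - m) (Finset.Icc 1 N) fun (s : ℕ) _ ↦
      ((hV (s : ℤ)).2.integrable one_le_two).sub (integrable_const m)).abs
  -- Pathwise, the error splits into the shift error `∑ D_j` and the centred excess sum.
  have hkey : ∀ᵐ ω ∂P, |(∑ k ∈ Finset.Icc 1 N, ∑' j : ℕ, ξ ((k : ℤ) - j) j ω - N * (w + m)) -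
      ∑ s ∈ Finset.Icc 1 N, ((truncatedSum fun j ↦ ξ (s : ℤ) j ω) - w)| ≤
      |∑' j, D j ω| + |∑ s ∈ Finset.Icc 1 N, (V s ω - m)| := by
    filter_upwards [ae_all_iff.2 fun k ↦ (hT k).1, ae_all_iff.2 fun s ↦ (hW s).1,
      ae_all_iff.2 fun s ↦ (hV s).1, ae_all_iff.2 fun s ↦ (hZ s).1] with ω h1 h2 h3 h4
    refine le_trans (le_of_eq ?_) (abs_add_le _ _)
    congr 1
    have hDω : ∑' j, D j ω = ∑ k ∈ Finset.Icc 1 N, (∑' j : ℕ, ξ ((k : ℤ) - j) j ω -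
        ∑' j : ℕ, ξ (k : ℤ) j ω) := by
      simp only [hD]
      rw [Summable.tsum_finsetSum fun (k : ℕ) _ ↦ (h1 (k : ℤ)).sub (h4 (k : ℤ))]
      exact Finset.sum_congr rfl fun k _ ↦ (h1 k).tsum_sub (h4 k)
    have hZω (s : ℕ) : ∑' j : ℕ, ξ (s : ℤ) j ω = (truncatedSum fun j ↦ ξ (s : ℤ) j ω) + V s ω := by
      simp only [truncatedSum, hVdef]
      rw [← (h2 s).tsum_add (h3 s)]
      simp_rw [min_add_excess]
    rw [hDω]
    simp_rw [hZω]
    simp only [Finset.sum_sub_distrib, Finset.sum_add_distrib, Finset.sum_const, Nat.card_Icc,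
      add_tsub_cancel_right, nsmul_eq_mul]
    ring
  rw [hE1]
  calc _ ≤ ∫ ω, (|∑' j, D j ω| + |∑ s ∈ Finset.Icc 1 N, (V s ω - m)|) ∂P :=
        integral_mono_of_nonneg (Eventually.of_forall fun _ ↦ abs_nonneg _)
          (hDsum.2.1.abs.add hVsint) hkey
    _ = ∫ ω, |∑' j, D j ω| ∂P + ∫ ω, |∑ s ∈ Finset.Icc 1 N, (V s ω - m)| ∂P :=
        integral_add hDsum.2.1.abs hVsint
    _ ≤ ∑' j, bD j + √v * √((Finset.Icc 1 N).card : ℝ) := add_le_add hDsum.2.2.2 hVsum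
    _ = 2 * (∑' j : ℕ, C * ((j : ℝ) + 1) ^ (κ - α)) * (N : ℝ) ^ (1 - κ) +
          √v * (N : ℝ) ^ (1 / 2 : ℝ) := by
        simp only [hbD]
        rw [tsum_mul_right, tsum_mul_left, Nat.card_Icc, add_tsub_cancel_right,
          Real.sqrt_eq_rpow (N : ℝ)]
    _ ≤ 2 * (∑' j : ℕ, C * ((j : ℝ) + 1) ^ (κ - α)) * (N : ℝ) ^ (max (1 - κ) (1 / 2)) +
          √v * (N : ℝ) ^ (max (1 - κ) (1 / 2)) := by
        have h1 := natCast_rpow_le_rpow N (sub_pos.2 hκ3) (le_max_left (1 - κ) (1 / 2))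
        have h2 := natCast_rpow_le_rpow N (p := 1 / 2) (by norm_num) (le_max_right (1 - κ) (1 / 2))
        have h3 : 0 ≤ ∑' j : ℕ, C * ((j : ℝ) + 1) ^ (κ - α) := tsum_nonneg fun j ↦ by positivity
        gcongr
    _ = _ := by ring

end Reduction

/-! ### Asymptotics of the counting function of the trawl. -/

/-- The number of terms of a sequence that are at least `y`. -/
def countGe (a : ℕ → ℝ≥0) (y : ℝ) : ℝ := ∑' j, if y ≤ a j then 1 else 0

lemma measurable_countGe (a : ℕ → ℝ≥0) : Measurable (countGe a) :=
  Measurable.tsum fun _ ↦ Measurable.ite measurableSet_Iic measurable_const measurable_const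

lemma countGe_nonneg (a : ℕ → ℝ≥0) (y : ℝ) : 0 ≤ countGe a y :=
  tsum_nonneg fun j ↦ by split_ifs <;> simp

section CountGe

variable {a : ℕ → ℝ≥0} {α c₀ : ℝ}

lemma exists_countGe_eq_card (ha : Tendsto a atTop (𝓝 0)) {y : ℝ} (hy : 0 < y) :
    ∃ S : Finset ℕ, (∀ j, j ∈ S ↔ y ≤ a j) ∧ countGe a y = S.card := by
  have hlt : ∀ᶠ j in atTop, (a j : ℝ) < y := by
    have h : Tendsto (fun j ↦ (a j : ℝ)) atTop (𝓝 0) := by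
      rw [← NNReal.coe_zero, NNReal.tendsto_coe]
      exact ha
    exact h.eventually (gt_mem_nhds hy)
  obtain ⟨M, hM⟩ := eventually_atTop.1 hlt
  classical
  refine ⟨(Finset.range M).filter fun j ↦ y ≤ a j, fun j ↦ ?_, ?_⟩
  · simp only [Finset.mem_filter, Finset.mem_range, and_iff_right_iff_imp]
    intro h
    by_contra hj
    exact absurd (hM j (not_lt.1 hj)) (not_lt.2 h)
  · unfold countGe
    rw [tsum_eq_sum (s := Finset.range M)]
    · simp
    · intro j hj
      rw [if_neg (not_le.2 (hM j (by simpa using hj)))]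

lemma le_rpow_neg_iff {α c x y : ℝ} (hα : 0 < α) (hc : 0 ≤ c) (hx : 0 < x) (hy : 0 < y) :
    y ≤ c ^ α * x ^ (-α) ↔ x ≤ c * y ^ (-(1 / α)) := by
  rw [Real.rpow_neg hx.le, ← div_eq_mul_inv, ← Real.div_rpow hc hx.le]
  rw [← Real.rpow_inv_le_iff_of_pos hy.le (by positivity) hα, le_div_iff₀ hx,
    Real.rpow_neg hy.le, ← div_eq_mul_inv, le_div_iff₀ (by positivity), one_div, mul_comm]

/-- Indexing by `j + 1` makes the integer part itself bound the count, with no additive constant.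
The bound thus holds for all `y > 0`, as a majorant on the whole half-line requires. -/
lemma countGe_le (hα : 0 < α) (ha : Tendsto a atTop (𝓝 0)) {b : ℝ} (hb : 0 ≤ b)
    (hab : ∀ j, (a j : ℝ) ≤ b ^ α * ((j : ℝ) + 1) ^ (-α)) {y : ℝ} (hy : 0 < y) :
    countGe a y ≤ b * y ^ (-(1 / α)) := by
  obtain ⟨S, hS, hcard⟩ := exists_countGe_eq_card ha hy
  rw [hcard]
  have hsub : S ⊆ Finset.range ⌊b * y ^ (-(1 / α))⌋₊ := by
    intro j hj
    have h := ((hS j).1 hj).trans (hab j)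
    rw [le_rpow_neg_iff hα hb (by positivity) hy] at h
    rw [Finset.mem_range, ← Nat.succ_le_iff]
    exact Nat.le_floor (by push_cast; exact h)
  have h1 := Finset.card_le_card hsub
  rw [Finset.card_range] at h1
  calc (S.card : ℝ) ≤ ⌊b * y ^ (-(1 / α))⌋₊ := by exact_mod_cast h1
    _ ≤ _ := Nat.floor_le (by positivity)

lemma eventually_le_mul_rpow {c d : ℝ} (hcd : c < d)
    (ha : (fun j : ℕ ↦ (a j : ℝ)) ~[atTop] fun j : ℕ ↦ c * (j : ℝ) ^ (-α)) (hc : 0 < c) :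
    ∀ᶠ j : ℕ in atTop, (a j : ℝ) ≤ d * (j : ℝ) ^ (-α) := by
  obtain ⟨w, hw, hv⟩ := ha.exists_eq_mul
  filter_upwards [hv, hw.eventually (gt_mem_nhds ((one_lt_div hc).2 hcd))] with j hj hwj
  rw [hj]
  calc w j * (c * (j : ℝ) ^ (-α)) ≤ d / c * (c * (j : ℝ) ^ (-α)) := by gcongr
    _ = d * (j : ℝ) ^ (-α) := by field_simp

lemma eventually_mul_rpow_le {c d : ℝ} (hcd : d < c)
    (ha : (fun j : ℕ ↦ (a j : ℝ)) ~[atTop] fun j : ℕ ↦ c * (j : ℝ) ^ (-α)) (hc : 0 < c) :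
    ∀ᶠ j : ℕ in atTop, d * (j : ℝ) ^ (-α) ≤ a j := by
  obtain ⟨w, hw, hv⟩ := ha.exists_eq_mul
  filter_upwards [hv, hw.eventually (lt_mem_nhds ((div_lt_one hc).2 hcd))] with j hj hwj
  rw [hj]
  calc d * (j : ℝ) ^ (-α) = d / c * (c * (j : ℝ) ^ (-α)) := by field_simp
    _ ≤ w j * (c * (j : ℝ) ^ (-α)) := by gcongr

/-- Compare `a_j` with `l'^α j^{-α}` for `l'` slightly below or above `c₀^{1/α}`: beyond a fixed `M`
the condition `a_j ≥ y` is controlled by `j ≤ l' y^{-1/α}`. The initial terms and rounding cost a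
bounded number, which `y^{1/α}` sends to zero. -/
lemma tendsto_countGe_mul_rpow (hα : 0 < α) (hc₀ : 0 < c₀)
    (ha : (fun j : ℕ ↦ (a j : ℝ)) ~[atTop] fun j : ℕ ↦ c₀ * (j : ℝ) ^ (-α)) :
    Tendsto (fun y ↦ countGe a y * y ^ (1 / α)) (𝓝[>] 0) (𝓝 (c₀ ^ (1 / α))) := by
  have hlim := tendsto_zero_of_isEquivalent hα ha
  have hpow : Tendsto (fun y : ℝ ↦ y ^ (1 / α)) (𝓝[>] 0) (𝓝 0) := by
    have h : ContinuousAt (fun y : ℝ ↦ y ^ (1 / α)) 0 :=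
      Real.continuousAt_rpow_const _ _ (Or.inr (by positivity))
    have h' := h.tendsto
    rw [Real.zero_rpow (by positivity)] at h'
    exact h'.mono_left nhdsWithin_le_nhds
  have hroot (l : ℝ) (hl : 0 ≤ l) : (l ^ α) ^ (1 / α) = l := by
    rw [← Real.rpow_mul hl, mul_one_div_cancel hα.ne', Real.rpow_one]
  have hcancel {y : ℝ} (hy : 0 < y) : y ^ (-(1 / α)) * y ^ (1 / α) = 1 := by
    rw [← Real.rpow_add hy, neg_add_cancel, Real.rpow_zero]
  refine tendsto_order.2 ⟨fun l hl ↦ ?_, fun l hl ↦ ?_⟩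
  · obtain ⟨l', hl1, hl2⟩ := exists_between (max_lt hl (Real.rpow_pos_of_pos hc₀ (1 / α)))
    have hl0 : 0 < l' := (le_max_right _ _).trans_lt hl1
    have hlt : l' ^ α < c₀ := by
      have := Real.rpow_lt_rpow hl0.le hl2 hα
      rwa [← Real.rpow_mul hc₀.le, one_div_mul_cancel hα.ne', Real.rpow_one] at this
    obtain ⟨M, hM⟩ := eventually_atTop.1 ((eventually_mul_rpow_le hlt ha hc₀).and
      (eventually_ge_atTop 1))
    have hev : Tendsto (fun y : ℝ ↦ l' - M * y ^ (1 / α)) (𝓝[>] 0) (𝓝 l') := by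
      simpa using (hpow.const_mul (M : ℝ)).const_sub l'
    filter_upwards [hev.eventually (lt_mem_nhds ((le_max_left _ _).trans_lt hl1)),
      self_mem_nhdsWithin] with y hy hy0
    refine hy.trans_le ?_
    obtain ⟨S, hS, hcard⟩ := exists_countGe_eq_card hlim hy0
    have hy0' : (0 : ℝ) < y := hy0
    have hsub : Finset.Ico M (⌊l' * y ^ (-(1 / α))⌋₊ + 1) ⊆ S := by
      intro j hj
      rw [Finset.mem_Ico] at hj
      obtain ⟨h1, h2⟩ := hM j hj.1
      refine (hS j).2 (le_trans ?_ h1)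
      rw [le_rpow_neg_iff hα hl0.le (by exact_mod_cast h2) hy0']
      exact (Nat.le_floor_iff (by positivity)).1 (Nat.lt_succ_iff.1 hj.2)
    have h1 := Finset.card_le_card hsub
    rw [Nat.card_Ico, Nat.sub_le_iff_le_add] at h1
    have h2 : (⌊l' * y ^ (-(1 / α))⌋₊ : ℝ) + 1 ≤ S.card + M := by exact_mod_cast h1
    have h3 : l' * y ^ (-(1 / α)) - M ≤ countGe a y := by
      rw [hcard]
      linarith [Nat.lt_floor_add_one (l' * y ^ (-(1 / α)))]
    calc l' - M * y ^ (1 / α) = (l' * y ^ (-(1 / α)) - M) * y ^ (1 / α) := by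
          rw [sub_mul, mul_assoc, hcancel hy0', mul_one]
      _ ≤ countGe a y * y ^ (1 / α) := by gcongr
  · obtain ⟨l', hl1, hl2⟩ := exists_between hl
    have hl0 : 0 < l' := (Real.rpow_pos_of_pos hc₀ (1 / α)).trans hl1
    have hlt : c₀ < l' ^ α := by
      have := Real.rpow_lt_rpow (by positivity) hl1 hα
      rwa [← Real.rpow_mul hc₀.le, one_div_mul_cancel hα.ne', Real.rpow_one] at this
    obtain ⟨M, hM⟩ := eventually_atTop.1 (eventually_le_mul_rpow hlt ha hc₀)
    have hev : Tendsto (fun y : ℝ ↦ l' + (M + 1) * y ^ (1 / α)) (𝓝[>] 0) (𝓝 l') := by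
      simpa using (hpow.const_mul ((M : ℝ) + 1)).const_add l'
    filter_upwards [hev.eventually (gt_mem_nhds hl2), self_mem_nhdsWithin] with y hy hy0
    refine lt_of_le_of_lt ?_ hy
    obtain ⟨S, hS, hcard⟩ := exists_countGe_eq_card hlim hy0
    have hy0' : (0 : ℝ) < y := hy0
    have hsub : S ⊆ Finset.range (⌊l' * y ^ (-(1 / α))⌋₊ + M + 1) := by
      intro j hj
      rw [Finset.mem_range]
      by_contra hlt'
      have hj0 : 0 < j := by omega
      have h1 := ((hS j).1 hj).trans (hM j (by omega))
      rw [le_rpow_neg_iff hα hl0.le (by exact_mod_cast hj0) hy0'] at h1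
      have := Nat.le_floor h1
      omega
    have h1 := Finset.card_le_card hsub
    rw [Finset.card_range] at h1
    have h2 : (S.card : ℝ) ≤ ⌊l' * y ^ (-(1 / α))⌋₊ + M + 1 := by exact_mod_cast h1
    have h3 : countGe a y ≤ l' * y ^ (-(1 / α)) + (M + 1) := by
      rw [hcard]
      have : (⌊l' * y ^ (-(1 / α))⌋₊ : ℝ) ≤ l' * y ^ (-(1 / α)) := Nat.floor_le (by positivity)
      linarith
    calc countGe a y * y ^ (1 / α) ≤ (l' * y ^ (-(1 / α)) + (M + 1)) * y ^ (1 / α) := by gcongr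
      _ = l' + (M + 1) * y ^ (1 / α) := by rw [add_mul, mul_assoc, hcancel hy0', mul_one]

end CountGe

/-- The tail expansion of the characteristic function of the number of terms of a regularly varying
sequence exceeding a random level with density `θ`. -/
theorem tendsto_integral_compExp_countGe {a : ℕ → ℝ≥0} {α c₀ : ℝ} (hα₁ : 1 < α) (hα₂ : α < 2)
    (hc₀ : 0 < c₀) (ha : (fun j : ℕ ↦ (a j : ℝ)) ~[atTop] fun j : ℕ ↦ c₀ * (j : ℝ) ^ (-α))
    {θ : ℝ → ℝ} (hθ_meas : Measurable θ) (hθ_nonneg : ∀ y, 0 ≤ θ y)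
    (hθ_bdd : ∃ C, ∀ y, θ y ≤ C) (hθ_lim : Tendsto θ (𝓝[>] 0) (𝓝 1)) (z : ℝ) :
    Tendsto (fun n : ℕ ↦ (n : ℂ) * ∫ y in Set.Ioi (0 : ℝ),
      (θ y : ℂ) * compExp (z * (n : ℝ) ^ (-(1 / α)) * countGe a y)) atTop
      (𝓝 (stableExponent α c₀ z)) := by
  have hα : 0 < α := by linarith
  obtain ⟨T, hT⟩ := hθ_bdd
  have hT0 : 0 ≤ T := (hθ_nonneg 0).trans (hT 0)
  obtain ⟨C, hC, hCb⟩ := bound_of_isBigO_nat_atTop (isBigO_add_one_rpow hα.le ha)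
  set b : ℝ := C ^ (1 / α) with hb
  have hbα : b ^ α = C := by
    rw [hb, ← Real.rpow_mul hC.le, one_div_mul_cancel hα.ne', Real.rpow_one]
  have hb0 : 0 ≤ b := by positivity
  have hab (j : ℕ) : (a j : ℝ) ≤ b ^ α * ((j : ℝ) + 1) ^ (-α) := by
    rw [hbα]
    have h := hCb (show ((j : ℝ) + 1) ^ (-α) ≠ 0 by positivity)
    rwa [Real.norm_of_nonneg (by positivity), Real.norm_of_nonneg (by positivity)] at h
  have hlim := tendsto_zero_of_isEquivalent hα ha
  -- The integrand after `y = w/n`. The Jacobian absorbs the factor `n`, and `n^{-1/α} A(w/n)` has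
  -- order `w^{-1/α}` uniformly in `n`.
  set F : ℕ → ℝ → ℂ := fun n w ↦
    (θ ((n : ℝ)⁻¹ * w) : ℂ) * compExp (z * (n : ℝ) ^ (-(1 / α)) * countGe a ((n : ℝ)⁻¹ * w)) with hF
  rw [← integral_compExp_eq_stableExponent hα₁ hα₂ hc₀ z]
  have hmain : Tendsto (fun n ↦ ∫ w in Set.Ioi (0 : ℝ), F n w) atTop
      (𝓝 (∫ w in Set.Ioi (0 : ℝ), compExp (z * (c₀ / w) ^ (1 / α)))) := by
    set M := |z| * b with hM
    refine tendsto_integral_filter_of_dominated_convergence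
      (fun w ↦ T * ((2 * M + M ^ 2) * min (w ^ (-(1 / α))) (w ^ (-(2 / α))))) ?_ ?_ ?_ ?_
    · refine Eventually.of_forall fun n ↦ Measurable.aestronglyMeasurable ?_
      have h1 : Measurable fun w : ℝ ↦ (n : ℝ)⁻¹ * w := measurable_const_mul _
      exact (Complex.measurable_ofReal.comp (hθ_meas.comp h1)).mul
        (continuous_compExp.measurable.comp
          (((measurable_countGe a).comp h1).const_mul _))
    · filter_upwards [eventually_gt_atTop 0] with n hn
      filter_upwards [ae_restrict_mem measurableSet_Ioi] with w hw
      have hw0 : 0 < w := hw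
      have hn0 : (0 : ℝ) < n := by exact_mod_cast hn
      simp only [hF]
      rw [norm_mul, Complex.norm_real, Real.norm_of_nonneg (hθ_nonneg _)]
      have hx : |z * (n : ℝ) ^ (-(1 / α)) * countGe a ((n : ℝ)⁻¹ * w)| ≤ M * w ^ (-(1 / α)) := by
        rw [abs_mul, abs_mul, abs_of_nonneg (countGe_nonneg _ _),
          abs_of_nonneg (show (0 : ℝ) ≤ (n : ℝ) ^ (-(1 / α)) by positivity)]
        have h := countGe_le hα hlim hb0 hab (y := (n : ℝ)⁻¹ * w) (by positivity)
        rw [Real.mul_rpow (by positivity) hw0.le, Real.inv_rpow hn0.le] at h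
        calc |z| * (n : ℝ) ^ (-(1 / α)) * countGe a ((n : ℝ)⁻¹ * w) ≤ |z| * (n : ℝ) ^ (-(1 / α)) *
              (b * (((n : ℝ) ^ (-(1 / α)))⁻¹ * w ^ (-(1 / α)))) := by gcongr
          _ = M * w ^ (-(1 / α)) := by
              rw [hM]
              field_simp
      gcongr
      · exact hT _
      · exact norm_compExp_le_min_rpow hw0 hx
    · exact ((integrableOn_min_rpow hα₁ hα₂).const_mul _).const_mul _
    · filter_upwards [ae_restrict_mem measurableSet_Ioi] with w hw
      have hw0 : 0 < w := hw
      have hnw : Tendsto (fun n : ℕ ↦ (n : ℝ)⁻¹ * w) atTop (𝓝[>] 0) := by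
        refine tendsto_nhdsWithin_iff.2 ⟨?_, ?_⟩
        · simpa using (tendsto_inv_atTop_nhds_zero_nat (𝕜 := ℝ)).mul_const w
        · filter_upwards [eventually_gt_atTop 0] with n hn
          have hn0 : (0 : ℝ) < n := by exact_mod_cast hn
          exact mul_pos (inv_pos.2 hn0) hw0
      have h1 := hθ_lim.comp hnw
      have h2 := ((tendsto_countGe_mul_rpow hα hc₀ ha).comp hnw).mul_const (w ^ (-(1 / α)))
      have h3 : Tendsto (fun n : ℕ ↦ z * (n : ℝ) ^ (-(1 / α)) * countGe a ((n : ℝ)⁻¹ * w)) atTop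
          (𝓝 (z * (c₀ / w) ^ (1 / α))) := by
        rw [div_rpow_one_div hc₀.le hw0]
        refine (h2.const_mul z).congr' ?_
        filter_upwards [eventually_gt_atTop 0] with n hn
        have hn0 : (0 : ℝ) < n := by exact_mod_cast hn
        simp only [Function.comp_apply]
        rw [Real.mul_rpow (by positivity) hw0.le, Real.inv_rpow hn0.le, Real.rpow_neg hn0.le,
          Real.rpow_neg hw0.le]
        have : w ^ (1 / α) ≠ 0 := by positivity
        field_simp
      have h4 := (Complex.continuous_ofReal.tendsto _).comp h1
      have h5 := (continuous_compExp.tendsto _).comp h3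
      have h6 := h4.mul h5
      rw [Complex.ofReal_one, one_mul] at h6
      exact h6
  refine hmain.congr' ?_
  filter_upwards [eventually_gt_atTop 0] with n hn
  have hn0 : (0 : ℝ) < n := by exact_mod_cast hn
  have h := integral_comp_mul_left_Ioi (fun y ↦ (θ y : ℂ) *
    compExp (z * (n : ℝ) ^ (-(1 / α)) * countGe a y)) 0 (inv_pos.2 hn0)
  rw [mul_zero, inv_inv, Complex.real_smul, Complex.ofReal_natCast] at h
  exact h


/-! ### The truncated sum as a function of the first jump time. -/

section FirstJump

variable {Ω : Type*} [MeasurableSpace Ω] {P : Measure Ω} [IsProbabilityMeasure P]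

/-- The event of no jump is removed beforehand, since `toReal` would send it to zero; the two
measures then agree on all half-lines. -/
lemma map_toReal_restrict_eq_withDensity {T : Ω → ℝ≥0∞} (hT : Measurable T) {θ : ℝ → ℝ}
    (hθ_meas : Measurable θ) (hθ_nonneg : ∀ y, 0 ≤ θ y) (hθ_bdd : ∃ C, ∀ y, θ y ≤ C)
    (hd : ∀ u : ℝ≥0, P.real {ω | T ω ≤ u} = ∫ y in (0 : ℝ)..u, θ y) :
    (P.restrict {ω | T ω ≠ ∞}).map (fun ω ↦ (T ω).toReal) =
      (volume.restrict (Set.Ioi 0)).withDensity fun y ↦ ENNReal.ofReal (θ y) := by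
  obtain ⟨C, hC⟩ := hθ_bdd
  have hTm : Measurable fun ω ↦ (T ω).toReal := hT.ennreal_toReal
  refine Measure.ext_of_Iic _ _ fun u ↦ ?_
  rw [Measure.map_apply hTm measurableSet_Iic,
    Measure.restrict_apply (hTm measurableSet_Iic), withDensity_apply _ measurableSet_Iic,
    Measure.restrict_restrict measurableSet_Iic]
  rcases lt_or_ge u 0 with hu | hu
  · have h1 : (fun ω ↦ (T ω).toReal) ⁻¹' Set.Iic u = ∅ := by
      ext ω
      simpa using hu.trans_le ENNReal.toReal_nonneg
    have h2 : Set.Iic u ∩ Set.Ioi (0 : ℝ) = ∅ := by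
      ext y
      simp only [Set.mem_inter_iff, Set.mem_Iic, Set.mem_Ioi, Set.mem_empty_iff_false, iff_false,
        not_and, not_lt]
      intro h
      linarith
    simp [h1, h2]
  · lift u to ℝ≥0 using hu
    have h1 : (fun ω ↦ (T ω).toReal) ⁻¹' Set.Iic (u : ℝ) ∩ {ω | T ω ≠ ∞} = {ω | T ω ≤ u} := by
      ext ω
      simp only [Set.mem_inter_iff, Set.mem_preimage, Set.mem_Iic, Set.mem_ofPred_eq]
      constructor
      · rintro ⟨h, h'⟩
        rw [← ENNReal.ofReal_toReal h', ← ENNReal.ofReal_coe_nnreal]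
        exact ENNReal.ofReal_le_ofReal h
      · intro h
        have h' : T ω ≠ ∞ := ne_top_of_le_ne_top ENNReal.coe_ne_top h
        exact ⟨by simpa using ENNReal.toReal_mono ENNReal.coe_ne_top h, h'⟩
    have h2 : Set.Iic (u : ℝ) ∩ Set.Ioi 0 = Set.Ioc 0 (u : ℝ) := by
      rw [Set.inter_comm, Set.Ioi_inter_Iic]
    rw [h1, h2, ← ofReal_measureReal, hd, intervalIntegral.integral_of_le (NNReal.coe_nonneg u),
      ofReal_integral_eq_lintegral_ofReal _ (Eventually.of_forall hθ_nonneg)]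
    refine Measure.integrableOn_of_bounded (M := C) (by simp) hθ_meas.aestronglyMeasurable
      (Eventually.of_forall fun y ↦ ?_)
    rw [Real.norm_of_nonneg (hθ_nonneg y)]
    exact hC y

lemma integral_indicator_toReal_eq {T : Ω → ℝ≥0∞} (hT : Measurable T) {θ : ℝ → ℝ}
    (hθ_meas : Measurable θ) (hθ_nonneg : ∀ y, 0 ≤ θ y) (hθ_bdd : ∃ C, ∀ y, θ y ≤ C)
    (hd : ∀ u : ℝ≥0, P.real {ω | T ω ≤ u} = ∫ y in (0 : ℝ)..u, θ y) {G : ℝ → ℂ}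
    (hG : Measurable G) :
    ∫ ω, {ω | T ω ≠ ∞}.indicator (fun ω ↦ G (T ω).toReal) ω ∂P =
      ∫ y in Set.Ioi (0 : ℝ), (θ y : ℂ) * G y := by
  have hs : MeasurableSet {ω | T ω ≠ ∞} := hT (measurableSet_singleton ∞).compl
  rw [integral_indicator hs, ← integral_map (f := G) hT.ennreal_toReal.aemeasurable
    hG.aestronglyMeasurable,
    map_toReal_restrict_eq_withDensity hT hθ_meas hθ_nonneg hθ_bdd hd,
    integral_withDensity_eq_integral_toReal_smul (by fun_prop) (by simp)]
  refine integral_congr_ae (Eventually.of_forall fun y ↦ ?_)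
  simp only [ENNReal.toReal_ofReal (hθ_nonneg y), Complex.real_smul]

/-- Truncation at one turns `γ(a_j)` into the indicator of `τ₁ ≤ a_j`, so the sum counts the `a_j`
not below `τ₁`. -/
lemma truncatedSum_seedProcess {Ω₀ : Type*} {τ : ℕ → Ω₀ → ℝ≥0∞} (a : ℕ → ℝ≥0) {ω : Ω₀}
    (h : IsJumpSequence fun k ↦ τ k ω) :
    (truncatedSum fun j ↦ seedProcess τ (a j) ω) =
      if τ 1 ω ≠ ∞ then countGe a (τ 1 ω).toReal else 0 := by
  unfold truncatedSum seedProcess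
  simp_rw [h.min_jumpPath_one]
  split_ifs with htop
  · unfold countGe
    refine tsum_congr fun j ↦ ?_
    have : τ 1 ω ≤ a j ↔ (τ 1 ω).toReal ≤ a j := by
      rw [← ENNReal.toReal_le_toReal htop ENNReal.coe_ne_top, ENNReal.coe_toReal]
    simp only [this]
  · rw [not_not] at htop
    simp [htop]

lemma integral_compExp_truncatedSum {τ : ℕ → Ω → ℝ≥0∞} (a : ℕ → ℝ≥0) (hτ_meas : Measurable (τ 1))
    (hτ : ∀ᵐ ω ∂P, IsJumpSequence (fun k ↦ τ k ω))
    {θ : ℝ → ℝ} (hθ_meas : Measurable θ) (hθ_nonneg : ∀ y, 0 ≤ θ y)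
    (hθ_bdd : ∃ C, ∀ y, θ y ≤ C)
    (hθ_density : ∀ u : ℝ≥0, P.real {ω | 0 < τ 1 ω ∧ τ 1 ω ≤ u} = ∫ y in (0 : ℝ)..u, θ y)
    (x : ℝ) :
    ∫ ω, compExp (x * truncatedSum fun j ↦ seedProcess τ (a j) ω) ∂P =
      ∫ y in Set.Ioi (0 : ℝ), (θ y : ℂ) * compExp (x * countGe a y) := by
  have hd (u : ℝ≥0) : P.real {ω | τ 1 ω ≤ u} = ∫ y in (0 : ℝ)..u, θ y := by
    rw [← hθ_density]
    refine measureReal_congr ?_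
    filter_upwards [hτ] with ω hω
    exact propext ⟨fun h ↦ ⟨hω.one_pos, h⟩, fun h ↦ h.2⟩
  rw [← integral_indicator_toReal_eq hτ_meas hθ_meas hθ_nonneg hθ_bdd hd
    (G := fun y ↦ compExp (x * countGe a y))
    (continuous_compExp.measurable.comp ((measurable_countGe a).const_mul x))]
  refine integral_congr_ae ?_
  filter_upwards [hτ] with ω hω
  rw [truncatedSum_seedProcess a hω]
  by_cases htop : τ 1 ω = ∞
  · simp [htop]
  · simp [htop]

end FirstJump

/-! ### The i.i.d. stable limit theorem. -/

section CharFun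

variable {Ω : Type*} [MeasurableSpace Ω] {P : Measure Ω} [IsProbabilityMeasure P]

/-- With `u = z c E W`, this expands `e^{-iu}(1 + iu + E compExp(zcW)) - 1`, using `e^{-iu} =
compExp(-u) + 1 - iu`. For `c = n^{-1/α}` all terms except the last are of order `u²`, hence
`o(1/n)` because `α < 2`. -/
lemma charFun_map_mul_sub {W : Ω → ℝ} (hW : Integrable W P) (c z : ℝ) :
    charFun (P.map fun ω ↦ c * (W ω - ∫ ω', W ω' ∂P)) z - 1 =
      compExp (-(z * c * ∫ ω, W ω ∂P)) * (1 + (z * c * ∫ ω, W ω ∂P) * Complex.I) +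
      (z * c * ∫ ω, W ω ∂P) ^ 2 +
      Complex.exp (-(z * c * ∫ ω, W ω ∂P) * Complex.I) * ∫ ω, compExp (z * c * W ω) ∂P := by
  set m := ∫ ω, W ω ∂P with hm
  have hint : Integrable (fun ω ↦ compExp (z * c * W ω)) P := by
    refine (hW.const_mul (2 * (z * c))).mono ?_ (Eventually.of_forall fun ω ↦ ?_)
    · exact continuous_compExp.comp_aestronglyMeasurable (hW.1.const_mul _)
    · refine (norm_compExp_le _).trans (le_of_eq ?_)
      rw [norm_mul, Real.norm_eq_abs, Real.norm_eq_abs, abs_mul 2, abs_two, abs_mul (z * c)]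
      ring
  have hWc : Integrable (fun ω ↦ ((z * c * W ω : ℝ) : ℂ) * Complex.I) P :=
    ((hW.const_mul (z * c)).ofReal).mul_const _
  have hexp : ∫ ω, Complex.exp ((z * c * W ω : ℝ) * Complex.I) ∂P =
      1 + (z * c * m : ℝ) * Complex.I + ∫ ω, compExp (z * c * W ω) ∂P := by
    have h1 : ∀ ω, Complex.exp ((z * c * W ω : ℝ) * Complex.I) =
        (1 + ((z * c * W ω : ℝ) : ℂ) * Complex.I) + compExp (z * c * W ω) := by
      intro ω
      unfold compExp
      push_cast
      ring
    simp_rw [h1]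
    have h1c : Integrable (fun ω ↦ 1 + ((z * c * W ω : ℝ) : ℂ) * Complex.I) P :=
      (integrable_const 1).add hWc
    rw [integral_add h1c hint, integral_add (integrable_const 1) hWc,
      integral_mul_const, integral_complex_ofReal, integral_const_mul]
    simp [hm]
  have hmeas : AEMeasurable (fun ω ↦ c * (W ω - m)) P :=
    ((hW.1.aemeasurable.sub aemeasurable_const).const_mul c)
  rw [charFun_apply_real, integral_map hmeas (by fun_prop)]
  have h2 : ∀ ω, Complex.exp (z * (c * (W ω - m) : ℝ) * Complex.I) =
      Complex.exp (-(z * c * m) * Complex.I) * Complex.exp ((z * c * W ω : ℝ) * Complex.I) := by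
    intro ω
    rw [← Complex.exp_add]
    congr 1
    push_cast
    ring
  simp_rw [h2]
  rw [integral_const_mul, hexp]
  have h3 : Complex.exp (-(z * c * m) * Complex.I) =
      compExp (-(z * c * m)) + 1 - (z * c * m) * Complex.I := by
    unfold compExp
    push_cast
    ring
  rw [mul_add, h3]
  push_cast
  ring_nf
  simp only [Complex.I_sq]
  ring

lemma tendsto_mul_charFun_sub_one {α c₀ : ℝ} (hα₁ : 1 < α) (hα₂ : α < 2) {W : Ω → ℝ}
    (hW : Integrable W P) (z : ℝ)
    (h : Tendsto (fun n : ℕ ↦ (n : ℂ) * ∫ ω, compExp (z * (n : ℝ) ^ (-(1 / α)) * W ω) ∂P) atTop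
      (𝓝 (stableExponent α c₀ z))) :
    Tendsto (fun n : ℕ ↦ (n : ℂ) *
      (charFun (P.map fun ω ↦ (n : ℝ) ^ (-(1 / α)) * (W ω - ∫ ω', W ω' ∂P)) z - 1)) atTop
      (𝓝 (stableExponent α c₀ z)) := by
  set m := ∫ ω, W ω ∂P with hm
  set u : ℕ → ℝ := fun n ↦ z * (n : ℝ) ^ (-(1 / α)) * m with hu
  have hα : 0 < α := by linarith
  have hinv : 1 / 2 < 1 / α := one_div_lt_one_div_of_lt hα hα₂
  have hu0 : Tendsto u atTop (𝓝 0) := by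
    have := (((tendsto_rpow_neg_atTop (one_div_pos.2 hα)).comp
      tendsto_natCast_atTop_atTop).const_mul z).mul_const m
    rw [mul_zero, zero_mul] at this
    exact this
  have hu2 : Tendsto (fun n : ℕ ↦ (n : ℝ) * u n ^ 2) atTop (𝓝 0) := by
    have := (((tendsto_rpow_neg_atTop (y := 2 / α - 1) (by
      have : 2 / α = 2 * (1 / α) := by ring
      linarith)).comp tendsto_natCast_atTop_atTop).const_mul ((z * m) ^ 2))
    rw [mul_zero] at this
    refine this.congr' ?_
    filter_upwards [eventually_gt_atTop 0] with n hn
    have hn0 : (0 : ℝ) < n := by exact_mod_cast hn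
    have h1 : (n : ℝ) ^ (-(2 / α - 1)) = n * ((n : ℝ) ^ (-(1 / α))) ^ 2 := by
      rw [← Real.rpow_natCast, ← Real.rpow_mul hn0.le]
      nth_rw 2 [← Real.rpow_one (n : ℝ)]
      rw [← Real.rpow_add hn0]
      congr 1
      push_cast
      ring
    simp only [hu, Function.comp_apply]
    rw [h1]
    ring
  have hu2c : Tendsto (fun n : ℕ ↦ (n : ℂ) * (u n : ℂ) ^ 2) atTop (𝓝 0) := by
    have := (Complex.continuous_ofReal.tendsto _).comp hu2
    simpa [Function.comp_def] using this
  have hcomp : Tendsto (fun n : ℕ ↦ (n : ℂ) * compExp (-(u n))) atTop (𝓝 0) := by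
    refine squeeze_zero_norm (fun n ↦ ?_) hu2
    rw [norm_mul, Complex.norm_natCast]
    have := norm_compExp_le_sq (-(u n))
    rw [neg_sq] at this
    gcongr
  have huc : Tendsto (fun n ↦ (u n : ℂ)) atTop (𝓝 0) := by
    simpa [Function.comp_def] using (Complex.continuous_ofReal.tendsto _).comp hu0
  have he : Tendsto (fun n ↦ Complex.exp (-(u n : ℂ) * Complex.I)) atTop (𝓝 1) := by
    have := (Complex.continuous_exp.tendsto _).comp (huc.neg.mul_const Complex.I)
    simpa [Function.comp_def] using this
  have hone : Tendsto (fun n ↦ 1 + (u n : ℂ) * Complex.I) atTop (𝓝 1) := by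
    simpa using (huc.mul_const Complex.I).const_add 1
  have hfinal := ((hcomp.mul hone).add hu2c).add (he.mul h)
  simp only [zero_mul, zero_add, one_mul] at hfinal
  refine hfinal.congr fun n ↦ ?_
  rw [charFun_map_mul_sub hW]
  simp only [hu, ← hm]
  push_cast
  ring

/-- Write `k log φ = (k/n)(n log φ)`. The convergence `φ → 1` makes `φ` eventually nonzero, so the
logarithm can be inverted. -/
lemma tendsto_pow_of_tendsto_mul_sub_one {φ : ℕ → ℂ} {ψ : ℂ} {κ : ℝ} {k : ℕ → ℕ}
    (h : Tendsto (fun n : ℕ ↦ (n : ℂ) * (φ n - 1)) atTop (𝓝 ψ))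
    (hk : Tendsto (fun n ↦ (k n : ℝ) / n) atTop (𝓝 κ)) :
    Tendsto (fun n ↦ φ n ^ k n) atTop (𝓝 (Complex.exp (κ * ψ))) := by
  have hlog := Complex.tendsto_nat_mul_log_one_add_of_tendsto h
  have hφ : Tendsto φ atTop (𝓝 1) := by
    have h1 := (tendsto_inv_atTop_nhds_zero_nat (𝕜 := ℂ)).mul h
    rw [zero_mul] at h1
    have h2 : Tendsto (fun n ↦ φ n - 1) atTop (𝓝 0) := by
      refine h1.congr' ?_
      filter_upwards [eventually_gt_atTop 0] with n hn
      have : (n : ℂ) ≠ 0 := by exact_mod_cast hn.ne'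
      field_simp
    simpa using h2.add_const 1
  have hkc : Tendsto (fun n ↦ (((k n : ℝ) / n : ℝ) : ℂ)) atTop (𝓝 (κ : ℂ)) :=
    (Complex.continuous_ofReal.tendsto _).comp hk
  have := (Complex.continuous_exp.tendsto _).comp (hkc.mul hlog)
  refine this.congr' ?_
  filter_upwards [eventually_gt_atTop 0, hφ.eventually_ne one_ne_zero] with n hn hφn
  have hn0 : (n : ℂ) ≠ 0 := by exact_mod_cast hn.ne'
  simp only [Function.comp_apply, add_sub_cancel]
  have h1 : (((k n : ℝ) / n : ℝ) : ℂ) * (n * Complex.log (φ n)) = k n * Complex.log (φ n) := by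
    push_cast
    field_simp
  rw [h1, Complex.exp_nat_mul, Complex.exp_log hφn]

end CharFun

/-- A frequency `y_i` on the block sum `i` amounts to the coefficient `c s = y_i` on each member of
that block; factorizing over all members and regrouping gives the product over blocks. -/
lemma iIndepFun_sum_of_pairwise_disjoint {Ω : Type*} [MeasurableSpace Ω] {P : Measure Ω}
    {X : ℕ → Ω → ℝ} (hX : ∀ s, Measurable (X s)) (hind : iIndepFun X P) {n : ℕ}
    (B : Fin n → Finset ℕ) (hB : Pairwise fun i j ↦ Disjoint (B i) (B j)) :
    iIndepFun (fun i ω ↦ ∑ s ∈ B i, X s ω) P := by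
  have := hind.isProbabilityMeasure
  have hsm (i : Fin n) : Measurable fun ω ↦ ∑ s ∈ B i, X s ω :=
    Finset.measurable_sum _ fun s _ ↦ hX s
  rw [iIndepFun_iff_charFun_pi fun i ↦ (hsm i).aemeasurable]
  intro y
  have hdisj : ((Finset.univ : Finset (Fin n)) : Set (Fin n)).PairwiseDisjoint B :=
    fun i _ j _ hij ↦ hB hij
  set c : ℕ → ℝ := fun s ↦ ∑ i, if s ∈ B i then y i else 0 with hc
  have hcB (i : Fin n) (s : ℕ) (hs : s ∈ B i) : c s = y i := by
    simp only [hc]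
    rw [Finset.sum_eq_single i, if_pos hs]
    · intro j _ hj
      exact if_neg fun hsj ↦ (Finset.disjoint_left.1 (hB hj) hsj) hs
    · simp
  have hsplit (ω : Ω) : ∑ s ∈ Finset.univ.biUnion B, c s * X s ω =
      ∑ i, y i * ∑ s ∈ B i, X s ω := by
    rw [Finset.sum_biUnion hdisj]
    refine Finset.sum_congr rfl fun i _ ↦ ?_
    rw [Finset.mul_sum]
    exact Finset.sum_congr rfl fun s hs ↦ by rw [hcB i s hs]
  have hcX : iIndepFun (fun s ω ↦ c s * X s ω) P :=
    hind.comp (fun s x ↦ c s * x) fun s ↦ measurable_const_mul _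
  have h1 := congrFun (iIndepFun.charFun_map_fun_finsetSum_eq_prod (s := Finset.univ.biUnion B)
    (X := fun s ω ↦ c s * X s ω) (fun s _ ↦ ((hX s).const_mul (c s)).aemeasurable)
    (hcX.restrict _)) 1
  have hscale (s : ℕ) (r : ℝ) : charFun (P.map fun ω ↦ r * X s ω) 1 = charFun (P.map (X s)) r := by
    rw [charFun_apply_real, charFun_apply_real,
      integral_map ((hX s).const_mul r).aemeasurable (by fun_prop),
      integral_map (hX s).aemeasurable (by fun_prop)]
    simp
  rw [Finset.prod_apply, Finset.prod_biUnion hdisj] at h1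
  simp_rw [hscale] at h1
  have h2 (i : Fin n) : charFun (P.map fun ω ↦ ∑ s ∈ B i, X s ω) (y i) =
      ∏ s ∈ B i, charFun (P.map (X s)) (c s) := by
    rw [iIndepFun.charFun_map_fun_finsetSum_eq_prod (fun s _ ↦ (hX s).aemeasurable)
      (hind.restrict _), Finset.prod_apply]
    exact Finset.prod_congr rfl fun s hs ↦ by rw [hcB i s hs]
  simp_rw [h2]
  rw [← h1, charFun_apply, charFun_apply_real, integral_map (by fun_prop) (by fun_prop),
    integral_map (by fun_prop) (by fun_prop)]
  congr 1 with ω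
  rw [hsplit]
  congr 2
  simp [PiLp.inner_apply]


lemma sum_Icc_one_sub {N M : ℕ} (h : N ≤ M) (f : ℕ → ℝ) :
    ∑ s ∈ Finset.Icc 1 M, f s - ∑ s ∈ Finset.Icc 1 N, f s = ∑ s ∈ Finset.Ioc N M, f s := by
  have h0 (K : ℕ) : Finset.Icc 1 K = Finset.Ioc 0 K := by
    ext
    simp [Nat.succ_le_iff]
  rw [h0, h0, ← Finset.sum_Ioc_consecutive f (Nat.zero_le N) h, add_sub_cancel_left]

lemma tendsto_floor_natCast_mul_div (t : ℝ≥0) :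
    Tendsto (fun n : ℕ ↦ (⌊(n : ℝ≥0) * t⌋₊ : ℝ) / n) atTop (𝓝 (t : ℝ)) := by
  have h := (tendsto_nat_floor_mul_div_atTop t.2).comp tendsto_natCast_atTop_atTop
  refine h.congr fun n ↦ ?_
  simp only [Function.comp_apply]
  have : ⌊(t : ℝ) * (n : ℝ)⌋₊ = ⌊(n : ℝ≥0) * t⌋₊ := by
    refine eq_of_forall_le_iff fun k ↦ ?_
    rw [Nat.le_floor_iff (by positivity), Nat.le_floor_iff zero_le, ← NNReal.coe_le_coe]
    push_cast
    rw [mul_comm]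
  exact congrArg (fun k : ℕ ↦ (k : ℝ) / n) this

lemma IsSkewedStableLevy.charFun_sub {Ω : Type*} [MeasurableSpace Ω] {α c₀ : ℝ}
    {L : ℝ≥0 → Ω → ℝ} {Q : Measure Ω} (hL : IsSkewedStableLevy α c₀ L Q) {s t : ℝ≥0} (hst : s ≤ t)
    (z : ℝ) :
    charFun (Q.map fun ω ↦ L t ω - L s ω) z =
      Complex.exp (((t - s : ℝ) : ℂ) * stableExponent α c₀ z) := by
  have h := (hL.levy.stationary s (t - s)).map_eq
  rw [add_tsub_cancel_of_le hst] at h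
  rw [h, hL.charFun_eq, stableExponent, NNReal.coe_sub hst]
  congr 1
  push_cast
  ring

/-- Functional stable limit theorem, in the sense of finite-dimensional distributions, for partial
sums of independent identically distributed variables. -/
theorem tendstoInDistribution_sum_stable {Ω Ω' : Type*} [MeasurableSpace Ω] [MeasurableSpace Ω']
    {P : Measure Ω} [IsProbabilityMeasure P] {Q : Measure Ω'} [IsProbabilityMeasure Q] {α c₀ : ℝ}
    (hα₁ : 1 < α) (hα₂ : α < 2) {W : ℕ → Ω → ℝ} (hW : ∀ s, Measurable (W s))
    (hind : iIndepFun W P) (hid : ∀ s, IdentDistrib (W s) (W 0) P P) (hint : Integrable (W 0) P)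
    (h : ∀ z : ℝ, Tendsto (fun n : ℕ ↦ (n : ℂ) *
      ∫ ω, compExp (z * (n : ℝ) ^ (-(1 / α)) * W 0 ω) ∂P) atTop (𝓝 (stableExponent α c₀ z)))
    {L : ℝ≥0 → Ω' → ℝ} (hL : IsSkewedStableLevy α c₀ L Q) {m : ℕ} (t : Fin m → ℝ≥0) :
    TendstoInDistribution (fun (n : ℕ) (ω : Ω) (i : Fin m) ↦
      ∑ s ∈ Finset.Icc 1 ⌊(n : ℝ≥0) * t i⌋₊, (n : ℝ) ^ (-(1 / α)) * (W s ω - ∫ ω', W 0 ω' ∂P))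
      atTop (fun (ω : Ω') (i : Fin m) ↦ L (t i) ω) (fun _ ↦ P) Q := by
  set μ := ∫ ω, W 0 ω ∂P with hμ
  set X : ℕ → ℕ → Ω → ℝ := fun n s ω ↦ (n : ℝ) ^ (-(1 / α)) * (W s ω - μ) with hX
  have hXm (n s : ℕ) : Measurable (X n s) := ((hW s).sub_const μ).const_mul _
  have hXi (n : ℕ) : iIndepFun (X n) P :=
    hind.comp (fun _ x ↦ (n : ℝ) ^ (-(1 / α)) * (x - μ)) fun _ ↦ by fun_prop
  have hmono (n : ℕ) {s t : ℝ≥0} (hst : s ≤ t) : ⌊(n : ℝ≥0) * s⌋₊ ≤ ⌊(n : ℝ≥0) * t⌋₊ := by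
    gcongr
  refine tendstoInDistribution_of_hasIndepIncrements
    (Y := fun n t ω ↦ ∑ s ∈ Finset.Icc 1 ⌊(n : ℝ≥0) * t⌋₊, X n s ω)
    (fun n t ↦ (Finset.measurable_sum _ fun s _ ↦ hXm n s).aemeasurable)
    (fun t ↦ (hL.levy.measurable t).aemeasurable) (fun n k T hT ↦ ?_) hL.levy.indep
    (fun n ↦ Eventually.of_forall fun ω ↦ by simp) hL.levy.zero (fun s t hst z ↦ ?_) t
  · have hdisj : Pairwise fun i j : Fin k ↦
        Disjoint (Finset.Ioc ⌊(n : ℝ≥0) * T i.castSucc⌋₊ ⌊(n : ℝ≥0) * T i.succ⌋₊)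
          (Finset.Ioc ⌊(n : ℝ≥0) * T j.castSucc⌋₊ ⌊(n : ℝ≥0) * T j.succ⌋₊) := by
      have hlt (i j : Fin k) (hij : i < j) :
          Disjoint (Finset.Ioc ⌊(n : ℝ≥0) * T i.castSucc⌋₊ ⌊(n : ℝ≥0) * T i.succ⌋₊)
            (Finset.Ioc ⌊(n : ℝ≥0) * T j.castSucc⌋₊ ⌊(n : ℝ≥0) * T j.succ⌋₊) := by
        have hle : ⌊(n : ℝ≥0) * T i.succ⌋₊ ≤ ⌊(n : ℝ≥0) * T j.castSucc⌋₊ := hmono n (hT (by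
          rw [Fin.le_def]
          simpa using hij))
        refine Finset.disjoint_left.2 fun u hu hu' ↦ ?_
        rw [Finset.mem_Ioc] at hu hu'
        omega
      intro i j hij
      rcases lt_or_gt_of_ne hij with h | h
      · exact hlt i j h
      · exact (hlt j i h).symm
    have hblock := iIndepFun_sum_of_pairwise_disjoint (hXm n) (hXi n) _ hdisj
    refine hblock.congr fun i ↦ Eventually.of_forall fun ω ↦ ?_
    exact (sum_Icc_one_sub (hmono n (hT (Fin.castSucc_le_succ i))) fun s ↦ X n s ω).symm
  · rw [hL.charFun_sub hst]
    have hφ := tendsto_mul_charFun_sub_one hα₁ hα₂ hint z (h z)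
    have hk : Tendsto (fun n : ℕ ↦ ((⌊(n : ℝ≥0) * t⌋₊ - ⌊(n : ℝ≥0) * s⌋₊ : ℕ) : ℝ) / n) atTop
        (𝓝 ((t : ℝ) - s)) := by
      refine ((tendsto_floor_natCast_mul_div t).sub (tendsto_floor_natCast_mul_div s)).congr
        fun n ↦ ?_
      rw [Nat.cast_sub (hmono n hst), sub_div]
    refine (tendsto_pow_of_tendsto_mul_sub_one hφ hk).congr fun n ↦ ?_
    have hXid (s : ℕ) : P.map (X n s) = P.map (X n 0) :=
      ((hid s).comp (u := fun x ↦ (n : ℝ) ^ (-(1 / α)) * (x - μ)) (by fun_prop)).map_eq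
    simp_rw [sum_Icc_one_sub (hmono n hst)]
    rw [iIndepFun.charFun_map_fun_finsetSum_eq_prod (fun s _ ↦ (hXm n s).aemeasurable)
      ((hXi n).restrict _), Finset.prod_apply]
    simp_rw [hXid]
    rw [Finset.prod_const, Nat.card_Ioc]

/-! ### Moment bounds for the seed process along the trawl. -/

section Seed

variable {Ω : Type*} [MeasurableSpace Ω] {P : Measure Ω} [IsProbabilityMeasure P]
  {τ : ℕ → Ω → ℝ≥0∞} {α c₀ : ℝ} {a : ℕ → ℝ≥0}

/-- The truncated part has mean `P(τ₁ ≤ a_j) = O(a_j)` by the bounded density. The excess has `L²`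
norm, hence mean, `O(a_j)`. The constant `C₁ + √C₂` serves both the first moment and the second
moment of the excess. -/
lemma exists_seedProcess_bounds (hα : 0 < α) (hc₀ : 0 < c₀)
    (ha : (fun j : ℕ ↦ (a j : ℝ)) ~[atTop] fun j : ℕ ↦ c₀ * (j : ℝ) ^ (-α))
    (hτ_meas : ∀ k, Measurable (τ k)) (hτ : ∀ᵐ ω ∂P, IsJumpSequence (fun k ↦ τ k ω))
    (hm : ∀ u, AEMeasurable (seedProcess τ u) P)
    {θ : ℝ → ℝ} (hθ_nonneg : ∀ y, 0 ≤ θ y) (hθ_bdd : ∃ C, ∀ y, θ y ≤ C)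
    (hθ_density : ∀ u : ℝ≥0, P.real {ω | 0 < τ 1 ω ∧ τ 1 ω ≤ u} = ∫ y in (0 : ℝ)..u, θ y)
    {δ : ℝ} (hδ : 0 ≤ δ)
    (hZ1 : ∀ u : ℝ≥0, 0 < u → Integrable (fun ω ↦ seedProcess τ u ω ^ (2 + δ)) P)
    (hZ2 : (fun u : ℝ≥0 ↦ ∫ ω, {ω | τ 2 ω ≤ u}.indicator (fun ω ↦ seedProcess τ u ω ^ 2) ω ∂P)
      =O[𝓝[>] 0] fun u : ℝ≥0 ↦ (u : ℝ) ^ 2) :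
    ∃ C : ℝ, ∀ j, Integrable (seedProcess τ (a j)) P ∧
      ∫ ω, |(seedProcess τ (a j) ω)| ∂P ≤ C * ((j : ℝ) + 1) ^ (-α) ∧
      MemLp (fun ω ↦ excess (seedProcess τ (a j) ω)) 2 P ∧
      ∫ ω, excess (seedProcess τ (a j) ω) ^ 2 ∂P ≤ (C * ((j : ℝ) + 1) ^ (-α)) ^ 2 := by
  have hsq := integrable_seedProcess_sq hτ hm hδ hZ1
  have hnn (u : ℝ≥0) (ω : Ω) : 0 ≤ seedProcess τ u ω := jumpPath_nonneg _ _
  obtain ⟨C₁, hC₁⟩ := exists_measureReal_jump_le hα.le ha hτ hθ_nonneg hθ_bdd hθ_density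
  obtain ⟨C₂, hC₂⟩ := exists_integral_excess_sq_le hα hc₀ ha hτ (hτ_meas 2) hsq hZ2
  have hC₁0 : 0 ≤ C₁ := by simpa using measureReal_nonneg.trans (hC₁ 0)
  have hC₂0 : 0 ≤ C₂ := by
    simpa using (integral_nonneg fun ω ↦ sq_nonneg (excess (seedProcess τ (a 0) ω))).trans (hC₂ 0)
  refine ⟨C₁ + √C₂, fun j ↦ ?_⟩
  have hseed : MemLp (seedProcess τ (a j)) 2 P :=
    (memLp_two_iff_integrable_sq (hm _).aestronglyMeasurable).2 (hsq _)
  have hexc : MemLp (fun ω ↦ excess (seedProcess τ (a j) ω)) 2 P :=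
    hseed.mono (continuous_excess.comp_aestronglyMeasurable hseed.1)
      (Eventually.of_forall fun ω ↦ by
        rw [Real.norm_of_nonneg (excess_nonneg _), Real.norm_of_nonneg (hnn _ _)]
        exact excess_le (hnn _ _))
  set b := ((j : ℝ) + 1) ^ (-α) with hb
  have hb0 : 0 ≤ b := by positivity
  have hb2 : ((j : ℝ) + 1) ^ (-(2 * α)) = b ^ 2 := by
    rw [hb, ← Real.rpow_natCast, ← Real.rpow_mul (by positivity)]
    congr 1
    push_cast
    ring
  have hE2 := hC₂ j
  rw [hb2] at hE2
  have hE1 : ∫ ω, excess (seedProcess τ (a j) ω) ∂P ≤ √C₂ * b := by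
    have hvar := variance_nonneg (fun ω ↦ excess (seedProcess τ (a j) ω)) P
    rw [variance_eq_sub hexc] at hvar
    refine abs_le_of_sq_le_sq' ?_ (by positivity) |>.2
    rw [mul_pow, Real.sq_sqrt hC₂0]
    simp only [Pi.pow_apply] at hvar
    linarith
  have hmin : ∫ ω, min (seedProcess τ (a j) ω) 1 ∂P ≤ C₁ * b := by
    refine le_trans (le_of_eq ?_) (hC₁ j)
    rw [← integral_indicator_one (measurableSet_le (hτ_meas 1) measurable_const)]
    refine integral_congr_ae ?_
    filter_upwards [hτ] with ω hω
    simp only [seedProcess, hω.min_jumpPath_one, Set.indicator_apply, Set.mem_ofPred_eq,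
      Pi.one_apply]
  have hint := hseed.integrable one_le_two
  refine ⟨hint, ?_, hexc, hE2.trans ?_⟩
  · have hminint : Integrable (fun ω ↦ min (seedProcess τ (a j) ω) 1) P :=
      hint.inf (integrable_const 1)
    calc ∫ ω, |(seedProcess τ (a j) ω)| ∂P
        = ∫ ω, (min (seedProcess τ (a j) ω) 1 + excess (seedProcess τ (a j) ω)) ∂P := by
          simp_rw [min_add_excess, abs_of_nonneg (hnn _ _)]
      _ = _ := integral_add hminint (hexc.integrable one_le_two)
      _ ≤ C₁ * b + √C₂ * b := add_le_add hmin hE1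
      _ = (C₁ + √C₂) * b := by ring
  · rw [mul_pow]
    have : C₂ ≤ (C₁ + √C₂) ^ 2 := by
      nth_rw 1 [← Real.sq_sqrt hC₂0]
      exact pow_le_pow_left₀ (Real.sqrt_nonneg _) (by linarith) 2
    gcongr

end Seed

/-! ### Negligibility of the error and conclusion. -/

lemma tendsto_rpow_neg_mul_floor_rpow {K ρ α : ℝ} (hρ : 0 < ρ) (hρα : ρ < 1 / α) (t : ℝ≥0) :
    Tendsto (fun n : ℕ ↦ (n : ℝ) ^ (-(1 / α)) * (K * (⌊(n : ℝ≥0) * t⌋₊ : ℝ) ^ ρ)) atTop (𝓝 0) := by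
  have h1 := ((tendsto_rpow_neg_atTop (sub_pos.2 hρα)).comp tendsto_natCast_atTop_atTop).const_mul K
  have h2 := (tendsto_floor_natCast_mul_div t).rpow_const (p := ρ) (Or.inr hρ.le)
  have h3 := h1.mul h2
  rw [mul_zero, zero_mul] at h3
  refine h3.congr' ?_
  filter_upwards [eventually_gt_atTop 0] with n hn
  have hn0 : (0 : ℝ) < n := by exact_mod_cast hn
  simp only [Function.comp_apply]
  rw [Real.div_rpow (by positivity) hn0.le, neg_sub, sub_eq_add_neg, Real.rpow_add hn0]
  have : (n : ℝ) ^ ρ ≠ 0 := by positivity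
  field_simp

lemma tendstoInMeasure_pi_of_tendsto_integral {Ω : Type*} [MeasurableSpace Ω] {P : Measure Ω}
    {m : ℕ} {D : ℕ → Ω → Fin m → ℝ} (hD : ∀ n i, Integrable (fun ω ↦ D n ω i) P)
    (h : ∀ i, Tendsto (fun n ↦ ∫ ω, |D n ω i| ∂P) atTop (𝓝 0)) :
    TendstoInMeasure P D atTop 0 := by
  have hDm (n : ℕ) : AEStronglyMeasurable (D n) P :=
    (aemeasurable_pi_iff.2 fun i ↦ (hD n i).1.aemeasurable).aestronglyMeasurable
  refine tendstoInMeasure_of_tendsto_eLpNorm one_ne_zero hDm aestronglyMeasurable_zero ?_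
  have hsum : Tendsto (fun n ↦ ENNReal.ofReal (∑ i, ∫ ω, |D n ω i| ∂P)) atTop (𝓝 0) := by
    rw [← ENNReal.ofReal_zero]
    refine ENNReal.tendsto_ofReal ?_
    simpa using tendsto_finsetSum Finset.univ fun i _ ↦ h i
  refine tendsto_of_tendsto_of_tendsto_of_le_of_le tendsto_const_nhds hsum (fun _ ↦ zero_le)
    fun n ↦ ?_
  have hint : Integrable (fun ω ↦ ∑ i, |D n ω i|) P :=
    integrable_finsetSum _ fun i _ ↦ (hD n i).abs
  rw [sub_zero, ← integral_finsetSum _ fun i _ ↦ (hD n i).abs,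
    eLpNorm_one_eq_lintegral_enorm,
    ofReal_integral_eq_lintegral_ofReal hint (Eventually.of_forall fun ω ↦
      Finset.sum_nonneg fun i _ ↦ abs_nonneg _)]
  refine lintegral_mono fun ω ↦ ?_
  rw [← ofReal_norm]
  refine ENNReal.ofReal_le_ofReal ((pi_norm_le_iff_of_nonneg
    (Finset.sum_nonneg fun i _ ↦ abs_nonneg _)).2 fun i ↦ ?_)
  exact Finset.single_le_sum (f := fun i ↦ |D n ω i|) (fun i _ ↦ abs_nonneg _) (Finset.mem_univ i)


end

theorem theorem2 {Ω Ω₀ : Type*} [MeasurableSpace Ω] [MeasurableSpace Ω₀]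
    (P : Measure Ω) [IsProbabilityMeasure P] (P₀ : Measure Ω₀) [IsProbabilityMeasure P₀]
    -- the trawl: `a_j ~ c₀ j^{-α}`
    (α c₀ : ℝ) (hα₁ : 1 < α) (hα₂ : α < 2) (hc₀ : 0 < c₀)
    (a : ℕ → ℝ≥0)
    (ha : (fun j : ℕ ↦ (a j : ℝ)) ~[atTop] fun j : ℕ ↦ c₀ * (j : ℝ) ^ (-α))
    -- the generic seed process, through its jump times
    (τ : ℕ → Ω₀ → ℝ≥0∞) (hτ_meas : ∀ k, Measurable (τ k))
    (hτ : ∀ᵐ ω ∂P₀, IsJumpSequence (fun k ↦ τ k ω))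
    -- the first jump time has a bounded density `θ` with `θ(0+) = 1`
    (θ : ℝ → ℝ) (hθ_meas : Measurable θ) (hθ_nonneg : ∀ y, 0 ≤ θ y)
    (hθ_bdd : ∃ C, ∀ y, θ y ≤ C)
    (hθ_density : ∀ u : ℝ≥0, P₀.real {ω | 0 < τ 1 ω ∧ τ 1 ω ≤ u} = ∫ y in (0 : ℝ)..u, θ y)
    (hθ_lim : Tendsto θ (𝓝[>] 0) (𝓝 1))
    -- the moment conditions
    (δ : ℝ) (hδ : 2 * (α - 1) < δ)
    (hZ1 : ∀ u : ℝ≥0, 0 < u → Integrable (fun ω ↦ seedProcess τ u ω ^ (2 + δ)) P₀)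
    (hZ2 : (fun u : ℝ≥0 ↦ ∫ ω, {ω | τ 2 ω ≤ u}.indicator (fun ω ↦ seedProcess τ u ω ^ 2) ω ∂P₀)
      =O[𝓝[>] 0] fun u : ℝ≥0 ↦ (u : ℝ) ^ 2)
    -- the independent copies of the seed process
    (γ : ℤ → ℝ≥0 → Ω → ℝ) (hγ : IsIIDCopies γ P (seedProcess τ) P₀) :
    -- the trawl process is well defined and integrable
    (∀ k : ℤ, (∀ᵐ ω ∂P, Summable fun j : ℕ ↦ γ (k - j) (a j) ω) ∧ Integrable (trawl γ a k) P) ∧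
    -- the limit process exists
    (∃ (Ω' : Type) (_ : MeasurableSpace Ω') (Q : Measure Ω') (L : ℝ≥0 → Ω' → ℝ),
      IsProbabilityMeasure Q ∧ IsSkewedStableLevy α c₀ L Q) ∧
    -- convergence of the finite-dimensional distributions
    (∀ (Ω' : Type*) [MeasurableSpace Ω'] (Q : Measure Ω') [IsProbabilityMeasure Q]
      (L : ℝ≥0 → Ω' → ℝ), IsSkewedStableLevy α c₀ L Q →
      ∀ (m : ℕ) (t : Fin m → ℝ≥0),
        TendstoInDistribution
          (fun (n : ℕ) (ω : Ω) (i : Fin m) ↦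
            (n : ℝ) ^ (-(1 / α)) *
              (trawlSum γ a ⌊(n : ℝ≥0) * t i⌋₊ ω - ∫ ω', trawlSum γ a ⌊(n : ℝ≥0) * t i⌋₊ ω' ∂P))
          atTop (fun (ω : Ω') (i : Fin m) ↦ L (t i) ω) (fun _ ↦ P) Q) := by
  have hα : 0 < α := by linarith
  have hδ0 : 0 ≤ δ := by linarith
  -- Measurability of the generic seed is contained in its identity in law with a copy.
  have hseed_meas (u : ℝ≥0) : AEMeasurable (seedProcess τ u) P₀ :=
    (measurable_pi_apply u).comp_aemeasurable (hγ.ident 0).aemeasurable_snd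
  obtain ⟨C, hC⟩ := exists_seedProcess_bounds hα hc₀ ha hτ_meas hτ hseed_meas hθ_nonneg hθ_bdd
    hθ_density hδ0 hZ1 hZ2
  have hrestr : Measurable fun (x : ℝ≥0 → ℝ) (j : ℕ) ↦ x (a j) :=
    measurable_pi_lambda _ fun j ↦ measurable_pi_apply (a j)
  -- Only the values at the countably many levels `a_j` matter, so each copy is restricted to a
  -- random sequence.
  have hindep : iIndepFun (fun (s : ℤ) (ω : Ω) (j : ℕ) ↦ γ s (a j) ω) P :=
    hγ.indep.comp (fun _ x j ↦ x (a j)) fun _ ↦ hrestr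
  have hid_seed (s : ℤ) : IdentDistrib (fun (ω : Ω) (j : ℕ) ↦ γ s (a j) ω)
      (fun (ω : Ω₀) (j : ℕ) ↦ seedProcess τ (a j) ω) P P₀ := (hγ.ident s).comp hrestr
  have hid_copy (s : ℤ) : IdentDistrib (fun (ω : Ω) (j : ℕ) ↦ γ s (a j) ω)
      (fun (ω : Ω) (j : ℕ) ↦ γ 0 (a j) ω) P P := (hid_seed s).trans (hid_seed 0).symm
  have hid (j : ℕ) : IdentDistrib (γ 0 (a j)) (seedProcess τ (a j)) P P₀ :=
    (hid_seed 0).comp (measurable_pi_apply j)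
  obtain ⟨htrawl, hW_int, K, ρ, hρ, hρα, hK⟩ := exists_integral_abs_trawlSum_sub_le
    (ξ := fun s j ω ↦ γ s (a j) ω) (C := C) hα₁ hα₂ (fun s j ↦ hγ.measurable s (a j)) hindep hid_copy
    (fun j ↦ (hid j).integrable_iff.2 (hC j).1)
    (fun j ↦ ((hid j).comp (u := fun x : ℝ ↦ |x|) (by fun_prop)).integral_eq.trans_le (hC j).2.1)
    (fun j ↦ ((hid j).comp continuous_excess.measurable).memLp_iff.2 (hC j).2.2.1)
    (fun j ↦ ((hid j).comp (u := fun x ↦ excess x ^ 2)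
      (continuous_excess.pow 2).measurable).integral_eq.trans_le (hC j).2.2.2)
  refine ⟨htrawl, exists_isSkewedStableLevy hα₁ hα₂ hc₀, fun Ω' _ Q _ L hL m t ↦ ?_⟩
  set W : ℕ → Ω → ℝ := fun s ω ↦ truncatedSum fun j ↦ γ (s : ℤ) (a j) ω with hW
  have hWm (s : ℕ) : Measurable (W s) :=
    measurable_truncatedSum.comp (measurable_pi_lambda _ fun j ↦ hγ.measurable s (a j))
  have hWi : iIndepFun W P :=
    (hindep.precomp (g := fun s : ℕ ↦ (s : ℤ)) Nat.cast_injective).comp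
      (fun _ ↦ truncatedSum) fun _ ↦ measurable_truncatedSum
  have hWid (s : ℕ) : IdentDistrib (W s) (W 0) P P := (hid_copy s).comp measurable_truncatedSum
  have hlim (z : ℝ) : Tendsto (fun n : ℕ ↦ (n : ℂ) *
      ∫ ω, compExp (z * (n : ℝ) ^ (-(1 / α)) * W 0 ω) ∂P) atTop (𝓝 (stableExponent α c₀ z)) := by
    refine (tendsto_integral_compExp_countGe hα₁ hα₂ hc₀ ha hθ_meas hθ_nonneg hθ_bdd hθ_lim
      z).congr fun n ↦ ?_
    rw [← integral_compExp_truncatedSum a (hτ_meas 1) hτ hθ_meas hθ_nonneg hθ_bdd hθ_density]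
    congr 1
    exact ((hid_seed 0).comp (u := fun x ↦ compExp (z * (n : ℝ) ^ (-(1 / α)) * truncatedSum x))
      (continuous_compExp.measurable.comp
        (measurable_truncatedSum.const_mul _))).integral_eq.symm
  have hmain := tendstoInDistribution_sum_stable hα₁ hα₂ hWm hWi hWid (hW_int 0) hlim hL t
  have hsum_int (N : ℕ) : Integrable (trawlSum γ a N) P :=
    integrable_finsetSum _ fun k _ ↦ (htrawl k).2
  have hWsum_int (n N : ℕ) : Integrable (fun ω ↦ ∑ s ∈ Finset.Icc 1 N,
      (n : ℝ) ^ (-(1 / α)) * (W s ω - ∫ ω', W 0 ω' ∂P)) P :=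
    integrable_finsetSum _ fun s _ ↦ ((hW_int s).sub (integrable_const _)).const_mul _
  have hnorm_int (n : ℕ) (i : Fin m) : Integrable (fun ω ↦ (n : ℝ) ^ (-(1 / α)) *
      (trawlSum γ a ⌊(n : ℝ≥0) * t i⌋₊ ω - ∫ ω', trawlSum γ a ⌊(n : ℝ≥0) * t i⌋₊ ω' ∂P)) P :=
    ((hsum_int _).sub (integrable_const _)).const_mul _
  -- Slutsky: the normalized trawl sums differ from the i.i.d. sums by a vector whose coordinates
  -- tend to zero in `L¹`.
  refine tendstoInDistribution_of_tendstoInMeasure_sub _ _ hmain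
    (tendstoInMeasure_pi_of_tendsto_integral (fun n i ↦ ?_) fun i ↦ ?_)
    fun n ↦ aemeasurable_pi_iff.2 fun i ↦ (hnorm_int n i).1.aemeasurable
  · exact (hnorm_int n i).sub (hWsum_int n _)
  · refine squeeze_zero (fun n ↦ integral_nonneg fun ω ↦ abs_nonneg _) (fun n ↦ ?_)
      (tendsto_rpow_neg_mul_floor_rpow (K := K) hρ hρα (t i))
    have h := hK ⌊(n : ℝ≥0) * t i⌋₊
    calc _ = ∫ ω, (n : ℝ) ^ (-(1 / α)) * |(trawlSum γ a ⌊(n : ℝ≥0) * t i⌋₊ ω -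
            ∫ ω', trawlSum γ a ⌊(n : ℝ≥0) * t i⌋₊ ω' ∂P) -
          ∑ s ∈ Finset.Icc 1 ⌊(n : ℝ≥0) * t i⌋₊, (W s ω - ∫ ω', W 0 ω' ∂P)| ∂P := by
          refine integral_congr_ae (Eventually.of_forall fun ω ↦ ?_)
          simp only [Pi.sub_apply]
          rw [← Finset.mul_sum, ← mul_sub, abs_mul,
            abs_of_nonneg (show (0 : ℝ) ≤ (n : ℝ) ^ (-(1 / α)) by positivity)]
      _ = (n : ℝ) ^ (-(1 / α)) * ∫ ω, |(trawlSum γ a ⌊(n : ℝ≥0) * t i⌋₊ ω -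
            ∫ ω', trawlSum γ a ⌊(n : ℝ≥0) * t i⌋₊ ω' ∂P) -
          ∑ s ∈ Finset.Icc 1 ⌊(n : ℝ≥0) * t i⌋₊, (W s ω - ∫ ω', W 0 ω' ∂P)| ∂P :=
          integral_const_mul _ _
      _ ≤ _ := mul_le_mul_of_nonneg_left h (by positivity)
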